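/- **Theorem (Width-depth trade-offs).** There are absolute constants $A,B,\delta>0$ such that the following holds for all integers $n,k,c$ with $3\le c\le k-1<\frac{n}{2\ln n}$ (so $n \geq 2$). There is a $4$-CNF formula $F$, namely a compressed Tseitin formula, with $N$ variables, such that 1. $2k^2n^{c+1}\le N\le 40k^2(2n)^{c+1}$, and $F$ has linear size: the sum of the widths of its clauses is at most $A\cdot N$; 2. $F$ has a resolution refutation of width at most $k+3$ and size at most $B\,k^2(4n)^k$; 3. every resolution refutation of $F$ of width at most $k+c$ has depth at least $\delta\, n^k$. Here the width of a clause is its number of literals, a $4$-CNF is a CNF formula with clauses of width at most 4, and a resolution refutation of $F$ is a sequence of clauses ending in the empty clause, each of which is a clause of $F$ or is derived from two specified earlier clauses by the rule $C\vee x,\ D\vee\overline{x}\vdash C\vee D$. Its width is the maximal width of its clauses, its size is the number of its clauses, and its depth is the number of edges in a longest path of the DAG that has an edge from each premise to the clause derived from it. A compressed Tseitin formula is given by a finite simple graph $G$ with an ordered list of neighbours at each vertex, an equivalence relation $\equiv_V$ on $V(G)$ such that equivalent vertices are non-adjacent and have the same degree, and labels $\chi\colon V(G)\to\mathbb{F}_2$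 that are constant on the classes of $\equiv_V$ and sum to $1$. The Tseitin formula of $(G,\chi)$ has a variable $x_e$ for each edge $e$ and consists, for each vertex $v$, of the clauses expressing $\sum_{e\ni v}x_e=\chi(v)$ in $\mathbb{F}_2$. Let $\equiv_E$ be the equivalence relation on $E(G)$ generated by identifying, for all $v\equiv_V v'$ and all $i$, the edge from $v$ to its $i$th neighbour with the edge from $v'$ to its $i$th neighbour. The compressed Tseitin formula arises by replacing each $x_e$ by one variable for the $\equiv_E$-class of $e$ (tautological clauses are dropped). -/

import Mathlib

/-! ### Clauses, CNF formulas and their measures -/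

/-- A literal over the variables `X`: `(x, true)` is `x`, `(x, false)` is the negation of `x`. -/
abbrev Literal (X : Type*) := X × Bool

/-- A clause: a finite set of literals over pairwise distinct variables. -/
abbrev Clause (X : Type*) :=
  {C : Finset (Literal X) // ∀ x, ¬ ((x, true) ∈ C ∧ (x, false) ∈ C)}

/-- A CNF formula, viewed as a finite set of clauses. -/
abbrev CNF (X : Type*) := Finset (Clause X)

/-- The width of a clause: its number of literals. -/
def Clause.width {X : Type*} (C : Clause X) : ℕ := C.1.card

/-- `F` is a `w`-CNF formula if all its clauses have width at most `w`. -/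
def CNF.IsKCNF {X : Type*} (w : ℕ) (F : CNF X) : Prop := ∀ C ∈ F, Clause.width C ≤ w

/-- The size of a formula: the sum of the widths of its clauses. -/
def CNF.size {X : Type*} (F : CNF X) : ℕ := ∑ C ∈ F, Clause.width C

open scoped Classical in
/-- The set of variables that appear in a formula. -/
noncomputable def CNF.vars {X : Type*} (F : CNF X) : Finset X :=
  F.biUnion fun C => C.1.image Prod.fst

open scoped Classical in
/-- The resolution rule: from `C ∨ x` and `D ∨ ¬ x` derive `C ∨ D`. -/
def IsResolvent {X : Type*} (C₁ C₂ D : Clause X) : Prop :=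
  ∃ x, (x, true) ∈ C₁.1 ∧ (x, false) ∈ C₂.1 ∧
    D.1 = C₁.1.erase (x, true) ∪ C₂.1.erase (x, false)

/-! ### Resolution refutations -/

/-- A resolution refutation of `F`: a sequence of clauses ending in the empty clause, each of which
is a clause of `F` (`premises i = none`) or is derived by the resolution rule from two specified
earlier clauses. -/
structure Refutation {X : Type*} (F : CNF X) where
  /-- the number of clauses in the sequence -/
  size : ℕ
  clause : Fin size → Clause X
  premises : Fin size → Option (Fin size × Fin size)
  axiom_mem : ∀ i, premises i = none → clause i ∈ F
  resolve : ∀ i j l, premises i = some (j, l) →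
    j < i ∧ l < i ∧ IsResolvent (clause j) (clause l) (clause i)
  last_empty : ∃ i : Fin size, (i : ℕ) + 1 = size ∧ (clause i).1 = ∅

namespace Refutation

variable {X : Type*} {F : CNF X}

/-- The width of a refutation: the width of its largest clause. -/
def width (π : Refutation F) : ℕ := Finset.univ.sup fun i => Clause.width (π.clause i)

/-- The edges of the associated DAG: from each of the two premises to the derived clause. -/
def Edge (π : Refutation F) (j i : Fin π.size) : Prop :=
  ∃ a b, π.premises i = some (a, b) ∧ (j = a ∨ j = b)

/-- The associated DAG has a path with exactly `d` edges. -/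
def HasPath (π : Refutation F) (d : ℕ) : Prop :=
  ∃ p : Fin (d + 1) → Fin π.size, ∀ t : Fin d, π.Edge (p t.castSucc) (p t.succ)

/-- The depth of a refutation: the number of edges in a longest path of the associated DAG. -/
noncomputable def depth (π : Refutation F) : ℕ := sSup {d | π.HasPath d}

theorem Edge.lt {π : Refutation F} {j i : Fin π.size} (h : π.Edge j i) : j < i := by
  obtain ⟨a, b, hab, rfl | rfl⟩ := h
  · exact (π.resolve i _ _ hab).1
  · exact (π.resolve i _ _ hab).2.1

theorem HasPath.lt_size {π : Refutation F} {d : ℕ} (h : π.HasPath d) : d < π.size := by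
  obtain ⟨p, hp⟩ := h
  have hm : StrictMono p := Fin.strictMono_iff_lt_succ.2 fun t => (hp t).lt
  simpa using Fintype.card_le_of_injective p hm.injective

/-- The supremum in the definition of the depth is a maximum. -/
theorem hasPath_depth (π : Refutation F) : π.HasPath π.depth := by
  refine Nat.sSup_mem ⟨0, ?_⟩ ⟨π.size, fun d hd => (HasPath.lt_size hd).le⟩
  obtain ⟨i, -⟩ := π.last_empty
  exact ⟨fun _ => i, fun t => t.elim0⟩

end Refutation

/-! ### Tseitin formulas and graph compressions -/

open scoped Classical in
/-- The Tseitin formula of the graph `G` with vertex labels (charges) `χ`. It has one variable for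
every edge, and for every vertex `v` it contains the clauses expressing that the variables of the
edges incident to `v` sum to `χ v` modulo 2: for every `0/1`-assignment to these edges of the wrong
parity, given by its set `T` of edges of value 1, the clause that is falsified by exactly this
assignment. -/
noncomputable def tseitin {V : Type*} [Fintype V] (G : SimpleGraph V) (χ : V → ZMod 2) :
    CNF G.edgeSet :=
  (Finset.univ.biUnion fun v : V =>
    let inc : Finset G.edgeSet := Finset.univ.filter fun e => v ∈ e.1
    (inc.powerset.filter fun T => (T.card : ZMod 2) ≠ χ v).image fun T =>
      inc.image fun e => ((e, decide (e ∉ T)) : Literal G.edgeSet)).subtype _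

open scoped Classical in
/-- Substitution of the variable `f x` for every variable `x`. Clauses that come to contain a
variable together with its negation are dropped. -/
noncomputable def CNF.substitute {X Y : Type*} (f : X → Y) (F : CNF X) : CNF Y :=
  (F.image fun C => C.1.image fun l => ((f l.1, l.2) : Literal Y)).subtype _

/-- A simple graph given by adjacency lists, together with a compatible equivalence relation on its
vertices: distinct equivalent vertices are non-adjacent and have the same degree. -/
structure GraphCompression (V : Type*) where
  graph : SimpleGraph V
  /-- the ordered list of the neighbours of each vertex -/
  nbrs : V → List V
  nodup_nbrs : ∀ v, (nbrs v).Nodup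
  mem_nbrs : ∀ v w, w ∈ nbrs v ↔ graph.Adj v w
  vertexEq : Setoid V
  not_adj : ∀ u v, vertexEq u v → ¬ graph.Adj u v
  degree_eq : ∀ u v, vertexEq u v → (nbrs u).length = (nbrs v).length

namespace GraphCompression

variable {V : Type*}

/-- Two edges are directly identified if they occur at the same position in the neighbour lists of
two equivalent vertices. -/
def EdgeStep (Γ : GraphCompression V) (e₁ e₂ : Γ.graph.edgeSet) : Prop :=
  ∃ v₁ v₂ w₁ w₂ : V, ∃ p : ℕ, Γ.vertexEq v₁ v₂ ∧
    (Γ.nbrs v₁)[p]? = some w₁ ∧ (Γ.nbrs v₂)[p]? = some w₂ ∧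
    e₁.1 = s(v₁, w₁) ∧ e₂.1 = s(v₂, w₂)

/-- The induced edge equivalence: the equivalence relation generated by the direct
identifications. -/
def edgeEq (Γ : GraphCompression V) : Setoid Γ.graph.edgeSet :=
  Relation.EqvGen.setoid Γ.EdgeStep

/-- The variables of the compressed formula: the equivalence classes of edges. -/
abbrev EdgeClass (Γ : GraphCompression V) : Type _ := Quotient Γ.edgeEq

/-- The compressed Tseitin formula: in the Tseitin formula, the variable of every edge is replaced
by the variable of its equivalence class. -/
noncomputable def compressedTseitin [Fintype V] (Γ : GraphCompression V) (χ : V → ZMod 2) :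
    CNF Γ.EdgeClass :=
  (tseitin Γ.graph χ).substitute (Quotient.mk Γ.edgeEq)

end GraphCompression

/-!
The graph is a *helix*: its vertices are the integers in `[0, len)`, and `t` is adjacent to `t + 1`
(a *step*) and to `t + k` (a *jump*), so that every residue modulo `k` is a row. Apart from two
zones at the ends, the vertices of the row `i` are identified periodically. There are `k` pairwise
coprime factors `q j` in `[n, 2 * n]` (primes, if `n` is large), and the period of the row `i` is
`8 * k * ∏ q j` columns, where the product extends over the `c + 1` factors with
`j ∈ {i - c, …, i}` modulo `k`. The whole helix has about half as many columns as the common period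
of all rows, which is at least `8 * k * n ^ k` columns, whereas the number of variables is governed
by the periods of the single rows. The charge is concentrated in the vertex `0`.

*Upper bound* (`Helix.exists_refutation`). The refutation sweeps over the vertices and maintains the
parity of the `k + 1` edges that leave an initial segment, a constraint on at most `k + 1`
variables. To pass the next vertex, it is combined with the constraint of that vertex, and the
variables of the two edges that end there are eliminated; they do not occur among the remaining
edges of the cut even after compression (`Helix.notMem_cut_add_one`).

*Lower bound* (`Helix.Condensed.le_depth`). Walking from the empty clause towards the axioms, an
adversary maintains an assignment that falsifies the current clause and violates only constraints of
`k` consecutive vertices in the zone at one of the ends, none of whose steps occurs in the clause.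
The violation can be moved along any *flow* that respects the identifications and avoids the
variables `S` of the clause (`Helix.ViolatesOnly.exists_move`). If `S` is *blocked*, that is, if
there is no such flow through the whole helix, then `S` contains a jump of every row. As `S` has at
most `k + c + 1` elements and contains some step, any `c + 1` consecutive rows include one in which
`S` has only one jump. The columns are grouped into blocks of `8 * k`. If the periods of two such
rows share the factor `q j`, then their jumps lie in blocks congruent modulo `q j`: otherwise a flow
could switch between the two rows periodically and dodge both (`Helix.Condensed.block_congr`). The
division into blocks has to avoid `S` and is not unique, but the choice matters by at most one block
(`Helix.Condensed.arc_congr`). By the Chinese remainder theorem, a blocked set thus has a *location*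
modulo `∏ q j`, which is unique up to one block. From one clause to the next the location changes by
at most one block (`Helix.Condensed.exists_dvd_sub_of_isLocated`), and the adversary is in trouble
only if the location is at the end of the helix where the violation is
(`Helix.Condensed.exists_dvd_sub_of_zone`). When a location first appears, the violation can still
be placed at the farther end, so the path has length about `(∏ q j) / 4 ≥ n ^ k / 4`.

Enough primes in `(n, 2 * n]` are provided by the prime factorization of the central binomial
coefficient (`eventually_le_card_primes`). For the finitely many small `n`, the claimed depth is at
most `1` when `δ` is small, and no coprimality is needed.
-/

/-! ### The compressed helix -/

/-- The shape of a helical grid. Its vertices are `0, …, len - 1`; the vertex `t` is joined to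
`t + 1` and to `t + rows`, so that winding the path `0, 1, 2, …` around a cylinder gives a grid with
`rows` rows in which `t` lies in row `t % rows`. The vertices in `[lo, hi)` are compressed: two of
them that lie in the same row `i` are identified if they differ by a multiple of `per i`. Positions
are integers throughout, so that they can be shifted freely; there is no vertex at a position
outside `[0, len)`. -/
structure Helix where
  len : ℕ
  rows : ℕ
  lo : ℕ
  hi : ℕ
  per : ℤ → ℤ
  two_le_rows : 2 ≤ rows
  rows_lt_per : ∀ i, (rows : ℤ) < per i
  rows_le_lo : rows ≤ lo
  hi_add_rows_le : hi + rows ≤ len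

namespace Helix

variable (h : Helix)

/-- The difference of the ends of an edge: `rows` for the edges along a row (`s = true`), which are
called jumps, and `1` for the edges around the helix (`s = false`), which are called steps. -/
def step (s : Bool) : ℤ := if s then h.rows else 1

@[simp] theorem step_true : h.step true = h.rows := rfl
@[simp] theorem step_false : h.step false = 1 := rfl

theorem step_pos (s : Bool) : 0 < h.step s := by
  have := h.two_le_rows
  cases s <;> simp; omega

theorem step_le (s : Bool) : h.step s ≤ h.rows := by
  have := h.two_le_rows
  cases s <;> simp; omega

theorem step_injective : Function.Injective h.step := by
  have := h.two_le_rows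
  intro s s' e
  cases s <;> cases s' <;> simp at e ⊢ <;> omega

/-- The identification of compressed vertices; distinct vertices are identified only by it. -/
def Rel (t t' : ℤ) : Prop :=
  (h.lo ≤ t ∧ t < h.hi) ∧ (h.lo ≤ t' ∧ t' < h.hi) ∧ t % h.rows = t' % h.rows ∧
    h.per (t % h.rows) ∣ t' - t

theorem Rel.symm {h : Helix} {t t' : ℤ} (H : h.Rel t t') : h.Rel t' t := by
  obtain ⟨a, b, c, d⟩ := H
  refine ⟨b, a, c.symm, ?_⟩
  rw [← c, ← neg_sub, dvd_neg]
  exact d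

theorem Rel.trans {h : Helix} {t t' t'' : ℤ} (H : h.Rel t t') (H' : h.Rel t' t'') :
    h.Rel t t'' := by
  obtain ⟨a, b, c, d⟩ := H
  obtain ⟨a', b', c', d'⟩ := H'
  refine ⟨a, b', c.trans c', ?_⟩
  rw [← c] at d'
  simpa using dvd_add d d'

/-- A family indexed by the edges (the type of an edge and its smaller end) is closed if it takes
the same value on identified edges. -/
def Closed {Y : Type*} (f : Bool → ℤ → Y) : Prop :=
  ∀ s t t', h.Rel t t' → f s t = f s t' ∧ f s (t - h.step s) = f s (t' - h.step s)

/-- The vertex with the given position, if there is one. -/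
def toVertex (z : ℤ) : Option (Fin h.len) :=
  if hz : 0 ≤ z ∧ z < h.len then some ⟨z.toNat, by omega⟩ else none

theorem toVertex_eq_some {z : ℤ} {v : Fin h.len} : h.toVertex z = some v ↔ z = (v : ℕ) := by
  unfold toVertex
  split_ifs with hz
  · rw [Option.some_inj, Fin.ext_iff]
    show z.toNat = _ ↔ _
    omega
  · have := v.2
    simp only [false_iff]
    omega

/-- The differences between a vertex and its neighbours. -/
def offsets : List ℤ := [1, -1, h.rows, -h.rows]

theorem mem_offsets {z : ℤ} : z ∈ h.offsets ↔ ∃ s, z = h.step s ∨ z = -h.step s := by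
  simp [offsets]
  tauto

theorem nodup_offsets : h.offsets.Nodup := by
  have := h.two_le_rows
  simp [offsets]
  omega

/-- The adjacency list of a vertex. -/
def nbrs (v : Fin h.len) : List (Fin h.len) :=
  h.offsets.filterMap fun z => h.toVertex ((v : ℕ) + z)

theorem mem_nbrs {v w : Fin h.len} :
    w ∈ h.nbrs v ↔ ∃ s, ((w : ℕ) : ℤ) = v + h.step s ∨ ((w : ℕ) : ℤ) + h.step s = v := by
  simp only [nbrs, List.mem_filterMap, toVertex_eq_some, mem_offsets]
  constructor
  · rintro ⟨z, ⟨s, rfl | rfl⟩, hz⟩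
    · exact ⟨s, Or.inl hz.symm⟩
    · exact ⟨s, Or.inr (by omega)⟩
  · rintro ⟨s, hs | hs⟩
    · exact ⟨_, ⟨s, Or.inl rfl⟩, hs.symm⟩
    · exact ⟨_, ⟨s, Or.inr rfl⟩, by omega⟩

theorem nodup_nbrs (v : Fin h.len) : (h.nbrs v).Nodup := by
  refine List.Nodup.filterMap ?_ h.nodup_offsets
  intro a a' b hb hb'
  rw [Option.mem_def, toVertex_eq_some] at hb hb'
  omega

theorem nbrs_eq_map_of_mem {v : Fin h.len} (hv : h.lo ≤ (v : ℕ) ∧ (v : ℕ) < h.hi) :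
    (h.nbrs v).map some = h.offsets.map fun z => h.toVertex ((v : ℕ) + z) := by
  have h1 := h.two_le_rows
  have h2 := h.rows_le_lo
  have h3 := h.hi_add_rows_le
  have key : ∀ z : ℤ, (z = 1 ∨ z = -1 ∨ z = h.rows ∨ z = -h.rows) →
      ∃ w, h.toVertex ((v : ℕ) + z) = some w := by
    intro z hz
    refine ⟨⟨((v : ℕ) + z).toNat, by omega⟩, ?_⟩
    rw [toVertex_eq_some]
    simp only
    omega
  obtain ⟨w1, e1⟩ := key 1 (by tauto)
  obtain ⟨w2, e2⟩ := key (-1) (by tauto)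
  obtain ⟨w3, e3⟩ := key h.rows (by tauto)
  obtain ⟨w4, e4⟩ := key (-h.rows) (by tauto)
  simp [nbrs, offsets, e1, e2, e3, e4]

theorem getElem?_nbrs {v w : Fin h.len} (hv : h.lo ≤ (v : ℕ) ∧ (v : ℕ) < h.hi) {p : ℕ}
    (hw : (h.nbrs v)[p]? = some w) : ∃ z, h.offsets[p]? = some z ∧ ((w : ℕ) : ℤ) = v + z := by
  have e := congrArg (fun l => l[p]?) (h.nbrs_eq_map_of_mem hv)
  simp only [List.getElem?_map, hw, Option.map_some] at e
  obtain ⟨z, hz, hz'⟩ := Option.map_eq_some_iff.1 e.symm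
  rw [toVertex_eq_some] at hz'
  exact ⟨z, hz, hz'.symm⟩

theorem length_nbrs {v : Fin h.len} (hv : h.lo ≤ (v : ℕ) ∧ (v : ℕ) < h.hi) :
    (h.nbrs v).length = 4 := by
  have e := congrArg List.length (h.nbrs_eq_map_of_mem hv)
  simpa [offsets] using e

/-- The compressed helix as a graph compression. -/
def compression : GraphCompression (Fin h.len) where
  graph :=
    { Adj := fun v w => ∃ s, ((w : ℕ) : ℤ) = v + h.step s ∨ ((w : ℕ) : ℤ) + h.step s = v
      symm := ⟨fun v w ⟨s, hs⟩ => ⟨s, by omega⟩⟩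
      loopless := ⟨fun v ⟨s, hs⟩ => by have := h.step_pos s; omega⟩ }
  nbrs := h.nbrs
  nodup_nbrs := h.nodup_nbrs
  mem_nbrs := fun v w => h.mem_nbrs
  vertexEq :=
    { r := fun u v => u = v ∨ h.Rel (u : ℕ) (v : ℕ)
      iseqv :=
        { refl := fun u => Or.inl rfl
          symm := by
            rintro u v (rfl | H)
            · exact Or.inl rfl
            · exact Or.inr H.symm
          trans := by
            rintro u v w (rfl | H) (rfl | H')
            · exact Or.inl rfl
            · exact Or.inr H'
            · exact Or.inr H
            · exact Or.inr (H.trans H') } }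
  not_adj := by
    rintro u v (rfl | ⟨-, -, hr, hd⟩) ⟨s, hs⟩
    · have := h.step_pos s
      omega
    · have h1 := h.rows_lt_per ((u : ℕ) % h.rows)
      have h2 := h.step_pos s
      have h3 := h.step_le s
      rcases hs with hs | hs
      · rw [hs, add_sub_cancel_left] at hd
        have := Int.le_of_dvd h2 hd
        omega
      · rw [← dvd_neg, neg_sub, sub_eq_iff_eq_add'.2 hs.symm] at hd
        have := Int.le_of_dvd h2 hd
        omega
  degree_eq := by
    rintro u v (rfl | ⟨hu, hv, -⟩)
    · rfl
    · rw [h.length_nbrs (by omega), h.length_nbrs (by omega)]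

/-- The edges of the helix. -/
abbrev Edge : Type := h.compression.graph.edgeSet

/-- The edge `e` has type `s` and smaller end `t`. -/
def HasIndex (e : h.Edge) (s : Bool) (t : ℤ) : Prop :=
  ∃ u v : Fin h.len, e.1 = s(u, v) ∧ ((u : ℕ) : ℤ) = t ∧ ((v : ℕ) : ℤ) = t + h.step s

variable {h}

theorem HasIndex.unique {e : h.Edge} {s s' : Bool} {t t' : ℤ} (H : h.HasIndex e s t)
    (H' : h.HasIndex e s' t') : s = s' ∧ t = t' := by
  obtain ⟨u, v, huv, hu, hv⟩ := H
  obtain ⟨u', v', huv', hu', hv'⟩ := H'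
  have h1 := h.step_pos s
  have h2 := h.step_pos s'
  rw [huv, Sym2.eq_iff] at huv'
  rcases huv' with ⟨rfl, rfl⟩ | ⟨rfl, rfl⟩
  · exact ⟨h.step_injective (by omega), by omega⟩
  · omega

theorem HasIndex.eq {e e' : h.Edge} {s : Bool} {t : ℤ} (H : h.HasIndex e s t)
    (H' : h.HasIndex e' s t) : e = e' := by
  obtain ⟨u, v, huv, hu, hv⟩ := H
  obtain ⟨u', v', huv', hu', hv'⟩ := H'
  apply Subtype.ext
  rw [huv, huv', Fin.ext (by omega : (u : ℕ) = u'), Fin.ext (by omega : (v : ℕ) = v')]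

theorem HasIndex.bounds {e : h.Edge} {s : Bool} {t : ℤ} (H : h.HasIndex e s t) :
    0 ≤ t ∧ t + h.step s < h.len := by
  obtain ⟨u, v, huv, hu, hv⟩ := H
  have := v.2
  omega

theorem exists_hasIndex_of_bounds {s : Bool} {t : ℤ} (h0 : 0 ≤ t) (h1 : t + h.step s < h.len) :
    ∃ e, h.HasIndex e s t := by
  have := h.step_pos s
  refine ⟨⟨s(⟨t.toNat, by omega⟩, ⟨(t + h.step s).toNat, by omega⟩), ?_⟩, _, _, rfl, ?_, ?_⟩
  · refine ⟨s, Or.inl ?_⟩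
    simp only
    omega
  all_goals simp only; omega

theorem hasIndex_of_eq {e : h.Edge} {v w : Fin h.len} (he : e.1 = s(v, w)) {s : Bool} :
    (((w : ℕ) : ℤ) = v + h.step s → h.HasIndex e s (v : ℕ)) ∧
    (((w : ℕ) : ℤ) = v - h.step s → h.HasIndex e s ((v : ℕ) - h.step s)) :=
  ⟨fun hs => ⟨v, w, he, rfl, hs⟩, fun hs => ⟨w, v, he.trans Sym2.eq_swap, hs, by omega⟩⟩

theorem exists_hasIndex (e : h.Edge) : ∃ s t, h.HasIndex e s t := by
  obtain ⟨e, he⟩ := e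
  induction e with
  | _ v w =>
    obtain ⟨s, hs | hs⟩ := he
    · exact ⟨s, _, (hasIndex_of_eq rfl).1 hs⟩
    · exact ⟨s, _, (hasIndex_of_eq rfl).2 (by simp only at hs ⊢; omega)⟩

theorem HasIndex.mem_iff {e : h.Edge} {s : Bool} {t : ℤ} (H : h.HasIndex e s t) (v : Fin h.len) :
    v ∈ e.1 ↔ t = (v : ℕ) ∨ t = (v : ℕ) - h.step s := by
  obtain ⟨u, w, huw, hu, hw⟩ := H
  rw [huw, Sym2.mem_iff, Fin.ext_iff, Fin.ext_iff]
  omega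

/-- Directly identified edges have the same type, and their smaller ends or their larger ends are
identified. -/
theorem edgeStep_cases {e e' : h.Edge} (H : h.compression.EdgeStep e e') :
    e = e' ∨ ∃ s t t', h.Rel t t' ∧ ((h.HasIndex e s t ∧ h.HasIndex e' s t') ∨
      (h.HasIndex e s (t - h.step s) ∧ h.HasIndex e' s (t' - h.step s))) := by
  obtain ⟨v, v', w, w', p, hv | hv, hw, hw', he, he'⟩ := H
  · subst hv
    rw [hw, Option.some_inj] at hw'
    subst hw'
    exact Or.inl (Subtype.ext (he.trans he'.symm))
  · right
    obtain ⟨z, hz, hwz⟩ := h.getElem?_nbrs ⟨by exact_mod_cast hv.1.1, by exact_mod_cast hv.1.2⟩ hw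
    obtain ⟨z', hz', hwz'⟩ :=
      h.getElem?_nbrs ⟨by exact_mod_cast hv.2.1.1, by exact_mod_cast hv.2.1.2⟩ hw'
    rw [hz, Option.some_inj] at hz'
    subst hz'
    obtain ⟨s, rfl | rfl⟩ := h.mem_offsets.1 (List.mem_of_getElem? hz)
    · exact ⟨s, _, _, hv, Or.inl ⟨(hasIndex_of_eq he).1 hwz, (hasIndex_of_eq he').1 hwz'⟩⟩
    · exact ⟨s, _, _, hv, Or.inr ⟨(hasIndex_of_eq he).2 hwz, (hasIndex_of_eq he').2 hwz'⟩⟩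

/-- Edges whose smaller ends, or whose larger ends, are identified are themselves identified. -/
theorem edgeStep_of_rel {e e' : h.Edge} {s : Bool} {t t' : ℤ} (H : h.Rel t t') :
    (h.HasIndex e s t → h.HasIndex e' s t' → h.compression.EdgeStep e e') ∧
    (h.HasIndex e s (t - h.step s) → h.HasIndex e' s (t' - h.step s) →
      h.compression.EdgeStep e e') := by
  have key : ∀ v v' w w' : Fin h.len, ∀ z ∈ h.offsets, h.Rel (v : ℕ) (v' : ℕ) →
      ((w : ℕ) : ℤ) = v + z → ((w' : ℕ) : ℤ) = v' + z → e.1 = s(v, w) → e'.1 = s(v', w') →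
      h.compression.EdgeStep e e' := by
    intro v v' w w' z hz hR hw hw' he he'
    obtain ⟨p, hp⟩ := List.getElem?_of_mem hz
    refine ⟨v, v', w, w', p, Or.inr hR, ?_, ?_, he, he'⟩
    · have e := congrArg (fun l => l[p]?)
        (h.nbrs_eq_map_of_mem ⟨by exact_mod_cast hR.1.1, by exact_mod_cast hR.1.2⟩)
      simp only [List.getElem?_map, hp, Option.map_some, h.toVertex_eq_some.2 hw.symm] at e
      obtain ⟨w₁, hw₁, hw₂⟩ := Option.map_eq_some_iff.1 e
      rw [Option.some_inj] at hw₂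
      exact hw₂ ▸ hw₁
    · have e := congrArg (fun l => l[p]?)
        (h.nbrs_eq_map_of_mem ⟨by exact_mod_cast hR.2.1.1, by exact_mod_cast hR.2.1.2⟩)
      simp only [List.getElem?_map, hp, Option.map_some, h.toVertex_eq_some.2 hw'.symm] at e
      obtain ⟨w₁, hw₁, hw₂⟩ := Option.map_eq_some_iff.1 e
      rw [Option.some_inj] at hw₂
      exact hw₂ ▸ hw₁
  constructor
  · rintro ⟨u, v, huv, rfl, hv⟩ ⟨u', v', huv', rfl, hv'⟩
    exact key u u' v v' _ (h.mem_offsets.2 ⟨s, Or.inl rfl⟩) H hv hv' huv huv'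
  · rintro ⟨u, v, huv, hu, hv⟩ ⟨u', v', huv', hu', hv'⟩
    refine key v v' u u' _ (h.mem_offsets.2 ⟨s, Or.inr rfl⟩) ?_ (by omega) (by omega)
      (huv.trans Sym2.eq_swap) (huv'.trans Sym2.eq_swap)
    rwa [show ((v : ℕ) : ℤ) = t by omega, show ((v' : ℕ) : ℤ) = t' by omega]

variable (h)

/-- The variables of the compressed Tseitin formula. -/
abbrev Var : Type := h.compression.EdgeClass

noncomputable instance : Fintype h.Var :=
  have : Finite h.Var := Quotient.finite _
  Fintype.ofFinite _

open scoped Classical in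
/-- The class of the edge of type `s` with smaller end `t`, as a set of at most one variable; it is
empty if there is no such edge. -/
noncomputable def cls (s : Bool) (t : ℤ) : Finset h.Var :=
  Finset.univ.filter fun x => ∃ e, Quotient.mk h.compression.edgeEq e = x ∧ h.HasIndex e s t

variable {h}

theorem mem_cls {s : Bool} {t : ℤ} {x : h.Var} :
    x ∈ h.cls s t ↔ ∃ e, Quotient.mk h.compression.edgeEq e = x ∧ h.HasIndex e s t := by
  simp [cls]

theorem exists_mem_cls (x : h.Var) : ∃ s t, x ∈ h.cls s t := by
  obtain ⟨e, rfl⟩ := Quotient.exists_rep x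
  obtain ⟨s, t, H⟩ := exists_hasIndex e
  exact ⟨s, t, mem_cls.2 ⟨e, rfl, H⟩⟩

theorem bounds_of_mem_cls {s : Bool} {t : ℤ} {x : h.Var} (H : x ∈ h.cls s t) :
    0 ≤ t ∧ t + h.step s < h.len := by
  obtain ⟨e, -, he⟩ := mem_cls.1 H
  exact he.bounds

theorem cls_nonempty {s : Bool} {t : ℤ} (h0 : 0 ≤ t) (h1 : t + h.step s < h.len) :
    (h.cls s t).Nonempty := by
  obtain ⟨e, he⟩ := exists_hasIndex_of_bounds h0 h1
  exact ⟨_, mem_cls.2 ⟨e, rfl, he⟩⟩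

theorem eq_of_mem_cls {s : Bool} {t : ℤ} {x y : h.Var} (hx : x ∈ h.cls s t) (hy : y ∈ h.cls s t) :
    x = y := by
  obtain ⟨e, rfl, he⟩ := mem_cls.1 hx
  obtain ⟨e', rfl, he'⟩ := mem_cls.1 hy
  rw [he.eq he']

theorem card_cls_le (s : Bool) (t : ℤ) : (h.cls s t).card ≤ 1 :=
  Finset.card_le_one.2 fun _ hx _ hy => eq_of_mem_cls hx hy

/-- A closed family descends to the variables of the compressed formula. -/
theorem exists_lift {Y : Type*} {f : Bool → ℤ → Y} (hf : h.Closed f) :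
    ∃ α : h.Var → Y, ∀ s t, ∀ x ∈ h.cls s t, α x = f s t := by
  choose s t hst using fun e : h.Edge => exists_hasIndex e
  have hg : ∀ e e', h.compression.EdgeStep e e' → f (s e) (t e) = f (s e') (t e') := by
    intro e e' H
    obtain rfl | ⟨s₀, t₀, t₀', hR, ⟨h1, h2⟩ | ⟨h1, h2⟩⟩ := edgeStep_cases H
    · rfl
    · obtain ⟨a, b⟩ := (hst e).unique h1
      obtain ⟨a', b'⟩ := (hst e').unique h2
      rw [a, b, a', b']
      exact (hf s₀ _ _ hR).1
    · obtain ⟨a, b⟩ := (hst e).unique h1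
      obtain ⟨a', b'⟩ := (hst e').unique h2
      rw [a, b, a', b']
      exact (hf s₀ _ _ hR).2
  have hg' : ∀ e e', h.compression.edgeEq e e' → f (s e) (t e) = f (s e') (t e') := by
    intro e e' H
    induction H with
    | rel e e' H => exact hg e e' H
    | refl => rfl
    | symm _ _ _ ih => exact ih.symm
    | trans _ _ _ _ _ ih ih' => exact ih.trans ih'
  refine ⟨Quotient.lift (fun e => f (s e) (t e)) hg', ?_⟩
  intro s' t' x hx
  obtain ⟨e, rfl, he⟩ := mem_cls.1 hx
  obtain ⟨a, b⟩ := (hst e).unique he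
  simp [a, b]

theorem eq_of_mem_cls_of_rel {s : Bool} {t t' : ℤ} (H : h.Rel t t') {x y : h.Var} :
    (x ∈ h.cls s t → y ∈ h.cls s t' → x = y) ∧
    (x ∈ h.cls s (t - h.step s) → y ∈ h.cls s (t' - h.step s) → x = y) := by
  constructor
  all_goals
    intro hx hy
    obtain ⟨e, rfl, he⟩ := mem_cls.1 hx
    obtain ⟨e', rfl, he'⟩ := mem_cls.1 hy
    apply Quotient.sound
    apply Relation.EqvGen.rel
  · exact (edgeStep_of_rel H).1 he he'
  · exact (edgeStep_of_rel H).2 he he'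

/-- Identified edges have the same type, and their smaller ends lie in the same row. -/
theorem cls_invariant {s s' : Bool} {t t' : ℤ} {x : h.Var} (hx : x ∈ h.cls s t)
    (hx' : x ∈ h.cls s' t') : s = s' ∧ t % h.rows = t' % h.rows := by
  have hf : h.Closed fun s t => (s, t % (h.rows : ℤ)) := by
    rintro s t t' ⟨-, -, hr, -⟩
    refine ⟨by simp [hr], ?_⟩
    simp only [Prod.mk.injEq, true_and]
    rw [Int.sub_emod, hr, ← Int.sub_emod]
  obtain ⟨α, hα⟩ := exists_lift hf
  have e := (hα _ _ _ hx).symm.trans (hα _ _ _ hx')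
  simpa using e

theorem dvd_sub_of_mem_cls {d : ℤ} (hd : ∀ i, d ∣ h.per i) {s s' : Bool} {t t' : ℤ} {x : h.Var}
    (hx : x ∈ h.cls s t) (hx' : x ∈ h.cls s' t') : d ∣ t' - t := by
  have hf : h.Closed fun _ t => t % d := by
    rintro s t t' ⟨-, -, -, hr⟩
    have : t ≡ t' [ZMOD d] := Int.modEq_iff_dvd.2 ((hd _).trans hr)
    exact ⟨this, this.sub_right _⟩
  obtain ⟨α, hα⟩ := exists_lift hf
  have e := (hα _ _ _ hx).symm.trans (hα _ _ _ hx')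
  exact Int.ModEq.dvd e

theorem per_dvd_of_mem_cls {t t' : ℤ} {x : h.Var} (hx : x ∈ h.cls true t)
    (hx' : x ∈ h.cls true t') : h.per (t % h.rows) ∣ t' - t := by
  have hf : h.Closed fun s t => if s then t % (h.per (t % h.rows)) else 0 := by
    rintro s t t' ⟨-, -, hr, hd⟩
    cases s
    · simp
    · have : t ≡ t' [ZMOD h.per (t % h.rows)] := Int.modEq_iff_dvd.2 hd
      simp only [if_true, step_true, Int.sub_emod_right, ← hr]
      exact ⟨this, this.sub_right _⟩
  obtain ⟨α, hα⟩ := exists_lift hf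
  have e := (hα _ _ _ hx).symm.trans (hα _ _ _ hx')
  simp only [if_true, (cls_invariant hx hx').2] at e ⊢
  exact Int.ModEq.dvd e

end Helix

/-! ### Membership in Tseitin formulas and in formulas with substituted variables -/

theorem mem_tseitin {V : Type*} [Fintype V] {G : SimpleGraph V} {χ : V → ZMod 2}
    {C : Clause G.edgeSet} : C ∈ tseitin G χ ↔ ∃ v : V, ∃ T : Finset G.edgeSet,
      (∀ e ∈ T, v ∈ e.1) ∧ (T.card : ZMod 2) ≠ χ v ∧
      ∀ l, l ∈ C.1 ↔ v ∈ l.1.1 ∧ (l.2 = true ↔ l.1 ∉ T) := by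
  classical
  simp only [tseitin, Finset.mem_subtype, Finset.mem_biUnion, Finset.mem_univ, true_and,
    Finset.mem_image, Finset.mem_filter, Finset.mem_powerset, Finset.subset_iff]
  refine exists_congr fun v => exists_congr fun T => ?_
  rw [and_assoc]
  refine and_congr_right fun _ => and_congr_right fun _ => ?_
  rw [Finset.ext_iff]
  refine forall_congr' fun l => ?_
  rw [iff_comm (b := l ∈ C.1)]
  refine iff_congr Iff.rfl ?_
  simp only [Finset.mem_image, Finset.mem_filter, Finset.mem_univ, true_and, Prod.ext_iff]
  constructor
  · rintro ⟨e, he, h1, h2⟩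
    rw [← h1, ← h2]
    simpa using he
  · rintro ⟨h1, h2⟩
    exact ⟨l.1, h1, rfl, by rw [Bool.eq_iff_iff, h2]; simp⟩

theorem mem_substitute {X Y : Type*} {f : X → Y} {F : CNF X} {C : Clause Y} :
    C ∈ F.substitute f ↔ ∃ C' ∈ F, ∀ l, l ∈ C.1 ↔ ∃ l' ∈ C'.1, f l'.1 = l.1 ∧ l'.2 = l.2 := by
  classical
  simp only [CNF.substitute, Finset.mem_subtype, Finset.mem_image]
  refine exists_congr fun C' => and_congr_right fun _ => ?_
  rw [Finset.ext_iff]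
  refine forall_congr' fun l => ?_
  simp only [Finset.mem_image, Prod.ext_iff]
  exact iff_comm

namespace Helix

variable {h : Helix}

/-! ### The clauses of the compressed Tseitin formula -/

/-- The edges at a vertex remain distinct under compression. -/
theorem eq_of_mem_cls_of_incident {s s' : Bool} {t t' v : ℤ} (ht : t = v ∨ t = v - h.step s)
    (ht' : t' = v ∨ t' = v - h.step s') {x : h.Var} (hx : x ∈ h.cls s t) (hx' : x ∈ h.cls s' t') :
    s = s' ∧ t = t' := by
  obtain ⟨rfl, hr⟩ := cls_invariant hx hx'
  refine ⟨rfl, ?_⟩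
  have h1 := h.step_pos s
  have h2 := h.two_le_rows
  have key : ∀ t t' : ℤ, t - t' = h.step s → t % h.rows = t' % h.rows → x ∈ h.cls s t →
      x ∈ h.cls s t' → False := by
    intro t t' e hr hx hx'
    cases s
    · have hd : (h.rows : ℤ) ∣ t - t' := Int.ModEq.dvd (show t' % _ = t % _ from hr.symm)
      rw [e, step_false] at hd
      have := Int.le_of_dvd one_pos hd
      omega
    · have hd := per_dvd_of_mem_cls hx' hx
      rw [e, step_true] at hd
      have := Int.le_of_dvd (by omega) hd
      have := h.rows_lt_per (t' % h.rows)
      omega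
  rcases ht with rfl | rfl <;> rcases ht' with rfl | rfl
  · rfl
  · exact (key _ _ (by ring) hr hx hx').elim
  · exact (key _ _ (by ring) hr.symm hx' hx).elim
  · rfl

variable (h) in
open scoped Classical in
/-- The variables of the edges at the vertex `v`. -/
noncomputable def inc (v : ℤ) : Finset h.Var :=
  Finset.univ.biUnion fun s => h.cls s v ∪ h.cls s (v - h.step s)

/-- The value of the edge of type `s` with smaller end `t`; it is zero if there is no such edge. -/
noncomputable def val (α : h.Var → ZMod 2) (s : Bool) (t : ℤ) : ZMod 2 := ∑ x ∈ h.cls s t, α x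

theorem val_of_mem {α : h.Var → ZMod 2} {s : Bool} {t : ℤ} {x : h.Var} (hx : x ∈ h.cls s t) :
    val α s t = α x := by
  rw [val, show h.cls s t = {x} from
    Finset.eq_singleton_iff_unique_mem.2 ⟨hx, fun y hy => eq_of_mem_cls hy hx⟩]
  simp

theorem mem_inc {v : ℤ} {x : h.Var} :
    x ∈ h.inc v ↔ ∃ s t, (t = v ∨ t = v - h.step s) ∧ x ∈ h.cls s t := by
  simp only [inc, Finset.mem_biUnion, Finset.mem_univ, true_and, Finset.mem_union]
  constructor
  · rintro ⟨s, hs | hs⟩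
    · exact ⟨s, _, Or.inl rfl, hs⟩
    · exact ⟨s, _, Or.inr rfl, hs⟩
  · rintro ⟨s, t, rfl | rfl, hs⟩
    · exact ⟨s, Or.inl hs⟩
    · exact ⟨s, Or.inr hs⟩

theorem sum_inc (α : h.Var → ZMod 2) (v : ℤ) :
    ∑ x ∈ h.inc v, α x =
      val α false v + val α false (v - 1) + val α true v + val α true (v - h.rows) := by
  classical
  have hd : ∀ s s' t t', (t = v ∨ t = v - h.step s) → (t' = v ∨ t' = v - h.step s') →
      (s, t) ≠ (s', t') → Disjoint (h.cls s t) (h.cls s' t') := by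
    intro s s' t t' ht ht' hne
    rw [Finset.disjoint_left]
    intro x hx hx'
    obtain ⟨rfl, rfl⟩ := eq_of_mem_cls_of_incident ht ht' hx hx'
    exact hne rfl
  have hne : ∀ s, v ≠ v - h.step s := fun s => by have := h.step_pos s; omega
  rw [inc, Finset.sum_biUnion]
  · rw [Fintype.sum_bool,
      Finset.sum_union (hd _ _ _ _ (Or.inl rfl) (Or.inr rfl) (by simpa using hne true)),
      Finset.sum_union (hd _ _ _ _ (Or.inl rfl) (Or.inr rfl) (by simpa using hne false))]
    simp only [val, step_true, step_false]
    ring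
  · intro s _ s' _ hs
    simp only [Function.onFun, Finset.disjoint_union_left, Finset.disjoint_union_right]
    refine ⟨⟨?_, ?_⟩, ?_, ?_⟩ <;> apply hd <;> simp [hs]

theorem card_inc_le (v : ℤ) : (h.inc v).card ≤ 4 := by
  classical
  refine Finset.card_biUnion_le.trans ?_
  rw [Fintype.sum_bool]
  have h1 := Finset.card_union_le (h.cls true v) (h.cls true (v - h.step true))
  have h2 := Finset.card_union_le (h.cls false v) (h.cls false (v - h.step false))
  have h3 := h.card_cls_le true v
  have h4 := h.card_cls_le false v
  have h5 := h.card_cls_le true (v - h.step true)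
  have h6 := h.card_cls_le false (v - h.step false)
  omega

theorem inc_nonempty (v : Fin h.len) : (h.inc (v : ℕ)).Nonempty := by
  have h1 := h.rows_le_lo
  have h2 := h.hi_add_rows_le
  have h3 := h.two_le_rows
  have h4 := v.2
  by_cases hv : (v : ℕ) + 1 < h.len
  · obtain ⟨x, hx⟩ := h.cls_nonempty (s := false) (t := (v : ℕ)) (by omega) (by simp; omega)
    exact ⟨x, mem_inc.2 ⟨_, _, Or.inl rfl, hx⟩⟩
  · obtain ⟨x, hx⟩ := h.cls_nonempty (s := false) (t := (v : ℕ) - 1) (by omega) (by simp)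
    exact ⟨x, mem_inc.2 ⟨_, _, Or.inr rfl, hx⟩⟩

/-- The clauses of the compressed formula: for every vertex, the clauses excluding the assignments
of wrong parity to the classes of its edges. -/
theorem mem_compressedTseitin {χ : Fin h.len → ZMod 2} {C : Clause h.Var} :
    C ∈ h.compression.compressedTseitin χ ↔ ∃ v : Fin h.len, ∃ α : h.Var → ZMod 2,
      ∑ x ∈ h.inc (v : ℕ), α x ≠ χ v ∧
      ∀ l, l ∈ C.1 ↔ l.1 ∈ h.inc (v : ℕ) ∧ (l.2 = true ↔ α l.1 = 0) := by
  classical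
  set mk : h.Edge → h.Var := Quotient.mk h.compression.edgeEq with hmk
  have hinj : ∀ v : Fin h.len, ∀ e e' : h.Edge, v ∈ e.1 → v ∈ e'.1 → mk e = mk e' → e = e' := by
    intro v e e' he he' heq
    obtain ⟨s, t, H⟩ := exists_hasIndex e
    obtain ⟨s', t', H'⟩ := exists_hasIndex e'
    obtain ⟨rfl, rfl⟩ := eq_of_mem_cls_of_incident ((H.mem_iff v).1 he) ((H'.mem_iff v).1 he')
      (mem_cls.2 ⟨e, rfl, H⟩) (mem_cls.2 ⟨e', heq.symm, H'⟩)
    exact H.eq H'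
  have hinc : ∀ v : Fin h.len, ∀ x, x ∈ h.inc (v : ℕ) ↔ ∃ e, v ∈ e.1 ∧ mk e = x := by
    intro v x
    rw [mem_inc]
    constructor
    · rintro ⟨s, t, ht, hx⟩
      obtain ⟨e, rfl, H⟩ := mem_cls.1 hx
      exact ⟨e, (H.mem_iff v).2 ht, rfl⟩
    · rintro ⟨e, he, rfl⟩
      obtain ⟨s, t, H⟩ := exists_hasIndex e
      exact ⟨s, t, (H.mem_iff v).1 he, mem_cls.2 ⟨e, rfl, H⟩⟩
  -- the sum over the classes at `v` counts the edges at `v` of value one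
  have hsum : ∀ v : Fin h.len, ∀ α : h.Var → ZMod 2, ∀ T : Finset h.Edge,
      (∀ e, e ∈ T ↔ v ∈ e.1 ∧ α (mk e) ≠ 0) → ∑ x ∈ h.inc (v : ℕ), α x = (T.card : ZMod 2) := by
    intro v α T hT
    have hz : ∀ z : ZMod 2, z ≠ 0 → z = 1 := by decide
    rw [← nsmul_one T.card, ← Finset.sum_const]
    refine (Finset.sum_of_injOn mk ?_ ?_ ?_ ?_).symm
    · intro e he e' he' heq
      exact hinj v e e' ((hT e).1 he).1 ((hT e').1 he').1 heq
    · intro e he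
      exact (hinc v _).2 ⟨e, ((hT e).1 he).1, rfl⟩
    · intro x hx hx'
      obtain ⟨e, he, rfl⟩ := (hinc v _).1 hx
      by_contra h0
      exact hx' ⟨e, (hT e).2 ⟨he, h0⟩, rfl⟩
    · intro e he
      exact (hz _ ((hT e).1 he).2).symm
  rw [GraphCompression.compressedTseitin, mem_substitute]
  constructor
  · rintro ⟨C₀, hC₀, hC⟩
    obtain ⟨v, T, hT, hTχ, hC₀⟩ := mem_tseitin.1 hC₀
    have hval : ∀ e, v ∈ e.1 → ((∃ e' ∈ T, mk e' = mk e) ↔ e ∈ T) := fun e he =>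
      ⟨fun ⟨e', he', heq⟩ => hinj v e' e (hT _ he') he heq ▸ he', fun he => ⟨e, he, rfl⟩⟩
    obtain ⟨α, hα⟩ : ∃ α : h.Var → ZMod 2, ∀ e, v ∈ e.1 → (α (mk e) = 0 ↔ e ∉ T) := by
      refine ⟨fun x => if ∃ e ∈ T, mk e = x then 1 else 0, fun e he => ?_⟩
      rw [← hval e he]
      simp
    refine ⟨v, α, ?_, ?_⟩
    · rwa [hsum v _ T]
      intro e
      constructor
      · intro he
        exact ⟨hT e he, by simpa [hα e (hT e he)] using he⟩
      · rintro ⟨he, he'⟩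
        simpa [hα e he] using he'
    · rintro ⟨x, b⟩
      rw [hC, hinc]
      constructor
      · rintro ⟨⟨e, b'⟩, he, rfl, rfl⟩
        obtain ⟨he, hb⟩ := (hC₀ _).1 he
        refine ⟨⟨e, he, rfl⟩, ?_⟩
        exact hb.trans (hα e he).symm
      · rintro ⟨⟨e, he, rfl⟩, hb⟩
        exact ⟨(e, b), (hC₀ _).2 ⟨he, hb.trans (hα e he)⟩, rfl, rfl⟩
  · rintro ⟨v, α, hα, hC⟩
    set T : Finset h.Edge := Set.Finite.toFinset (Set.toFinite {e | v ∈ e.1 ∧ α (mk e) ≠ 0})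
      with hTdef
    have hT : ∀ e, e ∈ T ↔ v ∈ e.1 ∧ α (mk e) ≠ 0 := fun e => by simp [hTdef]
    set C₀ : Finset (Literal h.Edge) := Set.Finite.toFinset
      (Set.toFinite {l : Literal h.Edge | v ∈ l.1.1 ∧ (l.2 = true ↔ l.1 ∉ T)}) with hC₀def
    have hC₀ : ∀ l, l ∈ C₀ ↔ v ∈ l.1.1 ∧ (l.2 = true ↔ l.1 ∉ T) := fun e => by simp [hC₀def]
    refine ⟨⟨C₀, ?_⟩, mem_tseitin.2 ⟨v, T, fun e he => ((hT e).1 he).1, ?_, hC₀⟩, ?_⟩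
    · rintro e ⟨h1, h2⟩
      have h1 := ((hC₀ _).1 h1).2
      have h2 := ((hC₀ _).1 h2).2
      simp only at h1 h2
      tauto
    · rwa [← hsum v α T hT]
    · rintro ⟨x, b⟩
      rw [hC, hinc]
      constructor
      · rintro ⟨⟨e, he, rfl⟩, hb⟩
        refine ⟨(e, b), (hC₀ _).2 ⟨he, ?_⟩, rfl, rfl⟩
        simp only [hT] at hb ⊢
        tauto
      · rintro ⟨⟨e, b'⟩, he, rfl, rfl⟩
        obtain ⟨he, hb⟩ := (hC₀ _).1 he
        refine ⟨⟨e, he, rfl⟩, ?_⟩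
        simp only [hT] at hb ⊢
        tauto

end Helix

/-! ### Building refutations clause by clause -/

section Derivations

variable {X : Type*}

/-- The assignment `α`, in which `1` stands for true and `0` for false, falsifies every literal of
`C`. -/
def Falsifies (α : X → ZMod 2) (C : Clause X) : Prop := ∀ l ∈ C.1, (l.2 = true ↔ α l.1 = 0)

/-- `ℓ` lists, last clause first, a resolution derivation of width at most `w` from `F`. -/
inductive ResolutionDerivation (F : CNF X) (w : ℕ) : List (Clause X) → Prop
  | nil : ResolutionDerivation F w []
  | initial {ℓ C} : ResolutionDerivation F w ℓ → C ∈ F → Clause.width C ≤ w →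
      ResolutionDerivation F w (C :: ℓ)
  | resolve {ℓ C C' D} : ResolutionDerivation F w ℓ → C ∈ ℓ → C' ∈ ℓ → IsResolvent C C' D →
      Clause.width D ≤ w → ResolutionDerivation F w (D :: ℓ)

namespace ResolutionDerivation

variable {F : CNF X} {w : ℕ} {ℓ : List (Clause X)}

theorem width_le (H : ResolutionDerivation F w ℓ) : ∀ C ∈ ℓ, Clause.width C ≤ w := by
  induction H with
  | nil => simp
  | initial _ _ hw ih => exact List.forall_mem_cons.2 ⟨hw, ih⟩
  | resolve _ _ _ _ hw ih => exact List.forall_mem_cons.2 ⟨hw, ih⟩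

theorem exists_cons_of_mem (H : ResolutionDerivation F w ℓ) {C : Clause X} (hC : C ∈ ℓ) :
    ∃ ℓ', ResolutionDerivation F w (C :: ℓ') ∧ (C :: ℓ').length ≤ ℓ.length := by
  induction H with
  | nil => simp at hC
  | initial H hF hw ih =>
    rcases List.mem_cons.1 hC with rfl | hC
    · exact ⟨_, .initial H hF hw, le_rfl⟩
    · obtain ⟨ℓ', h1, h2⟩ := ih hC
      exact ⟨ℓ', h1, h2.trans (by simp)⟩
  | resolve H h1 h2 hr hw ih =>
    rcases List.mem_cons.1 hC with rfl | hC
    · exact ⟨_, .resolve H h1 h2 hr hw, le_rfl⟩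
    · obtain ⟨ℓ', h1, h2⟩ := ih hC
      exact ⟨ℓ', h1, h2.trans (by simp)⟩

theorem mem_or_isResolvent (H : ResolutionDerivation F w ℓ) (i : ℕ) (hi : i < ℓ.reverse.length) :
    ℓ.reverse[i] ∈ F ∨ ∃ (a b : ℕ) (ha : a < i) (hb : b < i),
      IsResolvent (ℓ.reverse[a]'(ha.trans hi)) (ℓ.reverse[b]'(hb.trans hi)) ℓ.reverse[i] := by
  induction H generalizing i with
  | nil => simp at hi
  | @initial ℓ C H hF hw ih =>
    simp only [List.reverse_cons]
    by_cases hi' : i < ℓ.reverse.length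
    · rw [List.getElem_append_left hi']
      refine (ih i hi').imp id ?_
      rintro ⟨a, b, ha, hb, hr⟩
      refine ⟨a, b, ha, hb, ?_⟩
      rwa [List.getElem_append_left (ha.trans hi'), List.getElem_append_left (hb.trans hi')]
    · left
      rw [List.getElem_append_right (by omega)]
      simpa using hF
  | @resolve ℓ C C' D H h1 h2 hr hw ih =>
    simp only [List.reverse_cons]
    by_cases hi' : i < ℓ.reverse.length
    · rw [List.getElem_append_left hi']
      refine (ih i hi').imp id ?_
      rintro ⟨a, b, ha, hb, hr⟩
      refine ⟨a, b, ha, hb, ?_⟩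
      rwa [List.getElem_append_left (ha.trans hi'), List.getElem_append_left (hb.trans hi')]
    · right
      obtain ⟨a, ha, rfl⟩ := List.getElem_of_mem (List.mem_reverse.2 h1)
      obtain ⟨b, hb, rfl⟩ := List.getElem_of_mem (List.mem_reverse.2 h2)
      refine ⟨a, b, by omega, by omega, ?_⟩
      rw [List.getElem_append_left ha, List.getElem_append_left hb,
        List.getElem_append_right (by omega)]
      simpa using hr

/-- A derivation of the empty clause gives a refutation. -/
theorem exists_refutation (H : ResolutionDerivation F w ℓ) {C : Clause X} (hC : C ∈ ℓ)
    (h0 : C.1 = ∅) :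
    ∃ π : Refutation F, π.width ≤ w ∧ π.size ≤ ℓ.length := by
  classical
  obtain ⟨ℓ', H, hlen⟩ := H.exists_cons_of_mem hC
  set L := (C :: ℓ').reverse with hL
  have hLlen : L.length = ℓ'.length + 1 := by simp [hL]
  have key : ∀ i : Fin L.length, ∃ p : Option (Fin L.length × Fin L.length),
      (p = none → L[i] ∈ F) ∧
      ∀ j l, p = some (j, l) → j < i ∧ l < i ∧ IsResolvent L[j] L[l] L[i] := by
    intro i
    rcases H.mem_or_isResolvent i.1 i.2 with hF | ⟨a, b, ha, hb, hr⟩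
    · exact ⟨none, fun _ => hF, by simp⟩
    · refine ⟨some (⟨a, ha.trans i.2⟩, ⟨b, hb.trans i.2⟩), by simp, ?_⟩
      intro j l e
      simp only [Option.some.injEq, Prod.mk.injEq] at e
      obtain ⟨rfl, rfl⟩ := e
      exact ⟨ha, hb, hr⟩
  choose p hp hp' using key
  refine ⟨⟨L.length, fun i => L[i], p, hp, hp',
    ⟨⟨ℓ'.length, by omega⟩, by simp [hLlen], ?_⟩⟩, ?_, ?_⟩
  · simp [hL, h0]
  · refine Finset.sup_le fun i _ => H.width_le _ ?_
    exact List.mem_reverse.1 (List.getElem_mem (i.2 : i.1 < L.length))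
  · simp only [hLlen]
    simpa using hlen

end ResolutionDerivation

/-- Some clause of `ℓ` over the variables `A` is falsified by `α`. -/
def Refutes (ℓ : List (Clause X)) (A : Finset X) (α : X → ZMod 2) : Prop :=
  ∃ C ∈ ℓ, Falsifies α C ∧ ∀ l ∈ C.1, l.1 ∈ A

theorem Refutes.mono {ℓ ℓ' : List (Clause X)} {A A' : Finset X} {α : X → ZMod 2}
    (H : Refutes ℓ A α) (hℓ : ℓ ⊆ ℓ') (hA : A ⊆ A') : Refutes ℓ' A' α := by
  obtain ⟨C, hC, hα, hv⟩ := H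
  exact ⟨C, hℓ hC, hα, fun l hl => hA (hv l hl)⟩

theorem Refutes.congr {ℓ : List (Clause X)} {A : Finset X} {α β : X → ZMod 2}
    (H : Refutes ℓ A α) (hαβ : ∀ x ∈ A, α x = 0 ↔ β x = 0) : Refutes ℓ A β := by
  obtain ⟨C, hC, hα, hv⟩ := H
  exact ⟨C, hC, fun l hl => (hα l hl).trans (hαβ _ (hv l hl)), hv⟩

theorem Clause.width_le_card {C : Clause X} {A : Finset X} (hC : ∀ l ∈ C.1, l.1 ∈ A) :
    C.width ≤ A.card := by
  refine Finset.card_le_card_of_injOn Prod.fst hC ?_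
  rintro ⟨x, b⟩ hb ⟨x', b'⟩ hb' (rfl : x = x')
  have := C.2 x
  cases b <;> cases b' <;> simp_all

variable {F : CNF X} {w : ℕ}

/-- If every assignment with the property `P` can be refuted over `A` at the cost of one further
clause, then all of them can be refuted at the cost of one clause for each assignment to `A`. -/
theorem ResolutionDerivation.exists_refutes_forall {ℓ : List (Clause X)}
    (H : ResolutionDerivation F w ℓ) (A : Finset X) (P : (X → ZMod 2) → Prop)
    (hP : ∀ ℓ₁, ℓ ⊆ ℓ₁ → ResolutionDerivation F w ℓ₁ → ∀ α, P α → ∃ ℓ₂, ℓ₁ ⊆ ℓ₂ ∧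
      ResolutionDerivation F w ℓ₂ ∧ ℓ₂.length ≤ ℓ₁.length + 1 ∧ Refutes ℓ₂ A α) :
    ∃ ℓ', ℓ ⊆ ℓ' ∧ ResolutionDerivation F w ℓ' ∧ ℓ'.length ≤ ℓ.length + 2 ^ A.card ∧
      ∀ α, P α → Refutes ℓ' A α := by
  classical
  have key : ∀ U : Finset (Finset X), ∃ ℓ', ℓ ⊆ ℓ' ∧ ResolutionDerivation F w ℓ' ∧
      ℓ'.length ≤ ℓ.length + U.card ∧
      ∀ α, P α → (A.filter fun x => α x ≠ 0) ∈ U → Refutes ℓ' A α := by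
    intro U
    induction U using Finset.induction_on with
    | empty => exact ⟨ℓ, List.Subset.refl _, H, by simp, by simp⟩
    | insert B U hB ih =>
      obtain ⟨ℓ₁, h1, h2, h3, h4⟩ := ih
      rw [Finset.card_insert_of_notMem hB]
      by_cases hex : ∃ α, P α ∧ (A.filter fun x => α x ≠ 0) = B
      · obtain ⟨α, hα, rfl⟩ := hex
        obtain ⟨ℓ₂, g1, g2, g3, g4⟩ := hP ℓ₁ h1 h2 α hα
        refine ⟨ℓ₂, List.Subset.trans h1 g1, g2, by omega, ?_⟩
        intro β hβ hβU
        rcases Finset.mem_insert.1 hβU with he | hβU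
        · refine g4.congr fun x hx => ?_
          have := Finset.ext_iff.1 he x
          simp only [Finset.mem_filter, hx, true_and] at this
          tauto
        · exact (h4 β hβ hβU).mono g1 (Finset.Subset.refl _)
      · refine ⟨ℓ₁, h1, h2, by omega, ?_⟩
        intro β hβ hβU
        rcases Finset.mem_insert.1 hβU with he | hβU
        · exact (hex ⟨β, hβ, he⟩).elim
        · exact h4 β hβ hβU
  obtain ⟨ℓ', h1, h2, h3, h4⟩ := key A.powerset
  refine ⟨ℓ', h1, h2, by rwa [Finset.card_powerset] at h3, fun α hα => h4 α hα ?_⟩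
  simp

/-- If both values of `x` are refuted over `A` and `x`, then by resolving on `x` at the cost of at
most one clause, `α` is refuted over `A`. -/
theorem ResolutionDerivation.exists_refutes_of_update [DecidableEq X] {ℓ : List (Clause X)}
    (H : ResolutionDerivation F w ℓ) {A : Finset X} (hA : A.card ≤ w) {x : X} (α : X → ZMod 2)
    (h0 : Refutes ℓ (insert x A) (Function.update α x 0))
    (h1 : Refutes ℓ (insert x A) (Function.update α x 1)) :
    ∃ ℓ', ℓ ⊆ ℓ' ∧ ResolutionDerivation F w ℓ' ∧ ℓ'.length ≤ ℓ.length + 1 ∧ Refutes ℓ' A α := by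
  have key : ∀ C : Clause X, ∀ z, Falsifies (Function.update α x z) C →
      ∀ l ∈ C.1, l.1 ≠ x → (l.2 = true ↔ α l.1 = 0) := by
    intro C z hC l hl hlx
    have := hC l hl
    rwa [Function.update_of_ne hlx] at this
  have key' : ∀ z, ∀ C ∈ ℓ, Falsifies (Function.update α x z) C → (∀ l ∈ C.1, l.1 ∈ insert x A) →
      (x, decide (z = 0)) ∉ C.1 → Refutes ℓ A α := by
    intro z C hC hf hv hx
    have hne : ∀ l ∈ C.1, l.1 ≠ x := by
      rintro ⟨y, b⟩ hl rfl
      have := hf _ hl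
      simp only [Function.update_self] at this
      apply hx
      convert hl using 2
      rw [Bool.eq_iff_iff, this]
      simp
    exact ⟨C, hC, fun l hl => key C z hf l hl (hne l hl),
      fun l hl => Finset.mem_of_mem_insert_of_ne (hv l hl) (hne l hl)⟩
  obtain ⟨C, hC, hf, hv⟩ := h0
  obtain ⟨C', hC', hf', hv'⟩ := h1
  by_cases hx : (x, true) ∈ C.1
  swap
  · exact ⟨ℓ, List.Subset.refl _, H, by omega, key' 0 C hC hf hv (by simpa using hx)⟩
  by_cases hx' : (x, false) ∈ C'.1
  swap
  · exact ⟨ℓ, List.Subset.refl _, H, by omega, key' 1 C' hC' hf' hv' (by simpa using hx')⟩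
  have hne : ∀ l ∈ C.1.erase (x, true) ∪ C'.1.erase (x, false), l.1 ≠ x ∧ (l ∈ C.1 ∨ l ∈ C'.1) := by
    rintro ⟨y, b⟩ hl
    rw [Finset.mem_union, Finset.mem_erase, Finset.mem_erase] at hl
    refine ⟨?_, hl.imp And.right And.right⟩
    rintro (rfl : y = x)
    have h1 := C.2 y
    have h2 := C'.2 y
    cases b <;> simp_all
  have hval : ∀ l ∈ C.1.erase (x, true) ∪ C'.1.erase (x, false), (l.2 = true ↔ α l.1 = 0) := by
    intro l hl
    obtain ⟨h1, h2 | h2⟩ := hne l hl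
    · exact key C _ hf l h2 h1
    · exact key C' _ hf' l h2 h1
  let D : Clause X := ⟨C.1.erase (x, true) ∪ C'.1.erase (x, false), by
    rintro y ⟨h1, h2⟩
    have h1 := hval _ h1
    have h2 := hval _ h2
    simp only [true_iff, Bool.false_eq_true, false_iff] at h1 h2
    exact h2 h1⟩
  have hDv : ∀ l ∈ D.1, l.1 ∈ A := by
    intro l hl
    obtain ⟨h1, h2 | h2⟩ := hne l hl
    · exact Finset.mem_of_mem_insert_of_ne (hv l h2) h1
    · exact Finset.mem_of_mem_insert_of_ne (hv' l h2) h1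
  have hD : IsResolvent C C' D := ⟨x, hx, hx', by
    ext l
    simp only [D, Finset.mem_union, Finset.mem_erase]⟩
  exact ⟨D :: ℓ, by simp, .resolve H hC hC' hD ((Clause.width_le_card hDv).trans hA), by simp,
    D, by simp, hval, hDv⟩

/-- Elimination of at most one variable: if all assignments with a property that does not depend on
`E` are refuted over `A ∪ E`, then by resolving on `E` they are refuted over `A`. -/
theorem ResolutionDerivation.exists_refutes_of_union [DecidableEq X] {ℓ : List (Clause X)}
    (H : ResolutionDerivation F w ℓ) {A E : Finset X} (hA : A.card ≤ w) (hE : E.card ≤ 1)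
    (P : (X → ZMod 2) → Prop)
    (hP : ∀ α β, (∀ x ∉ E, α x = β x) → P α → P β)
    (href : ∀ α, P α → Refutes ℓ (A ∪ E) α) :
    ∃ ℓ', ℓ ⊆ ℓ' ∧ ResolutionDerivation F w ℓ' ∧ ℓ'.length ≤ ℓ.length + 2 ^ A.card ∧
      ∀ α, P α → Refutes ℓ' A α := by
  rcases Nat.le_one_iff_eq_zero_or_eq_one.1 hE with hE | hE
  · rw [Finset.card_eq_zero] at hE
    subst hE
    exact ⟨ℓ, List.Subset.refl _, H, by simp, by simpa using href⟩
  · obtain ⟨x, rfl⟩ := Finset.card_eq_one.1 hE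
    refine H.exists_refutes_forall A P fun ℓ₁ hℓ H₁ α hα => ?_
    have hins : A ∪ {x} = insert x A := by
      rw [Finset.union_comm, ← Finset.insert_eq]
    have hup : ∀ z, Refutes ℓ₁ (insert x A) (Function.update α x z) := by
      intro z
      have := href (Function.update α x z) (hP α _ (fun y hy => by
        rw [Function.update_of_ne (by simpa using hy)]) hα)
      rw [hins] at this
      exact this.mono hℓ (Finset.Subset.refl _)
    exact H₁.exists_refutes_of_update hA α (hup 0) (hup 1)

end Derivations

/-! ### Refuting the formula by a sweep along the helix -/

namespace Helix

variable {h : Helix}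

variable (h) in
open scoped Classical in
/-- The variables of the edges between the vertices below `y` and the remaining ones. -/
noncomputable def cut (y : ℤ) : Finset h.Var :=
  h.cls false (y - 1) ∪ (Finset.range h.rows).biUnion fun i => h.cls true (y - 1 - i)

/-- The sum of an assignment over the edges between the vertices below `y` and the others. -/
noncomputable def cutSum (α : h.Var → ZMod 2) (y : ℤ) : ZMod 2 :=
  val α false (y - 1) + ∑ i ∈ Finset.range h.rows, val α true (y - 1 - i)

theorem card_cut_le (y : ℤ) : (h.cut y).card ≤ h.rows + 1 := by
  classical
  refine (Finset.card_union_le _ _).trans ?_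
  rw [add_comm]
  refine add_le_add ?_ (card_cls_le _ _)
  refine Finset.card_biUnion_le.trans ((Finset.sum_le_sum fun i _ => card_cls_le _ _).trans ?_)
  simp

theorem cls_eq_empty {s : Bool} {t : ℤ} (ht : t < 0 ∨ h.len ≤ t + h.step s) : h.cls s t = ∅ := by
  rw [Finset.eq_empty_iff_forall_notMem]
  intro x hx
  have := bounds_of_mem_cls hx
  omega

theorem cutSum_zero (α : h.Var → ZMod 2) : cutSum α 0 = 0 := by
  rw [cutSum, val, cls_eq_empty (by left; omega)]
  simp only [Finset.sum_empty, zero_add]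
  refine Finset.sum_eq_zero fun i _ => ?_
  rw [val, cls_eq_empty (by left; omega), Finset.sum_empty]

theorem cut_len : h.cut h.len = ∅ := by
  classical
  rw [cut, cls_eq_empty (by right; simp), Finset.empty_union, Finset.eq_empty_iff_forall_notMem]
  intro x hx
  obtain ⟨i, hi, hx⟩ := Finset.mem_biUnion.1 hx
  rw [Finset.mem_range] at hi
  have := (bounds_of_mem_cls hx).2
  simp only [step_true] at this
  omega

theorem cutSum_len (α : h.Var → ZMod 2) : cutSum α h.len = 0 := by
  rw [cutSum, val, cls_eq_empty (by right; simp)]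
  simp only [Finset.sum_empty, zero_add]
  refine Finset.sum_eq_zero fun i hi => ?_
  rw [Finset.mem_range] at hi
  rw [val, cls_eq_empty (by right; simp only [step_true]; omega), Finset.sum_empty]

theorem cutSum_add_one (α : h.Var → ZMod 2) (y : ℤ) :
    cutSum α (y + 1) = cutSum α y + ∑ x ∈ h.inc y, α x := by
  have e := Finset.sum_range_succ' (fun i : ℕ => val α true (y - i)) h.rows
  rw [Finset.sum_range_succ] at e
  have e1 : ∀ i : ℕ, y - ((i + 1 : ℕ) : ℤ) = y - 1 - i := fun i => by push_cast; ring
  simp only [e1, Nat.cast_zero, sub_zero] at e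
  rw [sum_inc, cutSum, cutSum]
  simp only [add_sub_cancel_right]
  have h2 : ∀ z : ZMod 2, z + z = 0 := by decide
  linear_combination (e + h2 (val α false (y - 1)) * (-1) + h2 (val α true (y - h.rows)) * (-1))

theorem cutSum_congr {α β : h.Var → ZMod 2} {y : ℤ} (hαβ : ∀ x ∈ h.cut y, α x = β x) :
    cutSum α y = cutSum β y := by
  classical
  have hval : ∀ s t, h.cls s t ⊆ h.cut y → val α s t = val β s t := fun s t hs =>
    Finset.sum_congr rfl fun x hx => hαβ x (hs hx)
  rw [cutSum, cutSum, hval _ _ Finset.subset_union_left]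
  congr 1
  refine Finset.sum_congr rfl fun i hi => hval _ _ ?_
  exact (Finset.subset_biUnion_of_mem (fun i : ℕ => h.cls true (y - 1 - i)) hi).trans
    Finset.subset_union_right

theorem mem_cut {y : ℤ} {x : h.Var} : x ∈ h.cut y ↔
    x ∈ h.cls false (y - 1) ∨ ∃ i : ℕ, i < h.rows ∧ x ∈ h.cls true (y - 1 - i) := by
  simp [cut]

theorem notMem_cut_add_one {y : ℤ} {x : h.Var}
    (hx : x ∈ h.cls false (y - 1) ∨ x ∈ h.cls true (y - h.rows)) : x ∉ h.cut (y + 1) := by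
  have h2 := h.two_le_rows
  rw [mem_cut]
  simp only [add_sub_cancel_right]
  rcases hx with hx | hx
  · rintro (hx' | ⟨i, -, hx'⟩)
    · have : y - 1 = y :=
        (eq_of_mem_cls_of_incident (v := y) (Or.inr rfl) (Or.inl rfl) hx hx').2
      omega
    · exact Bool.noConfusion (cls_invariant hx hx').1
  · rintro (hx' | ⟨i, hi, hx'⟩)
    · exact Bool.noConfusion (cls_invariant hx hx').1
    · rcases Nat.eq_zero_or_pos i with rfl | hi0
      · rw [Nat.cast_zero, sub_zero] at hx'
        have : y - h.rows = y :=
          (eq_of_mem_cls_of_incident (v := y) (Or.inr rfl) (Or.inl rfl) hx hx').2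
        omega
      · have hd : (h.rows : ℤ) ∣ (y - i) - (y - h.rows) := Int.ModEq.dvd (cls_invariant hx hx').2
        have := Int.le_of_dvd (by omega) hd
        omega

theorem cut_union_inc_subset (y : ℤ) [DecidableEq h.Var] : h.cut y ∪ h.inc y ⊆
    (h.cut (y + 1) ∪ h.cls false (y - 1)) ∪ h.cls true (y - h.rows) := by
  have h2 := h.two_le_rows
  intro x hx
  rw [Finset.mem_union, mem_cut, mem_inc] at hx
  rw [Finset.mem_union, Finset.mem_union, mem_cut]
  simp only [add_sub_cancel_right]
  rcases hx with (hx | ⟨i, hi, hx⟩) | ⟨s, t, rfl | rfl, hx⟩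
  · tauto
  · by_cases hi' : i + 1 < h.rows
    · left; left; right
      exact ⟨i + 1, hi', by convert hx using 2; push_cast; ring⟩
    · right
      convert hx using 2
      omega
  · left; left
    cases s
    · exact Or.inl hx
    · exact Or.inr ⟨0, by omega, by simpa using hx⟩
  · cases s
    · exact Or.inl (Or.inr hx)
    · exact Or.inr hx

/-- The charge of the vertices below `y`. -/
def charge (χ : Fin h.len → ZMod 2) (y : ℕ) : ZMod 2 :=
  ∑ v ∈ Finset.univ.filter fun v : Fin h.len => (v : ℕ) < y, χ v

theorem charge_add_one (χ : Fin h.len → ZMod 2) (v : Fin h.len) :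
    charge χ (v + 1) = charge χ v + χ v := by
  rw [charge, charge, add_comm _ (χ v), ← Finset.sum_insert (by simp)]
  refine Finset.sum_congr ?_ fun _ _ => rfl
  ext u
  simp only [Finset.mem_filter, Finset.mem_univ, true_and, Finset.mem_insert, Fin.ext_iff]
  omega

variable {χ : Fin h.len → ZMod 2}

theorem exists_clause {v : Fin h.len} {α : h.Var → ZMod 2}
    (hα : ∑ x ∈ h.inc (v : ℕ), α x ≠ χ v) : ∃ C ∈ h.compression.compressedTseitin χ,
      Falsifies α C ∧ (∀ l ∈ C.1, l.1 ∈ h.inc (v : ℕ)) ∧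
        ∀ x ∈ h.inc (v : ℕ), ∃ b, (x, b) ∈ C.1 := by
  have hfin : {l : Literal h.Var | l.1 ∈ h.inc (v : ℕ) ∧ (l.2 = true ↔ α l.1 = 0)}.Finite :=
    Set.toFinite _
  have hmem : ∀ l, l ∈ hfin.toFinset ↔ l.1 ∈ h.inc (v : ℕ) ∧ (l.2 = true ↔ α l.1 = 0) := by simp
  refine ⟨⟨hfin.toFinset, ?_⟩, mem_compressedTseitin.2 ⟨v, α, hα, hmem⟩, ?_, ?_,
    fun x hx => ⟨decide (α x = 0), (hmem _).2 ⟨hx, by simp⟩⟩⟩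
  · rintro x ⟨h1, h2⟩
    have h1 := ((hmem _).1 h1).2
    have h2 := ((hmem _).1 h2).2
    simp only [true_iff, Bool.false_eq_true, false_iff] at h1 h2
    exact h2 h1
  · exact fun l hl => ((hmem l).1 hl).2
  · exact fun l hl => ((hmem l).1 hl).1

/-- Wrong parities of the cut at `y` can be refuted over the variables of the cut. Passing a vertex
requires its own clauses and those that eliminate the two edges ending there. -/
theorem exists_derivation_cut (χ : Fin h.len → ZMod 2) (h3 : 3 ≤ h.rows) (y : ℕ) (hy : y ≤ h.len) :
    ∃ ℓ, ResolutionDerivation (h.compression.compressedTseitin χ) (h.rows + 2) ℓ ∧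
      ℓ.length ≤ y * (8 * 2 ^ h.rows) ∧ ∀ α, cutSum α y ≠ charge χ y → Refutes ℓ (h.cut y) α := by
  classical
  induction y with
  | zero => exact ⟨[], .nil, by simp, by simp [charge, cutSum_zero]⟩
  | succ y ih =>
    obtain ⟨ℓ, H, hlen, href⟩ := ih (by omega)
    set v : Fin h.len := ⟨y, hy⟩ with hv
    -- the clauses of the vertex `v` are listed first
    obtain ⟨ℓ₁, g1, H₁, hlen₁, href₁⟩ := H.exists_refutes_forall (h.inc (v : ℕ))
      (fun α => ∑ x ∈ h.inc (v : ℕ), α x ≠ χ v) (by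
        intro ℓ₁ _ H₁ α hα
        obtain ⟨C, hC, hf, hvar, -⟩ := exists_clause hα
        refine ⟨C :: ℓ₁, by simp, .initial H₁ hC ?_, by simp, C, by simp, hf, hvar⟩
        have := (Clause.width_le_card hvar).trans (card_inc_le _)
        omega)
    have hwrong : ∀ α, cutSum α ((y : ℤ) + 1) ≠ charge χ (y + 1) →
        Refutes ℓ₁ ((h.cut ((y : ℤ) + 1) ∪ h.cls false ((y : ℤ) - 1)) ∪
          h.cls true ((y : ℤ) - h.rows)) α := by
      intro α hα
      rw [cutSum_add_one, show y + 1 = (v : ℕ) + 1 from rfl, charge_add_one] at hα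
      have : Refutes ℓ₁ (h.cut y ∪ h.inc y) α := by
        by_cases hc : cutSum α y = charge χ y
        · refine (href₁ α fun e => hα ?_).mono (List.Subset.refl _) Finset.subset_union_right
          rw [hc, ← e]
        · exact (href α hc).mono g1 Finset.subset_union_left
      exact this.mono (List.Subset.refl _) (cut_union_inc_subset _)
    have hinv : ∀ α β : h.Var → ZMod 2, (∀ x ∉ h.cls false ((y : ℤ) - 1), α x = β x) ∨
        (∀ x ∉ h.cls true ((y : ℤ) - h.rows), α x = β x) →
        cutSum α ((y : ℤ) + 1) ≠ charge χ (y + 1) → cutSum β ((y : ℤ) + 1) ≠ charge χ (y + 1) := by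
      intro α β hαβ hα
      rwa [← cutSum_congr (α := α)]
      intro x hx
      rcases hαβ with hαβ | hαβ
      · exact hαβ x fun hx' => notMem_cut_add_one (Or.inl hx') hx
      · exact hαβ x fun hx' => notMem_cut_add_one (Or.inr hx') hx
    have hcard : (h.cut ((y : ℤ) + 1) ∪ h.cls false ((y : ℤ) - 1)).card ≤ h.rows + 2 := by
      refine (Finset.card_union_le _ _).trans ?_
      have := h.card_cut_le ((y : ℤ) + 1)
      have := h.card_cls_le false ((y : ℤ) - 1)
      omega
    obtain ⟨ℓ₂, g2, H₂, hlen₂, href₂⟩ := H₁.exists_refutes_of_union hcard (card_cls_le _ _)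
      (fun α => cutSum α ((y : ℤ) + 1) ≠ charge χ (y + 1))
      (fun α β hαβ => hinv α β (Or.inr hαβ)) hwrong
    obtain ⟨ℓ₃, g3, H₃, hlen₃, href₃⟩ := H₂.exists_refutes_of_union
      ((h.card_cut_le ((y : ℤ) + 1)).trans (by omega)) (card_cls_le _ _)
      (fun α => cutSum α ((y : ℤ) + 1) ≠ charge χ (y + 1))
      (fun α β hαβ => hinv α β (Or.inl hαβ)) href₂
    refine ⟨ℓ₃, H₃, ?_, by exact_mod_cast href₃⟩
    have e1 : 2 ^ (h.inc (v : ℕ)).card ≤ 2 ^ 4 := Nat.pow_le_pow_right (by omega) (card_inc_le _)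
    have e2 := Nat.pow_le_pow_right (n := 2) (by omega) hcard
    have e3 := Nat.pow_le_pow_right (n := 2) (by omega) (h.card_cut_le ((y : ℤ) + 1))
    have e4 := Nat.pow_le_pow_right (n := 2) (by omega) h3
    rw [pow_add] at e2 e3
    rw [add_mul]
    omega

/-- The sweep refutes the formula. -/
theorem exists_refutation (hχ : ∑ v, χ v = 1) (h3 : 3 ≤ h.rows) :
    ∃ π : Refutation (h.compression.compressedTseitin χ), π.width ≤ h.rows + 2 ∧
      π.size ≤ h.len * (8 * 2 ^ h.rows) := by
  obtain ⟨ℓ, H, hlen, href⟩ := exists_derivation_cut χ h3 h.len le_rfl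
  obtain ⟨C, hC, -, hv⟩ := href 0 (by
    rw [cutSum_len, charge, Finset.filter_true_of_mem (fun v _ => v.2), hχ]
    decide)
  rw [cut_len] at hv
  obtain ⟨π, hw, hs⟩ := H.exists_refutation hC
    (Finset.eq_empty_of_forall_notMem fun l hl => by simpa using hv l hl)
  exact ⟨π, hw, hs.trans hlen⟩

end Helix

/-! ### Flows on the helix -/

namespace Helix

variable (h : Helix)

/-- The sum over the edges at `v` of a family indexed by the edges. -/
def divergence (f : Bool → ℤ → ZMod 2) (v : ℤ) : ZMod 2 :=
  f false v + f false (v - 1) + f true v + f true (v - h.rows)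

/-- The flow along the whole helix with one unit from left to right, changed by the boundaries of
the faces in `R`; the face `t` has the corners `t`, `t + 1`, `t + rows`, `t + rows + 1`. -/
def flow (R : ℤ → ZMod 2) (s : Bool) (t : ℤ) : ZMod 2 :=
  if s then R t + R (t - 1) else 1 + R t + R (t - h.rows)

@[simp] theorem flow_true (R : ℤ → ZMod 2) (t : ℤ) : h.flow R true t = R t + R (t - 1) := rfl
@[simp] theorem flow_false (R : ℤ → ZMod 2) (t : ℤ) :
    h.flow R false t = 1 + R t + R (t - h.rows) := rfl

/-- The part of a flow on the edges whose smaller end lies in `[y, y')`. -/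
def truncFlow (R : ℤ → ZMod 2) (y y' : ℤ) (s : Bool) (t : ℤ) : ZMod 2 :=
  if y ≤ t ∧ t < y' then h.flow R s t else 0

theorem zmod_two_add_self (z : ZMod 2) : z + z = 0 := CharTwo.add_self_eq_zero z

theorem divergence_flow (R : ℤ → ZMod 2) (v : ℤ) : h.divergence (h.flow R) v = 0 := by
  simp only [divergence, flow_true, flow_false]
  rw [show v - 1 - (h.rows : ℤ) = v - h.rows - 1 by ring]
  linear_combination zmod_two_add_self 1 + zmod_two_add_self (R v) + zmod_two_add_self (R (v - 1))
    + zmod_two_add_self (R (v - h.rows)) + zmod_two_add_self (R (v - h.rows - 1))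

theorem sum_telescope (g : ℤ → ZMod 2) (y : ℤ) (n : ℕ) :
    ∑ i ∈ Finset.range n, (g (y + i) + g (y + i - 1)) = g (y + n - 1) + g (y - 1) := by
  induction n with
  | zero => simp [zmod_two_add_self]
  | succ n ih =>
    rw [Finset.sum_range_succ, ih]
    push_cast
    rw [show y + (n + 1 : ℤ) - 1 = y + n by ring]
    linear_combination zmod_two_add_self (g (y + n - 1))

theorem sum_divergence (f : Bool → ℤ → ZMod 2) (y : ℤ) :
    ∑ i ∈ Finset.range h.rows, h.divergence f (y + i) = f false (y + h.rows - 1) + f false (y - 1) +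
      ∑ i ∈ Finset.range h.rows, f true (y + i) +
      ∑ i ∈ Finset.range h.rows, f true (y + i - h.rows) := by
  simp only [divergence, Finset.sum_add_distrib, ← sum_telescope]

variable {h}

theorem divergence_truncFlow_of_outside {R : ℤ → ZMod 2} {y y' v : ℤ}
    (hv : v < y ∨ y' + h.rows ≤ v ∨ (y + h.rows ≤ v ∧ v < y')) :
    h.divergence (h.truncFlow R y y') v = 0 := by
  have h2 := h.two_le_rows
  rcases hv with hv | hv | hv
  · simp only [divergence, truncFlow]
    rw [if_neg (by omega), if_neg (by omega), if_neg (by omega), if_neg (by omega)]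
    simp
  · simp only [divergence, truncFlow]
    rw [if_neg (by omega), if_neg (by omega), if_neg (by omega), if_neg (by omega)]
    simp
  · rw [← h.divergence_flow R v]
    simp only [divergence, truncFlow]
    rw [if_pos (by omega), if_pos (by omega), if_pos (by omega), if_pos (by omega)]

theorem sum_divergence_truncFlow_left {R : ℤ → ZMod 2} {y y' : ℤ} (hy : y + h.rows ≤ y') :
    ∑ i ∈ Finset.range h.rows, h.divergence (h.truncFlow R y y') (y + i) = 1 := by
  have h2 := h.two_le_rows
  rw [sum_divergence]
  have e1 : ∑ i ∈ Finset.range h.rows, h.truncFlow R y y' true (y + i) =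
      ∑ i ∈ Finset.range h.rows, (R (y + i) + R (y + i - 1)) := by
    refine Finset.sum_congr rfl fun i hi => ?_
    rw [Finset.mem_range] at hi
    rw [truncFlow, if_pos (by omega), flow_true]
  have e2 : ∑ i ∈ Finset.range h.rows, h.truncFlow R y y' true (y + i - h.rows) = 0 := by
    refine Finset.sum_eq_zero fun i hi => ?_
    rw [Finset.mem_range] at hi
    rw [truncFlow, if_neg (by omega)]
  rw [e1, e2, sum_telescope, truncFlow, if_pos (by omega), truncFlow, if_neg (by omega), flow_false,
    show y + (h.rows : ℤ) - 1 - h.rows = y - 1 by ring]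
  linear_combination zmod_two_add_self (R (y + h.rows - 1)) + zmod_two_add_self (R (y - 1))

theorem sum_divergence_truncFlow_right {R : ℤ → ZMod 2} {y y' : ℤ} (hy : y + h.rows ≤ y') :
    ∑ i ∈ Finset.range h.rows, h.divergence (h.truncFlow R y y') (y' + i) = 1 := by
  have h2 := h.two_le_rows
  rw [sum_divergence]
  have e1 : ∑ i ∈ Finset.range h.rows, h.truncFlow R y y' true (y' + i - h.rows) =
      ∑ i ∈ Finset.range h.rows, (R (y' - h.rows + i) + R (y' - h.rows + i - 1)) := by
    refine Finset.sum_congr rfl fun i hi => ?_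
    rw [Finset.mem_range] at hi
    rw [truncFlow, if_pos (by omega), flow_true,
      show y' + (i : ℤ) - h.rows = y' - h.rows + i by ring]
  have e2 : ∑ i ∈ Finset.range h.rows, h.truncFlow R y y' true (y' + i) = 0 := by
    refine Finset.sum_eq_zero fun i hi => ?_
    rw [truncFlow, if_neg (by omega)]
  rw [e1, e2, sum_telescope, truncFlow, if_neg (by omega), truncFlow, if_pos (by omega), flow_false,
    show y' - (h.rows : ℤ) + h.rows - 1 = y' - 1 by ring,
    show y' - 1 - (h.rows : ℤ) = y' - h.rows - 1 by ring]
  linear_combination zmod_two_add_self (R (y' - 1)) + zmod_two_add_self (R (y' - h.rows - 1))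

/-! ### Moving the violated constraint along a flow -/

/-- The deviation of `α` from the constraint of the vertex `v`, for the charge concentrated in the
vertex `0`. -/
noncomputable def viol (α : h.Var → ZMod 2) (v : ℤ) : ZMod 2 :=
  h.divergence (val α) v + if v = 0 then 1 else 0

theorem val_add (α β : h.Var → ZMod 2) (s : Bool) (t : ℤ) :
    val (α + β) s t = val α s t + val β s t := Finset.sum_add_distrib

theorem viol_add (α β : h.Var → ZMod 2) (v : ℤ) :
    viol (α + β) v = viol α v + h.divergence (val β) v := by
  simp only [viol, divergence, val_add]
  ring

theorem exists_lift_val {f : Bool → ℤ → ZMod 2} (hf : h.Closed f)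
    (h0 : ∀ s t, (t < 0 ∨ h.len ≤ t + h.step s) → f s t = 0) :
    ∃ α : h.Var → ZMod 2, val α = f ∧ ∀ s t, ∀ x ∈ h.cls s t, α x = f s t := by
  obtain ⟨α, hα⟩ := exists_lift hf
  refine ⟨α, ?_, hα⟩
  funext s t
  by_cases hst : t < 0 ∨ h.len ≤ t + h.step s
  · rw [h0 s t hst, val, cls_eq_empty hst, Finset.sum_empty]
  · obtain ⟨x, hx⟩ := h.cls_nonempty (s := s) (t := t) (by omega) (by omega)
    rw [val_of_mem hx, hα s t x hx]

/-- The classes in `S` contain none of the steps that start in `[x, x + rows)`. -/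
def IsFree (S : Finset h.Var) (x : ℤ) : Prop :=
  ∀ t, x ≤ t → t < x + h.rows → ∀ z ∈ S, z ∉ h.cls false t

/-- `α` violates only constraints of vertices in `[x, x + rows)`, and an odd number of them. -/
structure ViolatesOnly (α : h.Var → ZMod 2) (x : ℤ) : Prop where
  viol_eq_zero : ∀ v : ℤ, 0 ≤ v → v < h.len → (v < x ∨ x + h.rows ≤ v) → viol α v = 0
  sum_viol : ∑ i ∈ Finset.range h.rows, viol α (x + i) = 1

/-- The position `x` lies in one of the two uncompressed zones, at a distance from the compressed
part. -/
def InZone (x : ℤ) : Prop :=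
  0 ≤ x ∧ x + h.rows ≤ h.len ∧ (x + 2 * h.rows ≤ h.lo ∨ h.hi ≤ x)

/-- If a flow avoids `S` between the positions `x` and `x'`, then the violated constraint can be
moved from `x` to `x'` without changing the assignment on `S`. -/
theorem ViolatesOnly.exists_move {α : h.Var → ZMod 2} {S : Finset h.Var} {x x' : ℤ}
    (hα : ViolatesOnly α x) (hfree : IsFree S x) (hx : h.InZone x) (hx' : h.InZone x')
    (R : ℤ → ZMod 2) (hne : x + h.rows ≤ x' ∨ x' + h.rows ≤ x)
    (hclosed : h.Closed (h.truncFlow R (min x x') (max x x')))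
    (havoid : ∀ s t, min x x' ≤ t → t < max x x' → ∀ z ∈ S, z ∈ h.cls s t → h.flow R s t = 0) :
    ∃ α' : h.Var → ZMod 2, (∀ z ∈ S, α' z = α z) ∧ ViolatesOnly α' x' := by
  have h2 := h.two_le_rows
  obtain ⟨hb1, hb2, hzone⟩ := hx
  obtain ⟨hb1', hb2', -⟩ := hx'
  set f := h.truncFlow R (min x x') (max x x') with hf
  obtain ⟨τ, hτ, hτ'⟩ := exists_lift_val hclosed (by
    intro s t ht
    have := h.step_le s
    exact if_neg (by omega))
  have hdiv_out : ∀ v, (v < x ∨ x + h.rows ≤ v) → (v < x' ∨ x' + h.rows ≤ v) →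
      h.divergence f v = 0 := fun v h1 h2 => divergence_truncFlow_of_outside (by omega)
  have hdiv : ∑ i ∈ Finset.range h.rows, h.divergence f (x + i) = 1 ∧
      ∑ i ∈ Finset.range h.rows, h.divergence f (x' + i) = 1 := by
    rcases hne with hne | hne
    · rw [hf, min_eq_left (by omega), max_eq_right (by omega)]
      exact ⟨sum_divergence_truncFlow_left hne, sum_divergence_truncFlow_right hne⟩
    · rw [hf, min_eq_right (by omega), max_eq_left (by omega)]
      exact ⟨sum_divergence_truncFlow_right hne, sum_divergence_truncFlow_left hne⟩
  -- the flow leaves an even number of violations near `x`, which the steps starting there cancel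
  set w : ℤ → ZMod 2 := viol (α + τ) with hw
  have hw' : ∀ v, w v = viol α v + h.divergence f v := fun v => by rw [hw, viol_add, hτ]
  have hwsum : ∑ i ∈ Finset.range h.rows, w (x + i) = 0 := by
    simp only [hw', Finset.sum_add_distrib, hα.sum_viol, hdiv.1]
    decide
  set g : Bool → ℤ → ZMod 2 := fun s t => if s = false ∧ x ≤ t ∧ t < x + h.rows - 1 then
    ∑ i ∈ Finset.range (t - x + 1).toNat, w (x + i) else 0 with hg
  have hg0 : ∀ s t, (s = true ∨ t < x ∨ x + h.rows - 1 ≤ t) → g s t = 0 := by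
    intro s t ht
    simp only [hg]
    rw [if_neg]
    rintro ⟨rfl, h1, h2⟩
    simp only [Bool.false_eq_true, false_or] at ht
    omega
  have hgc : h.Closed g := by
    rintro s t t' ⟨⟨h1, h2⟩, ⟨h3, h4⟩, -⟩
    have := h.step_le s
    have := h.step_pos s
    rw [hg0 _ _ (by omega), hg0 _ _ (by omega), hg0 _ _ (by omega), hg0 _ _ (by omega)]
    simp
  obtain ⟨σ, hσ, hσ'⟩ := exists_lift_val hgc (by
    intro s t ht
    refine hg0 _ _ ?_
    cases s
    · right
      simp only [step_false] at ht
      omega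
    · exact Or.inl rfl)
  have hgsum : ∀ j : ℕ, j < h.rows →
      g false (x + j) = ∑ i ∈ Finset.range (j + 1), w (x + i) := by
    intro j hj
    by_cases hj' : j + 1 < h.rows
    · simp only [hg]
      rw [if_pos ⟨trivial, by omega, by omega⟩]
      congr 2
      omega
    · rw [hg0 _ _ (by omega), show j + 1 = h.rows by omega, hwsum]
  have hgdiv : ∀ v, (x ≤ v ∧ v < x + h.rows → h.divergence g v = w v) ∧
      (v < x ∨ x + h.rows ≤ v → h.divergence g v = 0) := by
    intro v
    constructor
    · rintro ⟨h1, h2⟩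
      obtain ⟨j, rfl⟩ : ∃ j : ℕ, v = x + j := ⟨(v - x).toNat, by omega⟩
      simp only [divergence]
      rw [hg0 true _ (Or.inl rfl), hg0 true _ (Or.inl rfl), hgsum j (by omega),
        Finset.sum_range_succ]
      rcases j with _ | j
      · rw [hg0 _ _ (by omega)]
        simp
      · rw [show x + ((j + 1 : ℕ) : ℤ) - 1 = x + j by push_cast; ring, hgsum j (by omega)]
        linear_combination zmod_two_add_self (∑ i ∈ Finset.range (j + 1), w (x + i))
    · intro hv
      simp only [divergence]
      rw [hg0 true _ (Or.inl rfl), hg0 true _ (Or.inl rfl), hg0 _ _ (by omega), hg0 _ _ (by omega)]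
      simp
  have hviol : ∀ v, viol (α + τ + σ) v = w v + h.divergence g v := fun v => by rw [viol_add, hσ]
  refine ⟨α + τ + σ, ?_, ?_, ?_⟩
  · intro z hz
    obtain ⟨s, t, hst⟩ := exists_mem_cls z
    rw [Pi.add_apply, Pi.add_apply, hτ' s t z hst, hσ' s t z hst]
    have e1 : f s t = 0 := by
      by_cases ht : min x x' ≤ t ∧ t < max x x'
      · rw [hf, truncFlow, if_pos ht, havoid s t ht.1 ht.2 z hz hst]
      · rw [hf, truncFlow, if_neg ht]
    have e2 : g s t = 0 := by
      refine hg0 s t ?_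
      cases s
      · right
        by_contra hc
        exact hfree t (by omega) (by omega) z hz hst
      · exact Or.inl rfl
    rw [e1, e2, add_zero, add_zero]
  · intro v h0 h1 hv
    rw [hviol]
    by_cases hvx : v < x ∨ x + h.rows ≤ v
    · rw [(hgdiv v).2 hvx, hw', hα.viol_eq_zero v h0 h1 hvx, hdiv_out v hvx hv]
      simp
    · rw [(hgdiv v).1 (by omega), zmod_two_add_self]
  · rw [← hdiv.2]
    refine Finset.sum_congr rfl fun i hi => ?_
    rw [Finset.mem_range] at hi
    rw [hviol, (hgdiv _).2 (by omega), hw',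
      hα.viol_eq_zero (x' + i) (by omega) (by omega) (by omega)]
    simp

end Helix

/-! ### Flows that switch between two rows -/

open scoped Classical in
/-- The indicator of a proposition, with values in `ZMod 2`. -/
noncomputable def indic (p : Prop) : ZMod 2 := if p then 1 else 0

theorem indic_of_true {p : Prop} (hp : p) : indic p = 1 := if_pos hp

theorem indic_of_false {p : Prop} (hp : ¬ p) : indic p = 0 := if_neg hp

namespace Helix

section Switch

variable (h : Helix)

/-- The faces producing the flow that runs along the row `r` in the columns where `σ` fails and
along the row `r + d` in the columns where `σ` holds. Columns are counted from the row `r`. -/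
noncomputable def switchFaces (r d : ℤ) (σ : ℤ → Prop) (t : ℤ) : ZMod 2 :=
  (((t - r) / h.rows : ℤ) : ZMod 2) + indic ((t - r) % h.rows < d ∧ σ ((t - r) / h.rows))

variable {h}

theorem rows_pos : (0 : ℤ) < h.rows := by
  have := h.two_le_rows
  omega

theorem ediv_sub_rows (t : ℤ) : (t - h.rows) / h.rows = t / h.rows - 1 := by
  have := Int.add_mul_ediv_right t (-1) (rows_pos (h := h)).ne'
  rw [sub_eq_add_neg (t / _), ← this]
  congr 1
  ring

variable {r d : ℤ} {σ : ℤ → Prop}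

theorem flow_switchFaces_false (t : ℤ) : h.flow (h.switchFaces r d σ) false t =
    indic ((t - r) % h.rows < d ∧ σ ((t - r) / h.rows)) +
      indic ((t - r) % h.rows < d ∧ σ ((t - r) / h.rows - 1)) := by
  have e1 : (t - h.rows - r) / h.rows = (t - r) / h.rows - 1 := by
    rw [← ediv_sub_rows]
    congr 1
    ring
  have e2 : (t - h.rows - r) % h.rows = (t - r) % h.rows := by
    rw [show t - h.rows - r = (t - r) - h.rows by ring, Int.sub_emod_right]
  rw [flow_false, switchFaces, switchFaces, e1, e2]
  push_cast
  linear_combination zmod_two_add_self (((t - r) / h.rows : ℤ) : ZMod 2)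

theorem flow_switchFaces_true (hd : 0 < d) (hd' : d < h.rows) (t : ℤ) :
    h.flow (h.switchFaces r d σ) true t =
      indic ((t - r) % h.rows = 0 ∧ ¬ σ ((t - r) / h.rows)) +
        indic ((t - r) % h.rows = d ∧ σ ((t - r) / h.rows)) := by
  have hk := rows_pos (h := h)
  rw [flow_true, switchFaces, switchFaces]
  by_cases hr : (t - r) % h.rows = 0
  · have e : t - r = h.rows * ((t - r) / h.rows) := by
      have := Int.mul_ediv_add_emod (t - r) h.rows
      omega
    have e1 : t - 1 - r = (h.rows - 1) + h.rows * ((t - r) / h.rows - 1) := by linarith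
    have e2 : (t - 1 - r) / h.rows = (t - r) / h.rows - 1 := by
      rw [e1, Int.add_mul_ediv_left _ _ hk.ne', Int.ediv_eq_zero_of_lt (by omega) (by omega)]
      ring
    have e3 : (t - 1 - r) % h.rows = h.rows - 1 := by
      rw [e1, Int.add_mul_emod_self_left, Int.emod_eq_of_lt (by omega) (by omega)]
    rw [e2, e3, hr, indic_of_false (p := _ - 1 < d ∧ _) (by omega),
      indic_of_false (p := 0 = d ∧ _) (by omega)]
    push_cast
    by_cases hs : σ ((t - r) / h.rows)
    · rw [indic_of_true ⟨hd, hs⟩, indic_of_false (by tauto)]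
      linear_combination zmod_two_add_self (((t - r) / h.rows : ℤ) : ZMod 2)
    · rw [indic_of_false (by tauto), indic_of_true ⟨trivial, hs⟩]
      linear_combination zmod_two_add_self (((t - r) / h.rows : ℤ) : ZMod 2) - zmod_two_add_self 1
  · have hpos : 0 < (t - r) % h.rows := lt_of_le_of_ne (Int.emod_nonneg _ hk.ne') (Ne.symm hr)
    have hlt := Int.emod_lt_of_pos (t - r) hk
    have e1 : t - 1 - r = ((t - r) % h.rows - 1) + h.rows * ((t - r) / h.rows) := by
      have := Int.mul_ediv_add_emod (t - r) h.rows
      linarith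
    have e2 : (t - 1 - r) / h.rows = (t - r) / h.rows := by
      rw [e1, Int.add_mul_ediv_left _ _ hk.ne', Int.ediv_eq_zero_of_lt (by omega) (by omega)]
      ring
    have e3 : (t - 1 - r) % h.rows = (t - r) % h.rows - 1 := by
      rw [e1, Int.add_mul_emod_self_left, Int.emod_eq_of_lt (by omega) (by omega)]
    rw [e2, e3, indic_of_false (p := _ = 0 ∧ _) (by tauto)]
    by_cases hs : σ ((t - r) / h.rows)
    · rcases lt_trichotomy ((t - r) % h.rows) d with hlt | heq | hgt
      · rw [indic_of_true ⟨hlt, hs⟩, indic_of_true ⟨by omega, hs⟩, indic_of_false (by omega)]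
        linear_combination zmod_two_add_self (((t - r) / h.rows : ℤ) : ZMod 2) +
          zmod_two_add_self 1
      · rw [indic_of_false (by omega), indic_of_true ⟨by omega, hs⟩, indic_of_true ⟨heq, hs⟩]
        linear_combination zmod_two_add_self (((t - r) / h.rows : ℤ) : ZMod 2)
      · rw [indic_of_false (by omega), indic_of_false (by omega), indic_of_false (by omega)]
        linear_combination zmod_two_add_self (((t - r) / h.rows : ℤ) : ZMod 2)
    · rw [indic_of_false (by tauto), indic_of_false (by tauto), indic_of_false (by tauto)]
      linear_combination zmod_two_add_self (((t - r) / h.rows : ℤ) : ZMod 2)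

theorem flow_switchFaces_false_eq_zero (t : ℤ) (hσ : (t - r) % h.rows < d →
    (σ ((t - r) / h.rows) ↔ σ ((t - r) / h.rows - 1))) :
    h.flow (h.switchFaces r d σ) false t = 0 := by
  rw [flow_switchFaces_false,
    show ((t - r) % h.rows < d ∧ σ ((t - r) / h.rows - 1)) =
      ((t - r) % h.rows < d ∧ σ ((t - r) / h.rows)) from
      propext (and_congr_right fun hd => (hσ hd).symm)]
  exact zmod_two_add_self _

theorem flow_switchFaces_true_eq_zero (hd : 0 < d) (hd' : d < h.rows) (t : ℤ)
    (h0 : (t - r) % h.rows = 0 → σ ((t - r) / h.rows))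
    (h1 : (t - r) % h.rows = d → ¬ σ ((t - r) / h.rows)) :
    h.flow (h.switchFaces r d σ) true t = 0 := by
  rw [flow_switchFaces_true hd hd', indic_of_false (by tauto), indic_of_false (by tauto), add_zero]

/-- The values of a switching flow on an edge depend only on the row of the edge and, in the rows
from `r` to `r + d`, on `σ` at its column and at the preceding one. -/
theorem flow_switchFaces_congr {s : Bool} {t t' : ℤ} (hd : 0 < d) (hd' : d < h.rows)
    (hr : (t - r) % h.rows = (t' - r) % h.rows)
    (hσ : ((t - r) % h.rows < d ∨ s = true ∧ (t - r) % h.rows = d) →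
      (σ ((t - r) / h.rows) ↔ σ ((t' - r) / h.rows)) ∧
      (σ ((t - r) / h.rows - 1) ↔ σ ((t' - r) / h.rows - 1))) :
    h.flow (h.switchFaces r d σ) s t = h.flow (h.switchFaces r d σ) s t' := by
  cases s
  · rw [flow_switchFaces_false, flow_switchFaces_false, ← hr]
    congr 2 <;> refine propext (and_congr_right fun hlt => ?_)
    · exact (hσ (Or.inl hlt)).1
    · exact (hσ (Or.inl hlt)).2
  · rw [flow_switchFaces_true hd hd', flow_switchFaces_true hd hd', ← hr]
    congr 2 <;> refine propext (and_congr_right fun heq => ?_)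
    · exact not_congr (hσ (Or.inl (by omega))).1
    · exact (hσ (Or.inr ⟨rfl, heq⟩)).1

/-- A switching flow is closed if the rows from `r` to `r + d` have periods divisible by
`rows * E`, and `σ` has period `E` on the compressed columns. -/
theorem closed_flow_switchFaces {E : ℤ} (hd : 0 < d) (hd' : d < h.rows)
    (hE : ∀ t, (t - r) % h.rows ≤ d → h.rows * E ∣ h.per (t % h.rows))
    (hσ : ∀ u u' t t' : ℤ, h.lo - h.rows ≤ t → t < h.hi → h.lo - h.rows ≤ t' → t' < h.hi →
      (u = (t - r) / h.rows ∧ u' = (t' - r) / h.rows ∨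
        u = (t - r) / h.rows - 1 ∧ u' = (t' - r) / h.rows - 1) → E ∣ u' - u → (σ u ↔ σ u')) :
    h.Closed (h.flow (h.switchFaces r d σ)) := by
  have hk := rows_pos (h := h)
  rintro s t t' ⟨⟨h1, h2⟩, ⟨h3, h4⟩, hr, hper⟩
  have hstep := h.step_le s
  have hstep' := h.step_pos s
  have key : ∀ a, 0 ≤ a → a ≤ h.step s → ((t - a - r) % h.rows < d ∨
      s = true ∧ (t - a - r) % h.rows = d → (t - r) % h.rows ≤ d) →
      h.flow (h.switchFaces r d σ) s (t - a) = h.flow (h.switchFaces r d σ) s (t' - a) := by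
    intro a ha0 ha1 ha
    have hm : (t - a - r) % h.rows = (t' - a - r) % h.rows :=
      ((show t ≡ t' [ZMOD h.rows] from hr).sub_right a).sub_right r
    refine flow_switchFaces_congr hd hd' hm fun hc => ?_
    obtain ⟨z, hz⟩ := (hE t (ha hc)).trans hper
    have e : (t' - a - r) / h.rows = (t - a - r) / h.rows + E * z := by
      rw [show t' - a - r = t - a - r + h.rows * (E * z) by linarith,
        Int.add_mul_ediv_left _ _ hk.ne']
    constructor
    · exact hσ _ _ (t - a) (t' - a) (by omega) (by omega) (by omega) (by omega)
        (Or.inl ⟨rfl, rfl⟩) ⟨z, by rw [e]; ring⟩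
    · exact hσ _ _ (t - a) (t' - a) (by omega) (by omega) (by omega) (by omega)
        (Or.inr ⟨rfl, rfl⟩) ⟨z, by rw [e]; ring⟩
  refine ⟨?_, key _ hstep'.le le_rfl ?_⟩
  · have := key 0 le_rfl hstep'.le (by rw [sub_zero]; omega)
    simpa using this
  · cases s
    · simp only [step_false, Bool.false_eq_true, false_and, or_false]
      intro hlt
      have e : t - r = ((t - 1 - r) % h.rows + 1) + h.rows * ((t - 1 - r) / h.rows) := by
        have := Int.mul_ediv_add_emod (t - 1 - r) h.rows
        linarith
      have h0 := Int.emod_nonneg (t - 1 - r) hk.ne'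
      rw [e, Int.add_mul_emod_self_left, Int.emod_eq_of_lt (by omega) (by omega)]
      omega
    · simp only [step_true, true_and]
      rw [show t - h.rows - r = (t - r) - h.rows by ring, Int.sub_emod_right]
      omega

end Switch

/-! ### Sets of variables that leave room for a flow -/

/-- Some closed flow avoids the classes in `S`. -/
def Unblocked {h : Helix} (S : Finset h.Var) : Prop :=
  ∃ R : ℤ → ZMod 2, h.Closed (h.flow R) ∧ ∀ s t, ∀ z ∈ S, z ∈ h.cls s t → h.flow R s t = 0

variable {h : Helix}

theorem Unblocked.mono {S S' : Finset h.Var} (H : Unblocked S') (hS : S ⊆ S') : Unblocked S := by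
  obtain ⟨R, h1, h2⟩ := H
  exact ⟨R, h1, fun s t z hz => h2 s t z (hS hz)⟩

/-- A closed flow remains closed when it is truncated within the uncompressed zones at both ends. -/
theorem closed_truncFlow {R : ℤ → ZMod 2} (hR : h.Closed (h.flow R)) {y y' : ℤ}
    (hy : y + h.rows ≤ h.lo) (hy' : h.hi ≤ y') : h.Closed (h.truncFlow R y y') := by
  intro s t t' H
  have h1 := H.1
  have h2 := H.2.1
  have := h.step_le s
  have := h.step_pos s
  simp only [truncFlow]
  rw [if_pos (by omega), if_pos (by omega), if_pos (by omega), if_pos (by omega)]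
  exact hR s t t' H

/-- Within an uncompressed zone, every flow is closed. -/
theorem closed_truncFlow_of_zone {R : ℤ → ZMod 2} {y y' : ℤ}
    (hy : y' + h.rows ≤ h.lo ∨ h.hi ≤ y) : h.Closed (h.truncFlow R y y') := by
  intro s t t' H
  have h1 := H.1
  have h2 := H.2.1
  have := h.step_le s
  have := h.step_pos s
  simp only [truncFlow]
  rw [if_neg (by omega), if_neg (by omega), if_neg (by omega), if_neg (by omega)]
  simp

/-- If no step is in `S`, the flow along the whole helix avoids `S`. -/
theorem unblocked_of_no_step {S : Finset h.Var}
    (hS : ∀ z ∈ S, ∀ t, z ∉ h.cls false t) : Unblocked S := by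
  refine ⟨0, ?_, ?_⟩
  · intro s t t' _
    cases s <;> simp
  · intro s t z hz hzt
    cases s
    · exact (hS z hz t hzt).elim
    · simp

/-- The flow along a single row. -/
theorem flow_row_eq_zero {r : ℤ} {s : Bool} {t : ℤ} (hst : s = true → (t - r) % h.rows ≠ 0) :
    h.flow (h.switchFaces r 1 fun _ => False) s t = 0 := by
  have := h.two_le_rows
  cases s
  · exact flow_switchFaces_false_eq_zero t fun _ => Iff.rfl
  · exact flow_switchFaces_true_eq_zero one_pos (by omega) t (fun h0 => hst rfl h0) fun _ => id

theorem unblocked_of_row {S : Finset h.Var} (r : ℤ)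
    (hS : ∀ z ∈ S, ∀ t, z ∈ h.cls true t → (t - r) % h.rows ≠ 0) : Unblocked S := by
  have := h.two_le_rows
  refine ⟨h.switchFaces r 1 fun _ => False, ?_, ?_⟩
  · intro s t t' H
    have hm : (t - r) % h.rows = (t' - r) % h.rows :=
      (show t ≡ t' [ZMOD h.rows] from H.2.2.1).sub_right r
    refine ⟨flow_switchFaces_congr one_pos (by omega) hm fun _ => ⟨Iff.rfl, Iff.rfl⟩,
      flow_switchFaces_congr one_pos (by omega) ?_ fun _ => ⟨Iff.rfl, Iff.rfl⟩⟩
    exact ((show t ≡ t' [ZMOD h.rows] from H.2.2.1).sub_right _).sub_right r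
  · intro s t z hz hzt
    refine flow_row_eq_zero ?_
    rintro rfl
    exact hS z hz t hzt

end Helix

/-! ### Congruences between the jumps of a blocked set -/

/-- The conditions on the shape of a helix under which the depth bound holds. There are `M * H`
columns, and the first and the last `2 * M` of them are not compressed. The period of every row is a
multiple of `rows * M`; moreover, the factor `q j` divides the periods of `c + 1` cyclically
consecutive rows, beginning with the row `j`, and these factors are pairwise coprime. -/
structure Helix.Condensed (h : Helix) (M H c : ℤ) (q : ℤ → ℤ) : Prop where
  len_eq : (h.len : ℤ) = h.rows * (M * H)
  lo_eq : (h.lo : ℤ) = h.rows * (2 * M)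
  hi_eq : (h.hi : ℤ) = h.rows * (M * (H - 2))
  dvd_per : ∀ i, h.rows * M ∣ h.per i
  mul_dvd_per : ∀ i j : ℤ, 0 ≤ j → j < h.rows → (i - j) % h.rows ≤ c →
    h.rows * (M * q j) ∣ h.per (i % h.rows)
  isCoprime : ∀ i j : ℤ, 0 ≤ i → i < h.rows → 0 ≤ j → j < h.rows → i ≠ j → IsCoprime (q i) (q j)
  four_rows_lt : 4 * h.rows < M
  four_le : 4 ≤ H
  c_nonneg : 0 ≤ c
  c_lt : c < h.rows

namespace Helix

variable {h : Helix}

/-- The boundaries of the blocks of `M` columns that begin with the columns `≡ g` modulo `M` keep a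
distance from the classes in `S`. -/
def IsGap (M : ℤ) (S : Finset h.Var) (g : ℤ) : Prop :=
  ∀ z ∈ S, ∀ s t, z ∈ h.cls s t → ¬ M ∣ t / h.rows - g ∧ ¬ M ∣ t / h.rows - g - 1

/-- `z` is the only class of jumps in row `r` that belongs to `S`. -/
def IsSole (S : Finset h.Var) (r : ℤ) (z : h.Var) : Prop :=
  z ∈ S ∧ ∀ z' ∈ S, ∀ t, z' ∈ h.cls true t → t % h.rows = r → z' = z

/-- The index of the block of `M` columns that contains the vertex `t`. -/
def block (h : Helix) (M g t : ℤ) : ℤ := (t / h.rows - g) / M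

theorem sub_ediv_rows {r : ℤ} (h0 : 0 ≤ r) (h1 : r < h.rows) (t : ℤ) :
    (t - r) / h.rows = t / h.rows ∧ r ≤ t % h.rows ∨
      (t - r) / h.rows = t / h.rows - 1 ∧ t % h.rows < r := by
  have hk := rows_pos (h := h)
  have e := Int.mul_ediv_add_emod t h.rows
  have hlt := Int.emod_lt_of_pos t hk
  have hge := Int.emod_nonneg t hk.ne'
  by_cases hr : r ≤ t % h.rows
  · left
    refine ⟨?_, hr⟩
    rw [show t - r = (t % h.rows - r) + h.rows * (t / h.rows) by linarith,
      Int.add_mul_ediv_left _ _ hk.ne', Int.ediv_eq_zero_of_lt (by omega) (by omega)]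
    ring
  · right
    refine ⟨?_, by omega⟩
    rw [show t - r = (t % h.rows - r + h.rows) + h.rows * (t / h.rows - 1) by linarith,
      Int.add_mul_ediv_left _ _ hk.ne', Int.ediv_eq_zero_of_lt (by omega) (by omega)]
    ring

theorem emod_rows_of_sub {r r' t : ℤ} (h0 : 0 ≤ r') (h1 : r' < h.rows)
    (ht : (t - r) % h.rows = (r' - r) % h.rows) : t % h.rows = r' := by
  have : t - r + r ≡ r' - r + r [ZMOD h.rows] := Int.ModEq.add_right r ht
  rw [sub_add_cancel, sub_add_cancel] at this
  rw [this.eq, Int.emod_eq_of_lt h0 h1]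

theorem block_of_dvd {M t t' Q g : ℤ} (hM : 0 < M) (hd : h.rows * (M * Q) ∣ t' - t) :
    Q ∣ h.block M g t' - h.block M g t := by
  have hk := rows_pos (h := h)
  obtain ⟨a, ha⟩ := hd
  refine ⟨a, ?_⟩
  rw [block, block, show t' = t + h.rows * (M * (Q * a)) by linarith,
    Int.add_mul_ediv_left _ _ hk.ne',
    show t / h.rows + M * (Q * a) - g = (t / h.rows - g) + M * (Q * a) by ring,
    Int.add_mul_ediv_left _ _ hM.ne']
  ring

variable {M H c : ℤ} {q : ℤ → ℤ}

theorem Condensed.M_pos (hC : h.Condensed M H c q) : 0 < M := by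
  have := hC.four_rows_lt
  omega

/-- The flow that runs along the row `r'` in the columns where `σ` holds and along `r` in the others
avoids `S` if it changes rows only at gaps and `S` has no jumps in its way. It respects the
identifications if `σ` has the period `E`, which divides the periods of the rows that it crosses. -/
theorem Condensed.unblocked_of_switch (hC : h.Condensed M H c q)
    {S : Finset h.Var} {r r' E : ℤ} {σ : ℤ → Prop}
    (h0 : 0 ≤ r) (h1 : r < h.rows) (h0' : 0 ≤ r') (h1' : r' < h.rows) (hne : r ≠ r')
    (hE : ∀ t, (t - r) % h.rows ≤ (r' - r) % h.rows → h.rows * E ∣ h.per (t % h.rows))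
    (hσ : ∀ u u', 2 * M - 3 ≤ u → u < M * (H - 2) → 2 * M - 3 ≤ u' → u' < M * (H - 2) →
      E ∣ u' - u → (σ u ↔ σ u'))
    (hgap : ∀ u, ¬ (σ u ↔ σ (u - 1)) → ∃ g, IsGap M S g ∧ M ∣ u - g)
    (hr : ∀ z ∈ S, ∀ t, z ∈ h.cls true t → t % h.rows = r → σ (t / h.rows))
    (hr' : ∀ z ∈ S, ∀ t, z ∈ h.cls true t → t % h.rows = r' → ¬ σ (t / h.rows)) :
    Unblocked S := by
  have hk := rows_pos (h := h)
  have hd : 0 < (r' - r) % h.rows := by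
    refine lt_of_le_of_ne (Int.emod_nonneg _ hk.ne') fun e => hne ?_
    have := emod_rows_of_sub (t := r) h0' h1' (by rw [sub_self, Int.zero_emod, e])
    rw [← this, Int.emod_eq_of_lt h0 h1]
  have hd' := Int.emod_lt_of_pos (r' - r) hk
  -- at the vertices of jumps in `S`, the shift between the two countings of columns is harmless
  have hshift : ∀ z ∈ S, ∀ s t, z ∈ h.cls s t → (σ ((t - r) / h.rows) ↔ σ (t / h.rows)) := by
    intro z hz s t hzt
    rcases sub_ediv_rows (h := h) h0 h1 t with ⟨e, -⟩ | ⟨e, -⟩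
    · rw [e]
    · rw [e]
      by_contra hc
      obtain ⟨g, hg, hdvd⟩ := hgap (t / h.rows) fun hc' => hc hc'.symm
      exact (hg z hz s t hzt).1 hdvd
  refine ⟨h.switchFaces r ((r' - r) % h.rows) σ, closed_flow_switchFaces hd hd' hE ?_, ?_⟩
  · intro u u' t t' ht1 ht2 ht1' ht2' hu hdvd
    have bound : ∀ t : ℤ, h.lo - h.rows ≤ t → t < h.hi →
        2 * M - 2 ≤ (t - r) / h.rows ∧ (t - r) / h.rows < M * (H - 2) := by
      intro t ht1 ht2
      rw [hC.lo_eq] at ht1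
      rw [hC.hi_eq] at ht2
      constructor
      · rw [Int.le_ediv_iff_mul_le hk]
        linarith
      · rw [Int.ediv_lt_iff_lt_mul hk]
        linarith
    have b := bound t ht1 ht2
    have b' := bound t' ht1' ht2'
    exact hσ u u' (by omega) (by omega) (by omega) (by omega) hdvd
  · intro s t z hz hzt
    cases s
    · refine flow_switchFaces_false_eq_zero t fun _ => ?_
      by_contra hc
      obtain ⟨g, hg, hdvd⟩ := hgap _ hc
      have := hg z hz _ t hzt
      rcases sub_ediv_rows (h := h) h0 h1 t with ⟨e, -⟩ | ⟨e, -⟩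
      · rw [e] at hdvd
        exact this.1 hdvd
      · rw [e] at hdvd
        exact this.2 (by rwa [show t / h.rows - g - 1 = t / h.rows - 1 - g by ring])
    · refine flow_switchFaces_true_eq_zero hd hd' t (fun ht => ?_) fun ht => ?_
      · rw [hshift z hz _ t hzt]
        refine hr z hz t hzt (emod_rows_of_sub (r := r) h0 h1 ?_)
        rw [ht, sub_self, Int.zero_emod]
      · rw [hshift z hz _ t hzt]
        exact hr' z hz t hzt (emod_rows_of_sub h0' h1' ht)

theorem Condensed.dvd_sub_of_mem (hC : h.Condensed M H c q)
    {s s' : Bool} {t t' : ℤ} {z : h.Var} (hz : z ∈ h.cls s t)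
    (hz' : z ∈ h.cls s' t') : M ∣ t' / h.rows - t / h.rows := by
  have hk := rows_pos (h := h)
  obtain ⟨a, ha⟩ := dvd_sub_of_mem_cls hC.dvd_per hz hz'
  refine ⟨a, ?_⟩
  rw [show t' = t + h.rows * (M * a) by linarith, Int.add_mul_ediv_left _ _ hk.ne']
  ring

/-- The jumps by which a blocked set meets two rows whose periods share the factor `q j` lie in
blocks that are congruent modulo `q j`. Otherwise the flow along one of the rows could dodge by
switching to the other one in the blocks congruent to the first jump. -/
theorem Condensed.block_congr (hC : h.Condensed M H c q)
    {S : Finset h.Var} (hS : ¬ Unblocked S) {g : ℤ} (hg : IsGap M S g)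
    {j r r' t t' : ℤ} {z z' : h.Var} (hj0 : 0 ≤ j) (hj1 : j < h.rows)
    (hr : (r - j) % h.rows ≤ c) (hr' : (r' - j) % h.rows ≤ c)
    (hz : IsSole S r z) (hz' : IsSole S r' z') (hzt : z ∈ h.cls true t) (ht : t % h.rows = r)
    (hzt' : z' ∈ h.cls true t') (ht' : t' % h.rows = r') :
    q j ∣ h.block M g t' - h.block M g t := by
  have hk := rows_pos (h := h)
  have hM := hC.M_pos
  have hper : ∀ {t t' : ℤ} {z : h.Var}, z ∈ h.cls true t → z ∈ h.cls true t' →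
      (t % h.rows - j) % h.rows ≤ c → q j ∣ h.block M g t' - h.block M g t := by
    intro t t' z hzt hzt' hr
    refine block_of_dvd hM ((hC.mul_dvd_per t j hj0 hj1 ?_).trans (per_dvd_of_mem_cls hzt hzt'))
    rwa [Int.emod_sub_emod] at hr
  have key : ∀ {r r' t t' : ℤ} {z z' : h.Var}, (r' - j) % h.rows ≤ c →
      (r - j) % h.rows < (r' - j) % h.rows → IsSole S r z → IsSole S r' z' →
      z ∈ h.cls true t → t % h.rows = r → z' ∈ h.cls true t' → t' % h.rows = r' →
      q j ∣ h.block M g t' - h.block M g t := by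
    intro r r' t t' z z' hr' hlt hz hz' hzt ht hzt' ht'
    by_contra hcon
    have b0 : 0 ≤ r := ht ▸ Int.emod_nonneg _ hk.ne'
    have b1 : r < h.rows := ht ▸ Int.emod_lt_of_pos _ hk
    have b0' : 0 ≤ r' := ht' ▸ Int.emod_nonneg _ hk.ne'
    have b1' : r' < h.rows := ht' ▸ Int.emod_lt_of_pos _ hk
    have n0 := Int.emod_nonneg (r - j) hk.ne'
    have n1 := Int.emod_lt_of_pos (r' - j) hk
    have hdiff : (r' - r) % h.rows = (r' - j) % h.rows - (r - j) % h.rows := by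
      rw [show r' - r = (r' - j) - (r - j) by ring, Int.sub_emod,
        Int.emod_eq_of_lt (by omega) (by omega)]
    refine hS (hC.unblocked_of_switch (r := r) (r' := r') (E := M * q j)
      (σ := fun u => q j ∣ (u - g) / M - h.block M g t) b0 b1 b0' b1' ?_ ?_ ?_ ?_ ?_ ?_)
    · rintro rfl
      omega
    · intro x hx
      refine hC.mul_dvd_per x j hj0 hj1 ?_
      have x0 := Int.emod_nonneg (x - r) hk.ne'
      rw [show x - j = (x - r) + (r - j) by ring, Int.add_emod,
        Int.emod_eq_of_lt (by omega) (by omega)]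
      omega
    · rintro u u' - - - - ⟨a, ha⟩
      rw [show u' - g = (u - g) + M * (q j * a) by linarith, Int.add_mul_ediv_left _ _ hM.ne',
        show (u - g) / M + q j * a - h.block M g t = (u - g) / M - h.block M g t + q j * a by ring]
      exact (dvd_add_left ⟨a, rfl⟩).symm
    · intro u hu
      refine ⟨g, hg, ?_⟩
      by_contra hdvd
      apply hu
      have hpos : 0 < (u - g) % M :=
        lt_of_le_of_ne (Int.emod_nonneg _ hM.ne') fun e => hdvd (Int.dvd_of_emod_eq_zero e.symm)
      have hlt := Int.emod_lt_of_pos (u - g) hM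
      have e : (u - 1 - g) / M = (u - g) / M := by
        rw [show u - 1 - g = ((u - g) % M - 1) + M * ((u - g) / M) by
          have := Int.mul_ediv_add_emod (u - g) M
          linarith, Int.add_mul_ediv_left _ _ hM.ne', Int.ediv_eq_zero_of_lt (by omega) (by omega)]
        ring
      simp only [e]
    · intro x hx y hy hyr
      obtain rfl := hz.2 x hx y hy hyr
      refine hper hzt hy ?_
      rw [ht]
      omega
    · intro x hx y hy hyr hdvd
      obtain rfl := hz'.2 x hx y hy hyr
      refine hcon ?_
      have h1 := hper hy hzt' (by rw [hyr]; exact hr')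
      have h2 : q j ∣ h.block M g y - h.block M g t := hdvd
      have h3 := dvd_add h1 h2
      rwa [sub_add_sub_cancel] at h3
  rcases lt_trichotomy ((r - j) % h.rows) ((r' - j) % h.rows) with hlt | heq | hgt
  · exact key hr' hlt hz hz' hzt ht hzt' ht'
  · have : r' = r := by
      have e1 : t' ≡ t [ZMOD h.rows] := by
        have : r' - j + j ≡ r - j + j [ZMOD h.rows] := Int.ModEq.add_right j heq.symm
        rw [sub_add_cancel, sub_add_cancel, ← ht, ← ht'] at this
        exact ((Int.mod_modEq _ _).symm.trans this).trans (Int.mod_modEq _ _)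
      rw [← ht, ← ht', e1.eq]
    subst this
    obtain rfl := hz'.2 z hz.1 t hzt ht
    exact hper hzt hzt' (by rwa [ht])
  · have := key hr hgt hz' hz hzt' ht' hzt ht
    rwa [← dvd_neg, neg_sub] at this

/-- The jumps by which a blocked set meets two rows lie on the same side of two gaps. -/
theorem Condensed.arc_congr (hC : h.Condensed M H c q)
    {S : Finset h.Var} (hS : ¬ Unblocked S) {g g' : ℤ} (hg : IsGap M S g)
    (hg' : IsGap M S g') (hg0 : 0 ≤ g') (hgM : g < M) {r r' t t' : ℤ} {z z' : h.Var}
    (hz : IsSole S r z) (hz' : IsSole S r' z') (hzt : z ∈ h.cls true t) (ht : t % h.rows = r)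
    (hzt' : z' ∈ h.cls true t') (ht' : t' % h.rows = r') :
    (g' ≤ t / h.rows % M ∧ t / h.rows % M < g) ↔ (g' ≤ t' / h.rows % M ∧ t' / h.rows % M < g) := by
  have hk := rows_pos (h := h)
  have hM := hC.M_pos
  have hcol : ∀ {t t' : ℤ} {z : h.Var}, z ∈ h.cls true t → z ∈ h.cls true t' →
      t / h.rows % M = t' / h.rows % M := fun hzt hzt' =>
    (Int.modEq_iff_dvd.2 (hC.dvd_sub_of_mem hzt hzt')).eq
  have key : ∀ {r r' t t' : ℤ} {z z' : h.Var}, IsSole S r z → IsSole S r' z' →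
      z ∈ h.cls true t → t % h.rows = r → z' ∈ h.cls true t' → t' % h.rows = r' →
      (g' ≤ t / h.rows % M ∧ t / h.rows % M < g) →
      (g' ≤ t' / h.rows % M ∧ t' / h.rows % M < g) := by
    intro r r' t t' z z' hz hz' hzt ht hzt' ht' hin
    by_contra hcon
    by_cases hne : r = r'
    · subst hne
      obtain rfl := hz'.2 z hz.1 t hzt ht
      rw [hcol hzt hzt'] at hin
      exact hcon hin
    refine hS (hC.unblocked_of_switch (r := r) (r' := r') (E := M)
      (σ := fun u => g' ≤ u % M ∧ u % M < g) (ht ▸ Int.emod_nonneg _ hk.ne')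
      (ht ▸ Int.emod_lt_of_pos _ hk) (ht' ▸ Int.emod_nonneg _ hk.ne')
      (ht' ▸ Int.emod_lt_of_pos _ hk) hne ?_ ?_ ?_ ?_ ?_)
    · exact fun x _ => hC.dvd_per _
    · intro u u' _ _ _ _ hd
      rw [(Int.modEq_iff_dvd.2 hd).eq]
    · intro u hu
      have h0 := Int.emod_nonneg u hM.ne'
      have h1 := Int.emod_lt_of_pos u hM
      have hcase : u % M = g ∨ u % M = g' := by
        by_contra hc
        apply hu
        have e : (u - 1) % M = if u % M = 0 then M - 1 else u % M - 1 := by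
          have e1 := Int.mul_ediv_add_emod u M
          split_ifs with h00
          · rw [show u - 1 = (M - 1) + M * (u / M - 1) by linarith, Int.add_mul_emod_self_left,
              Int.emod_eq_of_lt (by omega) (by omega)]
          · rw [show u - 1 = (u % M - 1) + M * (u / M) by linarith, Int.add_mul_emod_self_left,
              Int.emod_eq_of_lt (by omega) (by omega)]
        rw [e]
        split_ifs <;> omega
      rcases hcase with hc | hc
      · exact ⟨g, hg, by rw [← hc]; exact Int.dvd_self_sub_emod⟩
      · exact ⟨g', hg', by rw [← hc]; exact Int.dvd_self_sub_emod⟩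
    · intro x hx y hy hyr
      obtain rfl := hz.2 x hx y hy hyr
      rwa [hcol hy hzt]
    · intro x hx y hy hyr
      obtain rfl := hz'.2 x hx y hy hyr
      rwa [hcol hy hzt']
  exact ⟨key hz hz' hzt ht hzt' ht', key hz' hz hzt' ht' hzt ht⟩

/-- The uncompressed edges are alone in their classes. -/
theorem eq_of_mem_cls_of_outside {s s' : Bool} {t t' : ℤ} {z : h.Var} (hz : z ∈ h.cls s t)
    (hz' : z ∈ h.cls s' t') (ht : t + h.rows < h.lo ∨ h.hi ≤ t) : t' = t := by
  classical
  have hf : h.Closed fun _ t => if h.lo - h.rows ≤ t ∧ t < h.hi then none else some t := by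
    intro s t t' H
    have h1 := H.1
    have h2 := H.2.1
    have := h.step_le s
    have := h.step_pos s
    simp only
    rw [if_pos (by omega), if_pos (by omega), if_pos (by omega), if_pos (by omega)]
    simp
  obtain ⟨α, hα⟩ := exists_lift hf
  have e := (hα _ _ _ hz).symm.trans (hα _ _ _ hz')
  rw [if_neg (by omega)] at e
  split_ifs at e
  simpa using e.symm

/-- The jumps by which a blocked set meets two rows in an uncompressed part lie on the same side of
a gap in that part. -/
theorem Condensed.le_congr (hC : h.Condensed M H c q)
    {S : Finset h.Var} (hS : ¬ Unblocked S) {g : ℤ} (hg : IsGap M S g)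
    {u₀ : ℤ} (hu : M ∣ u₀ - g) (hu₀ : u₀ ≤ 2 * M - 3 ∨ M * (H - 2) ≤ u₀) {r r' t t' : ℤ}
    {z z' : h.Var} (hz : IsSole S r z) (hz' : IsSole S r' z') (hzt : z ∈ h.cls true t)
    (ht : t % h.rows = r) (hzt' : z' ∈ h.cls true t') (ht' : t' % h.rows = r')
    (hout : t + h.rows < h.lo ∨ h.hi ≤ t) (hout' : t' + h.rows < h.lo ∨ h.hi ≤ t') :
    u₀ ≤ t / h.rows → u₀ ≤ t' / h.rows := by
  have hk := rows_pos (h := h)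
  intro hin
  by_contra hcon
  by_cases hne : r = r'
  · subst hne
    obtain rfl := hz'.2 z hz.1 t hzt ht
    rw [eq_of_mem_cls_of_outside hzt hzt' hout] at hcon
    exact hcon hin
  refine hS (hC.unblocked_of_switch (r := r) (r' := r') (E := M)
    (σ := fun u => u₀ ≤ u) (ht ▸ Int.emod_nonneg _ hk.ne')
    (ht ▸ Int.emod_lt_of_pos _ hk) (ht' ▸ Int.emod_nonneg _ hk.ne')
    (ht' ▸ Int.emod_lt_of_pos _ hk) hne ?_ ?_ ?_ ?_ ?_)
  · exact fun x _ => hC.dvd_per _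
  · intro u u' _ _ _ _ _
    omega
  · intro u hu'
    rw [show u = u₀ by omega]
    exact ⟨g, hg, hu⟩
  · intro x hx y hy hyr
    obtain rfl := hz.2 x hx y hy hyr
    rwa [eq_of_mem_cls_of_outside hzt hy hout]
  · intro x hx y hy hyr
    obtain rfl := hz'.2 x hx y hy hyr
    rwa [eq_of_mem_cls_of_outside hzt' hy hout']

end Helix

/-! ### Blocked sets have a location -/

namespace Helix

variable {h : Helix} {M H c : ℤ} {q : ℤ → ℤ}

/-- Relative to the blocks given by `g`, the jumps in `S` point to the location `b`: the factor
`q j` divides the difference between `b` and the block of the only jump of `S` in some row whose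
period contains this factor. -/
structure IsLocated (M c : ℤ) (q : ℤ → ℤ) (S : Finset h.Var) (g b : ℤ) : Prop where
  nonneg : 0 ≤ g
  lt : g < M
  isGap : IsGap M S g
  exists_isSole : ∀ j : ℤ, 0 ≤ j → j < h.rows → ∃ z t, (t % h.rows - j) % h.rows ≤ c ∧
    IsSole S (t % h.rows) z ∧ z ∈ h.cls true t ∧ q j ∣ b - h.block M g t

theorem exists_jump_of_not_unblocked {S : Finset h.Var} (hS : ¬ Unblocked S) {r : ℤ} (h0 : 0 ≤ r)
    (h1 : r < h.rows) : ∃ z ∈ S, ∃ t, z ∈ h.cls true t ∧ t % h.rows = r := by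
  by_contra! hc
  refine hS (unblocked_of_row r fun z hz t hzt ht => hc z hz t hzt ?_)
  exact emod_rows_of_sub h0 h1 (by rw [ht, sub_self, Int.zero_emod])

theorem IsLocated.mono {S S' : Finset h.Var} {g b : ℤ} (hL : IsLocated M c q S' g b) (hSS : S ⊆ S')
    (hS : ¬ Unblocked S) : IsLocated M c q S g b := by
  refine ⟨hL.nonneg, hL.lt, fun z hz => hL.isGap z (hSS hz), fun j h0 h1 => ?_⟩
  obtain ⟨z, t, hj, hz, hzt, hd⟩ := hL.exists_isSole j h0 h1
  obtain ⟨z', hz', t', hzt', ht'⟩ := exists_jump_of_not_unblocked hS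
    (Int.emod_nonneg t rows_pos.ne') (Int.emod_lt_of_pos t rows_pos)
  obtain rfl := hz.2 z' (hSS hz') t' hzt' ht'
  exact ⟨z', t, hj, ⟨hz', fun y hy => hz.2 y (hSS hy)⟩, hzt, hd⟩

/-- A class meets only columns that are congruent modulo `M`. -/
theorem Condensed.exists_col (hC : h.Condensed M H c q) :
    ∃ ρ : h.Var → ℤ, ∀ z s t, z ∈ h.cls s t → (t / h.rows) % M = ρ z := by
  choose s t hst using fun z : h.Var => exists_mem_cls z
  refine ⟨fun z => (t z / h.rows) % M, fun z s' t' hz => ?_⟩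
  exact (Int.modEq_iff_dvd.2 (hC.dvd_sub_of_mem hz (hst z))).eq

theorem exists_notMem_of_card_lt {K : Finset ℤ} {m : ℤ} (hK : K.card < m) :
    ∃ i, 0 ≤ i ∧ i < m ∧ i ∉ K := by
  by_contra! hc
  have : (Finset.Ico 0 m).card ≤ K.card :=
    Finset.card_le_card fun i hi => hc i (Finset.mem_Ico.1 hi).1 (Finset.mem_Ico.1 hi).2
  rw [Int.card_Ico] at this
  omega

theorem Condensed.exists_isGap (hC : h.Condensed M H c q) {S : Finset h.Var}
    (hS : (S.card : ℤ) ≤ 2 * h.rows) : ∃ g, 0 ≤ g ∧ g < M ∧ IsGap M S g := by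
  classical
  obtain ⟨ρ, hρ⟩ := hC.exists_col
  have hM := hC.M_pos
  have h4 := hC.four_rows_lt
  obtain ⟨g, g0, g1, hg⟩ := exists_notMem_of_card_lt
    (K := S.image ρ ∪ S.image fun z => (ρ z - 1) % M) (m := M) (by
      have h1 := Finset.card_union_le (S.image ρ) (S.image fun z => (ρ z - 1) % M)
      have h2 : (S.image ρ).card ≤ S.card := Finset.card_image_le
      have h3 : (S.image fun z => (ρ z - 1) % M).card ≤ S.card := Finset.card_image_le
      omega)
  rw [Finset.mem_union, not_or] at hg
  refine ⟨g, g0, g1, fun z hz s t hzt => ⟨fun hd => hg.1 ?_, fun hd => hg.2 ?_⟩⟩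
  · refine Finset.mem_image.2 ⟨z, hz, ?_⟩
    rw [← hρ z s t hzt, ← (Int.modEq_iff_dvd.2 hd).eq, Int.emod_eq_of_lt g0 g1]
  · refine Finset.mem_image.2 ⟨z, hz, ?_⟩
    rw [← hρ z s t hzt, Int.emod_sub_emod,
      ← (Int.modEq_iff_dvd.2 (show M ∣ t / h.rows - 1 - g by rwa [sub_right_comm])).eq,
      Int.emod_eq_of_lt g0 g1]

/-- Among the zone of `M` columns beginning with the column `u` there is one without steps in
`S`. -/
theorem Condensed.exists_isFree (hC : h.Condensed M H c q) {S : Finset h.Var}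
    (hS : (S.card : ℤ) ≤ 2 * h.rows) (u : ℤ) :
    ∃ i, 0 ≤ i ∧ i < M ∧ IsFree S (h.rows * (u + i)) := by
  classical
  obtain ⟨ρ, hρ⟩ := hC.exists_col
  have hM := hC.M_pos
  have hk := rows_pos (h := h)
  have h4 := hC.four_rows_lt
  obtain ⟨i, i0, i1, hi⟩ := exists_notMem_of_card_lt
    (K := S.image fun z => (ρ z - u) % M) (m := M) (by
      have h3 : (S.image fun z => (ρ z - u) % M).card ≤ S.card := Finset.card_image_le
      omega)
  refine ⟨i, i0, i1, fun t ht0 ht1 z hz hzt => hi (Finset.mem_image.2 ⟨z, hz, ?_⟩)⟩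
  have e : t / h.rows = u + i := by
    refine le_antisymm (Int.lt_add_one_iff.1 ?_) ?_
    · rw [Int.ediv_lt_iff_lt_mul hk]
      linarith
    · rw [Int.le_ediv_iff_mul_le hk]
      linarith
  rw [← hρ z _ t hzt, e, Int.emod_sub_emod, add_sub_cancel_left, Int.emod_eq_of_lt i0 i1]

/-- A set of few classes that meets all rows meets one of `c + 1` consecutive rows only once. -/
theorem Condensed.exists_isSole (hC : h.Condensed M H c q) {S : Finset h.Var}
    (hcard : (S.card : ℤ) ≤ h.rows + c + 1) (hS : ¬ Unblocked S) (j : ℤ) :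
    ∃ z t, (t % h.rows - j) % h.rows ≤ c ∧ IsSole S (t % h.rows) z ∧ z ∈ h.cls true t := by
  classical
  by_contra! hcon
  have hk := rows_pos (h := h)
  have hc0 := hC.c_nonneg
  have hc1 := hC.c_lt
  choose s t hst using fun z : h.Var => exists_mem_cls z
  -- the row of a class, as seen from the row `j`
  set ρ : h.Var → ℤ := fun z => (t z - j) % h.rows with hρ
  set J := S.filter fun z => s z = true with hJ
  have hmem : ∀ z ∈ S, ∀ t', z ∈ h.cls true t' → z ∈ J ∧ ρ z = (t' - j) % h.rows := by
    intro z hz t' hzt'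
    obtain ⟨e1, e2⟩ := cls_invariant (hst z) hzt'
    exact ⟨Finset.mem_filter.2 ⟨hz, e1⟩, (show t z ≡ t' [ZMOD h.rows] from e2).sub_right j⟩
  have hlt : J.card < S.card := by
    refine Finset.card_lt_card (Finset.ssubset_iff_subset_ne.2 ⟨Finset.filter_subset _ _, ?_⟩)
    intro e
    refine hS (unblocked_of_no_step fun z hz t' hzt' => ?_)
    rw [← e] at hz
    have := (cls_invariant (hst z) hzt').1
    rw [(Finset.mem_filter.1 hz).2] at this
    exact absurd this (by decide)
  have hsum : J.card = ∑ r ∈ Finset.Ico (0 : ℤ) h.rows, {z ∈ J | ρ z = r}.card :=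
    Finset.card_eq_sum_card_fiberwise fun z _ => by
      simp only [Finset.coe_Ico, Set.mem_Ico]
      exact ⟨Int.emod_nonneg _ hk.ne', Int.emod_lt_of_pos _ hk⟩
  have hfib : ∀ r ∈ Finset.Ico (0 : ℤ) h.rows,
      1 + (if r ∈ Finset.Ico (0 : ℤ) (c + 1) then 1 else 0) ≤ {z ∈ J | ρ z = r}.card := by
    intro r hr
    rw [Finset.mem_Ico] at hr
    obtain ⟨z, hz, t', hzt', ht'⟩ := exists_jump_of_not_unblocked hS (r := (r + j) % h.rows)
      (Int.emod_nonneg _ hk.ne') (Int.emod_lt_of_pos _ hk)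
    have er : (t' - j) % h.rows = r := by
      have : t' ≡ r + j [ZMOD h.rows] := ht'
      have := (this.sub_right j).eq
      rw [add_sub_cancel_right, Int.emod_eq_of_lt hr.1 hr.2] at this
      exact this
    have hzJ := hmem z hz t' hzt'
    have hz1 : z ∈ {z ∈ J | ρ z = r} := Finset.mem_filter.2 ⟨hzJ.1, hzJ.2.trans er⟩
    split_ifs with hrc
    · rw [Finset.mem_Ico] at hrc
      have hns : ¬ IsSole S (t' % h.rows) z := fun hs =>
        hcon z t' (by rw [Int.emod_sub_emod, er]; omega) hs hzt'
      simp only [IsSole, not_and, not_forall] at hns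
      obtain ⟨z', hz', t'', hzt'', ht'', hne⟩ := hns hz
      have hzJ' := hmem z' hz' t'' hzt''
      have hz2 : z' ∈ {z ∈ J | ρ z = r} := Finset.mem_filter.2 ⟨hzJ'.1, by
        rw [hzJ'.2, ← er]
        exact (show t'' ≡ t' [ZMOD h.rows] from ht'').sub_right j⟩
      exact Finset.one_lt_card.2 ⟨z', hz2, z, hz1, hne⟩
    · exact Finset.card_pos.2 ⟨z, hz1⟩
  have hle := Finset.sum_le_sum hfib
  rw [← hsum, Finset.sum_add_distrib, ← Finset.sum_filter, Finset.sum_const, Finset.sum_const,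
    Finset.filter_mem_eq_inter, Finset.inter_eq_right.2
    (Finset.Ico_subset_Ico_right (by omega)), Int.card_Ico, Int.card_Ico] at hle
  simp only [smul_eq_mul, mul_one] at hle
  omega

theorem exists_forall_dvd_sub {ι : Type*} (s : Finset ι) {Q : ι → ℤ} (β : ι → ℤ)
    (hQ : (s : Set ι).Pairwise fun i j => IsCoprime (Q i) (Q j)) : ∃ b, ∀ i ∈ s, Q i ∣ b - β i := by
  classical
  induction s using Finset.induction_on with
  | empty => exact ⟨0, by simp⟩
  | insert a s ha ih =>
    obtain ⟨b, hb⟩ := ih (hQ.mono (by simp))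
    obtain ⟨x, y, hxy⟩ : IsCoprime (Q a) (∏ i ∈ s, Q i) := IsCoprime.prod_right fun i hi =>
      hQ (by simp) (by simp [hi]) (by rintro rfl; exact ha hi)
    refine ⟨b + (β a - b) * (y * ∏ i ∈ s, Q i), fun i hi => ?_⟩
    rcases Finset.mem_insert.1 hi with rfl | hi
    · exact ⟨(b - β i) * x, by linear_combination (β i - b) * hxy⟩
    · rw [add_sub_right_comm]
      exact dvd_add (hb i hi) ((Finset.dvd_prod_of_mem Q hi).mul_left _ |>.mul_left _)

theorem Condensed.pairwise_isCoprime (hC : h.Condensed M H c q) :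
    (Finset.range h.rows : Set ℕ).Pairwise fun i j => IsCoprime (q i) (q j) := by
  intro i hi j hj hij
  simp only [Finset.coe_range, Set.mem_Iio] at hi hj
  exact hC.isCoprime i j (by omega) (by omega) (by omega) (by omega) (by omega)

theorem Condensed.prod_dvd (hC : h.Condensed M H c q) {x : ℤ}
    (hx : ∀ j : ℤ, 0 ≤ j → j < h.rows → q j ∣ x) : ∏ j ∈ Finset.range h.rows, q j ∣ x :=
  Finset.prod_dvd_of_coprime hC.pairwise_isCoprime fun j hj =>
    hx j (by omega) (by rw [Finset.mem_range] at hj; omega)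

/-- Small blocked sets have a location. -/
theorem Condensed.exists_isLocated (hC : h.Condensed M H c q) {S : Finset h.Var}
    (hcard : (S.card : ℤ) ≤ h.rows + c + 1) (hS : ¬ Unblocked S) :
    ∃ g b, IsLocated M c q S g b := by
  have hc1 := hC.c_lt
  obtain ⟨g, g0, g1, hg⟩ := hC.exists_isGap (S := S) (by omega)
  choose z t h1 h2 h3 using hC.exists_isSole hcard hS
  obtain ⟨b, hb⟩ := exists_forall_dvd_sub (Finset.range h.rows) (fun j : ℕ => h.block M g (t j))
    hC.pairwise_isCoprime
  refine ⟨g, b, g0, g1, hg, fun j j0 j1 => ?_⟩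
  lift j to ℕ using j0
  exact ⟨z j, t j, h1 j, h2 j, h3 j, hb j (Finset.mem_range.2 (by omega))⟩

theorem ediv_sub_of_lt {u g : ℤ} (hM : 0 < M) (g0 : 0 ≤ g) (g1 : g < M) :
    (u - g) / M = u / M - if u % M < g then 1 else 0 := by
  have e := Int.mul_ediv_add_emod u M
  have h0 := Int.emod_nonneg u hM.ne'
  have h1 := Int.emod_lt_of_pos u hM
  split_ifs with hu
  · rw [show u - g = (u % M - g + M) + M * (u / M - 1) by linarith,
      Int.add_mul_ediv_left _ _ hM.ne', Int.ediv_eq_zero_of_lt (by omega) (by omega), zero_add]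
  · rw [show u - g = (u % M - g) + M * (u / M) by linarith,
      Int.add_mul_ediv_left _ _ hM.ne', Int.ediv_eq_zero_of_lt (by omega) (by omega)]
    ring

/-- The location of a blocked set is determined up to one block. -/
theorem Condensed.exists_dvd_sub_of_isLocated (hC : h.Condensed M H c q) {S : Finset h.Var}
    (hS : ¬ Unblocked S) {g g' b b' : ℤ} (hL : IsLocated M c q S g b)
    (hL' : IsLocated M c q S g' b') :
    ∃ ε, |ε| ≤ 1 ∧ ∏ j ∈ Finset.range h.rows, q j ∣ b' - b - ε := by
  have key : ∀ {g g' b b' : ℤ}, IsLocated M c q S g b → IsLocated M c q S g' b' → g' ≤ g →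
      ∃ ε, |ε| ≤ 1 ∧ ∏ j ∈ Finset.range h.rows, q j ∣ b' - b - ε := by
    clear hL hL'
    intro g g' b b' hL hL' hle
    have hk := rows_pos (h := h)
    obtain ⟨z₀, t₀, -, hz₀, hzt₀, -⟩ := hL'.exists_isSole 0 le_rfl hk
    refine ⟨if g' ≤ t₀ / h.rows % M ∧ t₀ / h.rows % M < g then 1 else 0, by split_ifs <;> simp,
      hC.prod_dvd fun j j0 j1 => ?_⟩
    obtain ⟨z, t, htj, hz, hzt, hd⟩ := hL.exists_isSole j j0 j1
    obtain ⟨z', t', htj', hz', hzt', hd'⟩ := hL'.exists_isSole j j0 j1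
    have h1 := hC.block_congr hS hL.isGap j0 j1 htj htj' hz hz' hzt rfl hzt' rfl
    have h2 := hC.arc_congr hS hL.isGap hL'.isGap hL'.nonneg hL.lt hz₀ hz' hzt₀ rfl hzt' rfl
    have e : h.block M g' t' - h.block M g t' =
        if g' ≤ t₀ / h.rows % M ∧ t₀ / h.rows % M < g then 1 else 0 := by
      rw [block, block, ediv_sub_of_lt hC.M_pos hL.nonneg hL.lt,
        ediv_sub_of_lt hC.M_pos hL'.nonneg hL'.lt]
      split_ifs <;> omega
    rw [← e]
    have h3 := dvd_sub (dvd_add hd' h1) hd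
    rwa [show b' - h.block M g' t' + (h.block M g t' - h.block M g t) - (b - h.block M g t) =
      b' - b - (h.block M g' t' - h.block M g t') by ring] at h3
  rcases le_total g' g with hle | hle
  · exact key hL hL' hle
  · obtain ⟨ε, hε, hd⟩ := key hL' hL hle
    refine ⟨-ε, by rwa [abs_neg], ?_⟩
    rw [← dvd_neg]
    rwa [show -(b' - b - -ε) = b - b' - ε by ring]

/-- If a blocked set meets all rows within an uncompressed zone at one of the ends, then it is
located near this end. -/
theorem Condensed.exists_dvd_sub_of_zone (hC : h.Condensed M H c q) {S : Finset h.Var}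
    (hS : ¬ Unblocked S) {g b E : ℤ} (hL : IsLocated M c q S g b) (hE : E = 0 ∨ E = H - 1)
    (hrow : ∀ r : ℤ, 0 ≤ r → r < h.rows → ∃ z ∈ S, ∃ t, z ∈ h.cls true t ∧ t % h.rows = r ∧
      M * E ≤ t / h.rows ∧ t / h.rows < M * E + M) :
    ∃ ε, |ε| ≤ 1 ∧ ∏ j ∈ Finset.range h.rows, q j ∣ b - E - ε := by
  have hk := rows_pos (h := h)
  have hM := hC.M_pos
  have h4 := hC.four_le
  have h4' := hC.four_rows_lt
  have hcol : ∀ j : ℤ, 0 ≤ j → j < h.rows → ∃ z t, IsSole S (t % h.rows) z ∧ z ∈ h.cls true t ∧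
      (t + h.rows < h.lo ∨ h.hi ≤ t) ∧ M * E ≤ t / h.rows ∧ t / h.rows < M * E + M ∧
      q j ∣ b - h.block M g t := by
    intro j j0 j1
    obtain ⟨z, t, htj, hz, hzt, hd⟩ := hL.exists_isSole j j0 j1
    obtain ⟨z', hz', t', hzt', ht', b1, b2⟩ := hrow (t % h.rows) (Int.emod_nonneg _ hk.ne')
      (Int.emod_lt_of_pos _ hk)
    obtain rfl := hz.2 z' hz' t' hzt' ht'
    have hout : t' + h.rows < h.lo ∨ h.hi ≤ t' := by
      rw [hC.lo_eq, hC.hi_eq]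
      rw [Int.le_ediv_iff_mul_le hk] at b1
      rw [Int.ediv_lt_iff_lt_mul hk] at b2
      rcases hE with rfl | rfl
      · left
        nlinarith
      · right
        nlinarith [mul_pos hM hk]
    obtain rfl := eq_of_mem_cls_of_outside hzt' hzt hout
    exact ⟨z', t, hz, hzt, hout, b1, b2, hd⟩
  obtain ⟨z₀, t₀, hz₀, hzt₀, hout₀, -⟩ := hcol 0 le_rfl hk
  refine ⟨if g + M * E ≤ t₀ / h.rows then 0 else -1, by split_ifs <;> simp,
    hC.prod_dvd fun j j0 j1 => ?_⟩
  obtain ⟨z, t, hz, hzt, hout, b1, b2, hd⟩ := hcol j j0 j1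
  have hu₀ : g + M * E ≤ 2 * M - 3 ∨ M * (H - 2) ≤ g + M * E := by
    have g0 := hL.nonneg
    have g1 := hL.lt
    have := h.two_le_rows
    rcases hE with rfl | rfl
    · left
      rw [mul_zero]
      omega
    · right
      nlinarith
  have hcongr : g + M * E ≤ t₀ / h.rows ↔ g + M * E ≤ t / h.rows :=
    ⟨hC.le_congr hS hL.isGap ⟨E, by ring⟩ hu₀ hz₀ hz hzt₀ rfl hzt rfl hout₀ hout,
      hC.le_congr hS hL.isGap ⟨E, by ring⟩ hu₀ hz hz₀ hzt rfl hzt₀ rfl hout hout₀⟩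
  have e : h.block M g t = E + if g + M * E ≤ t₀ / h.rows then 0 else -1 := by
    have g0 := hL.nonneg
    have g1 := hL.lt
    simp only [hcongr, block]
    split_ifs with hc
    · rw [show t / h.rows - g = (t / h.rows - g - M * E) + M * E by ring,
        Int.add_mul_ediv_left _ _ hM.ne', Int.ediv_eq_zero_of_lt (by omega) (by omega)]
      ring
    · rw [show t / h.rows - g = (t / h.rows - g - M * E + M) + M * (E - 1) by ring,
        Int.add_mul_ediv_left _ _ hM.ne', Int.ediv_eq_zero_of_lt (by omega) (by omega)]
      ring
  rw [sub_sub, ← e]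
  exact hd

end Helix

/-! ### The depth of narrow refutations -/

namespace Helix

variable {h : Helix} {M H c : ℤ} {q : ℤ → ℤ}

theorem IsFree.mono {S S' : Finset h.Var} {x : ℤ} (hS : IsFree S' x) (hSS : S ⊆ S') :
    IsFree S x := fun t h0 h1 z hz => hS t h0 h1 z (hSS hz)

/-- The position `x` is the first vertex of a column in the zone of `M` uncompressed columns at the
left end (`E = 0`) or at the right end (`E = H - 1`). -/
def IsSpot (h : Helix) (M H E x : ℤ) : Prop :=
  (E = 0 ∨ E = H - 1) ∧ ∃ i, 0 ≤ i ∧ i < M ∧ x = h.rows * (M * E + i)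

theorem IsSpot.inZone (hC : h.Condensed M H c q) {E x : ℤ} (hx : h.IsSpot M H E x) :
    h.InZone x := by
  obtain ⟨hE, i, i0, i1, rfl⟩ := hx
  have hk := rows_pos (h := h)
  have h4 := hC.four_rows_lt
  have h5 := hC.four_le
  rw [InZone, hC.len_eq, hC.lo_eq, hC.hi_eq]
  have e1 : (h.rows : ℤ) * (i + 1) ≤ h.rows * M := Int.mul_le_mul_of_nonneg_left (by omega) hk.le
  have e2 : (0 : ℤ) ≤ h.rows * i := by positivity
  have e3 : (h.rows : ℤ) * M * 4 ≤ h.rows * M * H :=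
    Int.mul_le_mul_of_nonneg_left h5 (mul_pos hk hC.M_pos).le
  have e4 : (h.rows : ℤ) * 1 ≤ h.rows * M := Int.mul_le_mul_of_nonneg_left (by omega) hk.le
  rcases hE with rfl | rfl
  · exact ⟨by linarith, by linarith, Or.inl (by linarith)⟩
  · exact ⟨by linarith, by linarith, Or.inr (by linarith)⟩

/-- Past a set that is not blocked, the violated constraint can be moved to any spot. -/
theorem ViolatesOnly.exists_move_of_unblocked (hC : h.Condensed M H c q) {α : h.Var → ZMod 2}
    {S : Finset h.Var} {E E' x x' : ℤ} (hα : ViolatesOnly α x) (hfree : IsFree S x)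
    (hx : h.IsSpot M H E x) (hx' : h.IsSpot M H E' x') (hS : Unblocked S) :
    ∃ α' : h.Var → ZMod 2, (∀ z ∈ S, α' z = α z) ∧ ViolatesOnly α' x' := by
  obtain ⟨R, hR, hRS⟩ := hS
  have hk := rows_pos (h := h)
  by_cases hxx : x = x'
  · subst hxx
    exact ⟨α, fun _ _ => rfl, hα⟩
  have z1 := hx.inZone hC
  have z2 := hx'.inZone hC
  have hne : x + h.rows ≤ x' ∨ x' + h.rows ≤ x := by
    obtain ⟨-, i, -, -, rfl⟩ := hx
    obtain ⟨-, i', -, -, rfl⟩ := hx'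
    rcases lt_trichotomy (M * E + i) (M * E' + i') with hlt | heq | hgt
    · left
      have := Int.mul_le_mul_of_nonneg_left (show M * E + i + 1 ≤ M * E' + i' by omega) hk.le
      linarith
    · exact (hxx (by rw [heq])).elim
    · right
      have := Int.mul_le_mul_of_nonneg_left (show M * E' + i' + 1 ≤ M * E + i by omega) hk.le
      linarith
  refine hα.exists_move hfree z1 z2 R hne ?_ fun s t _ _ z hz hzt => hRS s t z hz hzt
  have hmid : h.lo ≤ h.hi := by
    have := hC.lo_eq
    have := hC.hi_eq
    have := Int.mul_le_mul_of_nonneg_left (show 2 * M ≤ M * (H - 2) by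
      nlinarith [hC.four_le, hC.M_pos]) hk.le
    omega
  obtain ⟨-, -, hz1⟩ := z1
  obtain ⟨-, -, hz2⟩ := z2
  by_cases hmin : min x x' + h.rows ≤ h.lo ∧ h.hi ≤ max x x'
  · exact closed_truncFlow hR hmin.1 hmin.2
  · exact closed_truncFlow_of_zone (by omega)

/-- Within a zone where a row does not meet `S`, the violated constraint can be moved along that
row. -/
theorem ViolatesOnly.exists_move_of_row (hC : h.Condensed M H c q) {α : h.Var → ZMod 2}
    {S : Finset h.Var} {E x x' r : ℤ} (hα : ViolatesOnly α x) (hfree : IsFree S x)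
    (hx : h.IsSpot M H E x) (hx' : h.IsSpot M H E x') (h0 : 0 ≤ r) (h1 : r < h.rows)
    (hr : ∀ z ∈ S, ∀ t, z ∈ h.cls true t → t % h.rows = r → M * E ≤ t / h.rows →
      ¬ t / h.rows < M * E + M) :
    ∃ α' : h.Var → ZMod 2, (∀ z ∈ S, α' z = α z) ∧ ViolatesOnly α' x' := by
  have hk := rows_pos (h := h)
  by_cases hxx : x = x'
  · subst hxx
    exact ⟨α, fun _ _ => rfl, hα⟩
  have z1 := hx.inZone hC
  have z2 := hx'.inZone hC
  obtain ⟨hE, i, i0, i1, rfl⟩ := hx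
  obtain ⟨-, i', i0', i1', rfl⟩ := hx'
  have hne : h.rows * (M * E + i) + h.rows ≤ h.rows * (M * E + i') ∨
      h.rows * (M * E + i') + h.rows ≤ h.rows * (M * E + i) := by
    rcases lt_trichotomy i i' with hlt | heq | hgt
    · left
      have := Int.mul_le_mul_of_nonneg_left (show i + 1 ≤ i' by omega) hk.le
      linarith
    · exact (hxx (by rw [heq])).elim
    · right
      have := Int.mul_le_mul_of_nonneg_left (show i' + 1 ≤ i by omega) hk.le
      linarith
  have m0 : (h.rows : ℤ) * (M * E) ≤ min (h.rows * (M * E + i)) (h.rows * (M * E + i')) :=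
    le_min (Int.mul_le_mul_of_nonneg_left (by omega) hk.le)
      (Int.mul_le_mul_of_nonneg_left (by omega) hk.le)
  have m1 : max ((h.rows : ℤ) * (M * E + i)) (h.rows * (M * E + i')) + h.rows ≤
      h.rows * (M * E + M) := by
    have := Int.mul_le_mul_of_nonneg_left (show i + 1 ≤ M by omega) hk.le
    have := Int.mul_le_mul_of_nonneg_left (show i' + 1 ≤ M by omega) hk.le
    rw [← max_add_add_right]
    exact max_le (by linarith) (by linarith)
  refine hα.exists_move hfree z1 z2 (h.switchFaces r 1 fun _ => False) hne ?_ ?_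
  · refine closed_truncFlow_of_zone ?_
    rw [hC.lo_eq, hC.hi_eq]
    have := hC.M_pos
    have := mul_pos hk hC.M_pos
    rcases hE with rfl | rfl
    · left
      linarith
    · right
      linarith
  · intro s t ht0 ht1 z hz hzt
    refine flow_row_eq_zero ?_
    rintro rfl ht
    refine hr z hz t hzt (emod_rows_of_sub (r := r) h0 h1 (by rw [ht, sub_self, Int.zero_emod]))
      ?_ ?_
    · rw [Int.le_ediv_iff_mul_le hk]
      linarith
    · rw [Int.ediv_lt_iff_lt_mul hk]
      linarith

theorem viol_eq_of_charge {χ : Fin h.len → ZMod 2} (hχ : ∀ v, χ v = if (v : ℕ) = 0 then 1 else 0)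
    (α : h.Var → ZMod 2) (v : Fin h.len) :
    viol α ((v : ℕ) : ℤ) = ∑ x ∈ h.inc (v : ℕ), α x + χ v := by
  rw [viol, sum_inc, hχ]
  simp [divergence]

open scoped Classical in
/-- The variables of a clause. -/
noncomputable def support {X : Type*} (C : Clause X) : Finset X := C.1.image Prod.fst

theorem mem_support {X : Type*} {C : Clause X} {z : X} : z ∈ support C ↔ ∃ b, (z, b) ∈ C.1 := by
  classical
  simp [support]

theorem card_support_le {X : Type*} (C : Clause X) : (support C).card ≤ Clause.width C := by
  classical
  exact Finset.card_image_le

/-- A clause is not in the formula if it is falsified by an assignment that violates only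
constraints at a place that the clause does not touch. -/
theorem ViolatesOnly.notMem_compressedTseitin {χ : Fin h.len → ZMod 2}
    (hχ : ∀ v, χ v = if (v : ℕ) = 0 then 1 else 0) {C : Clause h.Var} {α : h.Var → ZMod 2} {x : ℤ}
    (hα : ViolatesOnly α x) (hαC : Falsifies α C) (hfree : IsFree (support C) x)
    (hx : x + h.rows ≤ h.len) : C ∉ h.compression.compressedTseitin χ := by
  intro hC
  obtain ⟨v, β, hβ, hl⟩ := mem_compressedTseitin.1 hC
  have hinc : ∀ z ∈ h.inc (v : ℕ), z ∈ support C ∧ α z = β z := by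
    intro z hz
    have hm := (hl (z, decide (β z = 0))).2 ⟨hz, by simp⟩
    have h1 := hαC _ hm
    simp only [decide_eq_true_eq] at h1
    have : ∀ a b : ZMod 2, (b = 0 ↔ a = 0) → a = b := by decide
    exact ⟨mem_support.2 ⟨_, hm⟩, this _ _ h1⟩
  have hv : viol α ((v : ℕ) : ℤ) ≠ 0 := by
    rw [viol_eq_of_charge hχ, Finset.sum_congr rfl fun z hz => (hinc z hz).2]
    have : ∀ a b : ZMod 2, a ≠ b → a + b ≠ 0 := by decide
    exact this _ _ hβ
  have hvx : x ≤ (v : ℕ) ∧ ((v : ℕ) : ℤ) < x + h.rows := by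
    by_contra hc
    exact hv (hα.viol_eq_zero _ (by omega) (by have := v.2; omega) (by omega))
  have h2 := h.two_le_rows
  have h3 := h.rows_le_lo
  have h4 := h.hi_add_rows_le
  have h5 := v.2
  -- the step to the next vertex does not exist at the right end of the helix
  by_cases hlast : (v : ℕ) + 1 < h.len
  · obtain ⟨z, hz⟩ := h.cls_nonempty (s := false) (t := (v : ℕ)) (by omega) (by simp; omega)
    exact hfree _ hvx.1 hvx.2 z (hinc z (mem_inc.2 ⟨_, _, Or.inl rfl, hz⟩)).1 hz
  · obtain ⟨z, hz⟩ := h.cls_nonempty (s := false) (t := ((v : ℕ) : ℤ) - 1) (by omega) (by simp)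
    exact hfree _ (by omega) (by omega) z (hinc z (mem_inc.2 ⟨_, _, Or.inr (by simp), hz⟩)).1 hz

/-- Modulo `P`, the locations `b` and `E` differ by at least `d`. -/
def IsFar (P d b E : ℤ) : Prop := ∀ z, d ≤ |b - E - z * P|

theorem IsFar.le {P d d' b E : ℤ} (hf : IsFar P d b E) (hd : d' ≤ d) : IsFar P d' b E :=
  fun z => hd.trans (hf z)

/-- A location cannot be close to both ends of the helix. -/
theorem exists_isFar {P D : ℤ} (hD : 2 * D ≤ H - 1) (hP : 2 * (H - 1) ≤ P) (hH : 1 ≤ H) (b : ℤ) :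
    ∃ E, (E = 0 ∨ E = H - 1) ∧ IsFar P D b E := by
  by_contra! hc
  obtain ⟨z, hz⟩ := not_forall.1 (hc 0 (Or.inl rfl))
  obtain ⟨z', hz'⟩ := not_forall.1 (hc _ (Or.inr rfl))
  rw [not_le, abs_lt] at hz hz'
  -- otherwise `H - 1` or `P - (H - 1)` would be smaller than `2 * D`
  rcases le_or_gt (z - z') 0 with h0 | h0
  · nlinarith
  · nlinarith

theorem IsFar.of_dvd {P d b b' E ε : ℤ} (hf : IsFar P d b E) (hε : |ε| ≤ 1)
    (hd : P ∣ b' - b - ε) : IsFar P (d - 1) b' E := by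
  obtain ⟨w, hw⟩ := hd
  intro z
  have h1 := hf (z - w)
  have e : b' - E - z * P = (b - E - (z - w) * P) + ε := by linear_combination hw
  have h2 := abs_sub_abs_le_abs_sub (b - E - (z - w) * P) (-ε)
  rw [abs_neg, sub_neg_eq_add, ← e] at h2
  linarith

/-- The state of the adversary at the clause `C`: an assignment that falsifies `C` and violates
constraints only at a spot near one end `E` of the helix, which `C` does not touch; a location of
the variables of `C` that lies at distance at least `d` from this end, unless they leave room for a
flow. -/
def Evades (M H c : ℤ) (q : ℤ → ℤ) (d : ℤ) (C : Clause h.Var) : Prop :=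
  ∃ E α x, h.IsSpot M H E x ∧ Falsifies α C ∧ IsFree (support C) x ∧ ViolatesOnly α x ∧
    (Unblocked (support C) ∨ ∃ g b, IsLocated M c q (support C) g b ∧
      IsFar (∏ j ∈ Finset.range h.rows, q j) d b E)

/-- The adversary finds a spot that is not touched even when a further variable is queried. -/
theorem Condensed.exists_spot (hC : h.Condensed M H c q) {S S' : Finset h.Var} (hSS : S ⊆ S')
    (hcard : (S'.card : ℤ) ≤ h.rows + c + 1) {D d : ℤ} (hD : 2 * D ≤ H - 1)
    (hP : 2 * (H - 1) ≤ ∏ j ∈ Finset.range h.rows, q j) (hd : 2 ≤ d) (hdD : d ≤ D) {E x : ℤ}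
    {α : h.Var → ZMod 2} (hx : h.IsSpot M H E x) (hfree : IsFree S x) (hα : ViolatesOnly α x)
    (hS : Unblocked S ∨ ∃ g b, IsLocated M c q S g b ∧
      IsFar (∏ j ∈ Finset.range h.rows, q j) d b E) :
    ∃ E' α' x', h.IsSpot M H E' x' ∧ IsFree S' x' ∧ ViolatesOnly α' x' ∧
      (∀ z ∈ S, α' z = α z) ∧ ∀ T ⊆ S', Unblocked T ∨ ∃ g b, IsLocated M c q T g b ∧
        IsFar (∏ j ∈ Finset.range h.rows, q j) (d - 1) b E' := by
  have hc1 := hC.c_lt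
  have spot : ∀ E', (E' = 0 ∨ E' = H - 1) → ∃ x', h.IsSpot M H E' x' ∧ IsFree S' x' := by
    intro E' hE'
    obtain ⟨i, i0, i1, hi⟩ := hC.exists_isFree (S := S') (by omega) (M * E')
    exact ⟨_, ⟨hE', i, i0, i1, rfl⟩, hi⟩
  by_cases hu' : Unblocked S'
  · obtain ⟨x', hx', hfree'⟩ := spot E hx.1
    obtain ⟨α', h1, h2⟩ := hα.exists_move_of_unblocked hC hfree hx hx' (hu'.mono hSS)
    exact ⟨E, α', x', hx', hfree', h2, h1, fun T hT => Or.inl (hu'.mono hT)⟩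
  obtain ⟨g', b', hL'⟩ := hC.exists_isLocated hcard hu'
  have hT : ∀ E', IsFar (∏ j ∈ Finset.range h.rows, q j) (d - 1) b' E' → ∀ T ⊆ S',
      Unblocked T ∨ ∃ g b, IsLocated M c q T g b ∧
        IsFar (∏ j ∈ Finset.range h.rows, q j) (d - 1) b E' := by
    intro E' hf T hT
    by_cases hu : Unblocked T
    · exact Or.inl hu
    · exact Or.inr ⟨g', b', hL'.mono hT hu, hf⟩
  by_cases hu : Unblocked S
  -- as long as nothing blocks the way, the adversary goes to the end farther from the new location
  · obtain ⟨E', hE', hf⟩ := exists_isFar hD hP (by have := hC.four_le; omega) b'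
    obtain ⟨x', hx', hfree'⟩ := spot E' hE'
    obtain ⟨α', h1, h2⟩ := hα.exists_move_of_unblocked hC hfree hx hx' hu
    exact ⟨E', α', x', hx', hfree', h2, h1, hT E' (hf.le (by omega))⟩
  · obtain ⟨g, b, hL, hf⟩ := hS.resolve_left hu
    obtain ⟨ε, hε, hdvd⟩ := hC.exists_dvd_sub_of_isLocated hu hL (hL'.mono hSS hu)
    obtain ⟨x', hx', hfree'⟩ := spot E hx.1
    -- the location is not at this end, so that some row can still be used there
    obtain ⟨r, r0, r1, hr⟩ : ∃ r : ℤ, 0 ≤ r ∧ r < h.rows ∧ ∀ z ∈ S, ∀ t, z ∈ h.cls true t →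
        t % h.rows = r → M * E ≤ t / h.rows → ¬ t / h.rows < M * E + M := by
      by_contra! hcon
      obtain ⟨ε', hε', w, hw⟩ := hC.exists_dvd_sub_of_zone hu hL hx.1 hcon
      have := hf w
      rw [show b - E - w * ∏ j ∈ Finset.range h.rows, q j = ε' by linear_combination hw] at this
      omega
    obtain ⟨α', h1, h2⟩ := hα.exists_move_of_row hC hfree hx hx' r0 r1 hr
    exact ⟨E, α', x', hx', hfree', h2, h1, hT E (hf.of_dvd hε hdvd)⟩

/-- The adversary can pass from every narrow clause to one of its premises. -/
theorem Condensed.evades_premise (hC : h.Condensed M H c q) {D d : ℤ} (hD : 2 * D ≤ H - 1)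
    (hP : 2 * (H - 1) ≤ ∏ j ∈ Finset.range h.rows, q j) (hd : 2 ≤ d) (hdD : d ≤ D)
    {C₁ C₂ C : Clause h.Var} (hw : (Clause.width C : ℤ) ≤ h.rows + c) (hr : IsResolvent C₁ C₂ C)
    (hev : Evades M H c q d C) : Evades M H c q (d - 1) C₁ ∨ Evades M H c q (d - 1) C₂ := by
  classical
  obtain ⟨y, hy₁, hy₂, hCC⟩ := hr
  obtain ⟨E, α, x, hx, hαC, hfree, hα, hS⟩ := hev
  have hcard := card_support_le C
  have hcard' := Finset.card_insert_le y (support C)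
  obtain ⟨E', α', x', hx', hfree', hα', hag, hT⟩ := hC.exists_spot
    (Finset.subset_insert y (support C)) (by omega) hD hP hd hdD hx hfree hα hS
  have hag' : ∀ l ∈ C.1, (l.2 = true ↔ α' l.1 = 0) := fun l hl => by
    rw [hag _ (mem_support.2 ⟨l.2, hl⟩)]
    exact hαC l hl
  have h₁ : ∀ l ∈ C₁.1, l = (y, true) ∨ l ∈ C.1 := fun l hl => by
    by_cases hl' : l = (y, true)
    · exact Or.inl hl'
    · exact Or.inr (by rw [hCC]; simp [hl, hl'])
  have h₂ : ∀ l ∈ C₂.1, l = (y, false) ∨ l ∈ C.1 := fun l hl => by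
    by_cases hl' : l = (y, false)
    · exact Or.inl hl'
    · exact Or.inr (by rw [hCC]; simp [hl, hl'])
  have hs₁ : support C₁ ⊆ insert y (support C) := fun z hz => by
    obtain ⟨b, hb⟩ := mem_support.1 hz
    rcases h₁ _ hb with h' | h'
    · exact Finset.mem_insert.2 (Or.inl (congrArg Prod.fst h'))
    · exact Finset.mem_insert_of_mem (mem_support.2 ⟨b, h'⟩)
  have hs₂ : support C₂ ⊆ insert y (support C) := fun z hz => by
    obtain ⟨b, hb⟩ := mem_support.1 hz
    rcases h₂ _ hb with h' | h'
    · exact Finset.mem_insert.2 (Or.inl (congrArg Prod.fst h'))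
    · exact Finset.mem_insert_of_mem (mem_support.2 ⟨b, h'⟩)
  -- the value of the variable that is resolved on selects the premise
  by_cases hy : α' y = 0
  · refine Or.inl ⟨E', α', x', hx', fun l hl => ?_, hfree'.mono hs₁, hα', hT _ hs₁⟩
    rcases h₁ l hl with rfl | hl'
    · simp [hy]
    · exact hag' l hl'
  · refine Or.inr ⟨E', α', x', hx', fun l hl => ?_, hfree'.mono hs₂, hα', hT _ hs₂⟩
    rcases h₂ l hl with rfl | hl'
    · simp [hy]
    · exact hag' l hl'

theorem evades_empty {D : ℤ} {C : Clause h.Var} (hC : h.Condensed M H c q) (h0 : C.1 = ∅) :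
    Evades M H c q D C := by
  have hs : support C = ∅ := by simp [support, h0]
  have hv : ∀ v : ℤ, viol (0 : h.Var → ZMod 2) v = if v = 0 then 1 else 0 := fun v => by
    simp [viol, divergence, val]
  refine ⟨0, 0, 0, ⟨Or.inl rfl, 0, le_rfl, hC.M_pos, by simp⟩, ?_, ?_, ⟨?_, ?_⟩, Or.inl ?_⟩
  · simp [Falsifies, h0]
  · simp [IsFree, hs]
  · intro v h1 h2 h3
    have := h.two_le_rows
    rw [hv, if_neg (by omega)]
  · have := h.two_le_rows
    simp only [hv, zero_add, Nat.cast_eq_zero]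
    rw [Finset.sum_ite_eq' _ 0, if_pos (Finset.mem_range.2 (by omega))]
  · exact unblocked_of_no_step (by simp [hs])

theorem hasPath_of_forall {X : Type*} {F : CNF X} (π : Refutation F) {Q : ℕ → Fin π.size → Prop}
    (hQ : ∀ m i, Q (m + 1) i → ∃ j, π.Edge j i ∧ Q m j) {m : ℕ} {i : Fin π.size} (hi : Q m i) :
    π.HasPath m := by
  have key : ∀ m i, Q m i → ∃ p : ℕ → Fin π.size, p m = i ∧
      ∀ t < m, π.Edge (p t) (p (t + 1)) := by
    intro m
    induction m with
    | zero => exact fun i _ => ⟨fun _ => i, rfl, by simp⟩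
    | succ m ih =>
      intro i hi
      obtain ⟨j, hj, hjQ⟩ := hQ m i hi
      obtain ⟨p, hp, hpE⟩ := ih j hjQ
      refine ⟨fun t => if t ≤ m then p t else i, by simp, fun t ht => ?_⟩
      rcases Nat.lt_succ_iff_lt_or_eq.1 ht with ht' | rfl
      · simpa [show t ≤ m by omega, show t + 1 ≤ m by omega] using hpE t ht'
      · simpa [hp] using hj
  obtain ⟨p, -, hp⟩ := key m i hi
  exact ⟨fun t => p t, fun t => by simpa using hp t t.2⟩

theorem le_depth {X : Type*} {F : CNF X} {π : Refutation F} {m : ℕ} (hm : π.HasPath m) :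
    m ≤ π.depth :=
  le_csSup ⟨π.size, fun _ hd => (Refutation.HasPath.lt_size hd).le⟩ hm

/-- Refutations of width at most `rows + c` are deep. -/
theorem Condensed.le_depth (hC : h.Condensed M H c q) {χ : Fin h.len → ZMod 2}
    (hχ : ∀ v, χ v = if (v : ℕ) = 0 then 1 else 0)
    (hP : 2 * (H - 1) ≤ ∏ j ∈ Finset.range h.rows, q j)
    (π : Refutation (h.compression.compressedTseitin χ)) (hπ : (π.width : ℤ) ≤ h.rows + c) {m : ℕ}
    (hm : 2 * (m + 1 : ℤ) ≤ H - 1) : m ≤ π.depth := by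
  obtain ⟨i, -, hi⟩ := π.last_empty
  refine Helix.le_depth (hasPath_of_forall π
    (Q := fun n i => n ≤ m ∧ Evades M H c q (n + 1) (π.clause i)) ?_
    (i := i) ⟨le_rfl, evades_empty hC hi⟩)
  rintro n i ⟨hn, hev⟩
  have hw : (Clause.width (π.clause i) : ℤ) ≤ h.rows + c := by
    have : Clause.width (π.clause i) ≤ π.width :=
      Finset.le_sup (f := fun i => Clause.width (π.clause i)) (Finset.mem_univ i)
    omega
  cases hp : π.premises i with
  | none =>
    obtain ⟨E, α, x, hx, hαC, hfree, hα, -⟩ := hev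
    exact (hα.notMem_compressedTseitin hχ hαC hfree (hx.inZone hC).2.1 (π.axiom_mem i hp)).elim
  | some jl =>
    obtain ⟨j, l⟩ := jl
    obtain ⟨-, -, hr⟩ := π.resolve i j l hp
    push_cast at hev
    rcases hC.evades_premise (D := m + 1) hm hP (by omega) (by omega) hw hr hev with hev' | hev'
    · exact ⟨j, ⟨j, l, hp, Or.inl rfl⟩, by omega, by simpa using hev'⟩
    · exact ⟨l, ⟨j, l, hp, Or.inr rfl⟩, by omega, by simpa using hev'⟩

end Helix

/-! ### Counting variables and clauses -/

namespace Helix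

variable {h : Helix}

open scoped Classical in
/-- Representatives of the classes of vertices. -/
noncomputable def reps (h : Helix) : Finset ℕ :=
  (Finset.range h.len).filter fun v =>
    (v : ℤ) < h.lo ∨ (h.hi : ℤ) ≤ v ∨ (v : ℤ) < h.lo + h.per ((v : ℤ) % h.rows)

theorem mem_reps {v : ℕ} : v ∈ h.reps ↔ v < h.len ∧
    ((v : ℤ) < h.lo ∨ (h.hi : ℤ) ≤ v ∨ (v : ℤ) < h.lo + h.per ((v : ℤ) % h.rows)) := by
  simp [reps]

theorem per_pos (i : ℤ) : 0 < h.per i := by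
  have := h.rows_lt_per i
  omega

theorem exists_mem_reps (hd : ∀ i, (h.rows : ℤ) ∣ h.per i) {v : ℕ} (hv : v < h.len) :
    ∃ w ∈ h.reps, w ≤ v ∧ (w = v ∨ h.Rel w v) := by
  by_cases hr : v ∈ h.reps
  · exact ⟨v, hr, le_rfl, Or.inl rfl⟩
  · rw [mem_reps, not_and] at hr
    have hr' := hr hv
    push Not at hr'
    obtain ⟨h1, h2, h3⟩ := hr'
    have hp := h.per_pos ((v : ℤ) % h.rows)
    set p := h.per ((v : ℤ) % h.rows) with hpdef
    have e := Int.mul_ediv_add_emod ((v : ℤ) - h.lo) p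
    have e0 := Int.emod_nonneg ((v : ℤ) - h.lo) hp.ne'
    have e1 := Int.emod_lt_of_pos ((v : ℤ) - h.lo) hp
    have e2 : 0 ≤ p * (((v : ℤ) - h.lo) / p) :=
      mul_nonneg hp.le (Int.ediv_nonneg (by omega) hp.le)
    obtain ⟨w, hw⟩ := Int.eq_ofNat_of_zero_le (show 0 ≤ (h.lo : ℤ) + ((v : ℤ) - h.lo) % p by omega)
    have hdvd : p ∣ (v : ℤ) - w := ⟨((v : ℤ) - h.lo) / p, by linarith⟩
    have hrow : (w : ℤ) % h.rows = (v : ℤ) % h.rows :=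
      (Int.modEq_iff_dvd.2 ((hd _).trans hdvd)).eq
    refine ⟨w, mem_reps.2 ⟨by omega, Or.inr (Or.inr ?_)⟩, by omega, Or.inr
      ⟨⟨by omega, by omega⟩, ⟨h1, h2⟩, hrow, ?_⟩⟩
    · rw [hrow, ← hpdef]
      omega
    · rw [hrow]
      exact hdvd

/-- Jumps that are less than a period apart are not identified. -/
theorem card_le_card_var {A : Finset ℕ} (h0 : ∀ v ∈ A, v + h.rows < h.len)
    (h1 : ∀ v ∈ A, ∀ w ∈ A, (v : ℤ) % h.rows = w % h.rows → (v : ℤ) - w < h.per (v % h.rows)) :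
    A.card ≤ Fintype.card h.Var := by
  classical
  have hne : ∀ v ∈ A, (h.cls true (v : ℤ)).Nonempty := fun v hv => by
    have := h0 v hv
    exact h.cls_nonempty (by omega) (by simp; omega)
  rcases A.eq_empty_or_nonempty with rfl | ⟨a, ha⟩
  · simp
  have : Nonempty h.Var := ⟨(hne a ha).choose⟩
  choose! z hz using hne
  refine Finset.card_le_card_of_injOn z (fun _ _ => Finset.mem_univ _) fun v hv w hw e => ?_
  have hzv := hz v hv
  rw [e] at hzv
  have hrow := (cls_invariant hzv (hz w hw)).2
  have d1 := per_dvd_of_mem_cls hzv (hz w hw)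
  have l1 := h1 v hv w hw hrow
  have l2 := h1 w hw v hv hrow.symm
  rw [← hrow] at l2
  by_contra hvw
  rcases lt_or_gt_of_ne hvw with hlt | hgt
  · have := Int.le_of_dvd (by omega) d1
    omega
  · rw [← dvd_neg, neg_sub] at d1
    have := Int.le_of_dvd (by omega) d1
    omega

theorem card_reps_le : h.reps.card ≤ h.lo + (h.len - h.hi) + Fintype.card h.Var := by
  classical
  set B := (Finset.Ico h.lo h.hi).filter fun v : ℕ =>
    (v : ℤ) < h.lo + h.per ((v : ℤ) % h.rows) with hB
  have hsub : h.reps ⊆ (Finset.range h.lo ∪ Finset.Ico h.hi h.len) ∪ B := by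
    intro v hv
    obtain ⟨h1, h2⟩ := mem_reps.1 hv
    simp only [hB, Finset.mem_union, Finset.mem_range, Finset.mem_Ico, Finset.mem_filter]
    by_cases h3 : v < h.lo
    · exact Or.inl (Or.inl h3)
    · by_cases h4 : h.hi ≤ v
      · exact Or.inl (Or.inr ⟨h4, h1⟩)
      · exact Or.inr ⟨by omega, by omega⟩
  have hBcard : B.card ≤ Fintype.card h.Var := by
    refine card_le_card_var (fun v hv => ?_) fun v hv w hw _ => ?_
    · have := h.hi_add_rows_le
      simp only [hB, Finset.mem_Ico, Finset.mem_filter] at hv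
      omega
    · simp only [hB, Finset.mem_Ico, Finset.mem_filter] at hv hw
      omega
  have h1 := Finset.card_le_card hsub
  have h2 := Finset.card_union_le (Finset.range h.lo ∪ Finset.Ico h.hi h.len) B
  have h3 := Finset.card_union_le (Finset.range h.lo) (Finset.Ico h.hi h.len)
  rw [Finset.card_range, Nat.card_Ico] at h3
  omega

theorem card_reps_le_of_per_le {W : ℕ} (hW : ∀ i, h.per i ≤ W) :
    h.reps.card ≤ h.lo + W + (h.len - h.hi) := by
  classical
  have hsub : h.reps ⊆ Finset.range (h.lo + W) ∪ Finset.Ico h.hi h.len := by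
    intro v hv
    obtain ⟨h1, h2⟩ := mem_reps.1 hv
    have := hW ((v : ℤ) % h.rows)
    simp only [Finset.mem_union, Finset.mem_range, Finset.mem_Ico]
    omega
  have h1 := Finset.card_le_card hsub
  have h2 := Finset.card_union_le (Finset.range (h.lo + W)) (Finset.Ico h.hi h.len)
  rw [Finset.card_range, Nat.card_Ico] at h2
  omega

/-- Every class of edges contains an edge whose smaller end is a representative. -/
theorem card_var_le (hd : ∀ i, (h.rows : ℤ) ∣ h.per i) :
    Fintype.card h.Var ≤ 2 * h.reps.card := by
  classical
  have hrep : ∀ z : h.Var, ∃ p : Bool × ℕ, p ∈ Finset.univ ×ˢ h.reps ∧ z ∈ h.cls p.1 (p.2 : ℤ) := by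
    intro z
    obtain ⟨s, t, hst⟩ := exists_mem_cls z
    obtain ⟨b0, b1⟩ := bounds_of_mem_cls hst
    have := h.step_pos s
    lift t to ℕ using b0
    obtain ⟨w, hw, hwt, rfl | hR⟩ := exists_mem_reps hd (v := t) (by omega)
    · exact ⟨(s, w), by simp [hw], hst⟩
    · obtain ⟨y, hy⟩ := h.cls_nonempty (s := s) (t := w) (by omega) (by omega)
      obtain rfl := (eq_of_mem_cls_of_rel hR).1 hy hst
      exact ⟨(s, w), by simp [hw], hy⟩
  choose p hp hpz using hrep
  have := Finset.card_le_card_of_injOn (s := Finset.univ) p (fun z _ => hp z)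
    fun z _ z' _ e => eq_of_mem_cls (hpz z) (by rw [e]; exact hpz z')
  rwa [Finset.card_univ, Finset.card_product, Finset.card_univ, Fintype.card_bool] at this

theorem inc_eq_of_rel {v w : Fin h.len} (hR : h.Rel (v : ℕ) (w : ℕ)) :
    h.inc (v : ℕ) = h.inc (w : ℕ) := by
  have key : ∀ {v w : Fin h.len}, h.Rel (v : ℕ) (w : ℕ) → h.inc (v : ℕ) ⊆ h.inc (w : ℕ) := by
    intro v w hR x hx
    have := h.rows_le_lo
    have := h.hi_add_rows_le
    have hw := hR.2.1
    obtain ⟨s, t, rfl | rfl, hst⟩ := mem_inc.1 hx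
    · have := h.step_le s
      obtain ⟨y, hy⟩ := h.cls_nonempty (s := s) (t := (w : ℕ)) (by omega) (by omega)
      obtain rfl := (eq_of_mem_cls_of_rel hR).1 hst hy
      exact mem_inc.2 ⟨s, _, Or.inl rfl, hy⟩
    · have := h.step_le s
      obtain ⟨y, hy⟩ := h.cls_nonempty (s := s) (t := (w : ℕ) - h.step s) (by omega) (by omega)
      obtain rfl := (eq_of_mem_cls_of_rel hR).2 hst hy
      exact mem_inc.2 ⟨s, _, Or.inr rfl, hy⟩
  exact (key hR).antisymm (key hR.symm)

variable {χ : Fin h.len → ZMod 2}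

theorem width_le_of_mem {C : Clause h.Var} (hC : C ∈ h.compression.compressedTseitin χ) :
    Clause.width C ≤ 4 := by
  obtain ⟨v, α, -, hl⟩ := mem_compressedTseitin.1 hC
  exact (Clause.width_le_card fun l hlC => ((hl l).1 hlC).1).trans (card_inc_le _)

theorem isKCNF : CNF.IsKCNF 4 (h.compression.compressedTseitin χ) := fun _ => width_le_of_mem

/-- There are at most `2 ^ 4` clauses for every class of vertices. -/
theorem card_compressedTseitin_le (hd : ∀ i, (h.rows : ℤ) ∣ h.per i) :
    (h.compression.compressedTseitin χ).card ≤ 16 * h.reps.card := by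
  classical
  have hrep : ∀ C ∈ h.compression.compressedTseitin χ, ∃ v ∈ h.reps,
      C.1.image Prod.fst = h.inc (v : ℤ) := by
    intro C hC
    obtain ⟨v, α, -, hl⟩ := mem_compressedTseitin.1 hC
    have himg : C.1.image Prod.fst = h.inc (v : ℕ) := by
      ext z
      rw [Finset.mem_image]
      constructor
      · rintro ⟨l, hlC, rfl⟩
        exact ((hl l).1 hlC).1
      · exact fun hz => ⟨(z, decide (α z = 0)), (hl _).2 ⟨hz, by simp⟩, rfl⟩
    obtain ⟨w, hw, hwv, e | hR⟩ := exists_mem_reps hd v.2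
    · exact ⟨w, hw, by rw [himg, e]⟩
    · exact ⟨w, hw, by rw [himg, inc_eq_of_rel (v := ⟨w, by have := v.2; omega⟩) (w := v) hR]⟩
  choose! v hv hvC using hrep
  refine Finset.card_le_mul_card_image_of_maps_to hv 16 fun w hw => ?_
  have : (h.inc (w : ℤ)).powerset.card ≤ 16 := by
    rw [Finset.card_powerset]
    exact (Nat.pow_le_pow_right two_pos (card_inc_le _)).trans (by norm_num)
  refine le_trans ?_ this
  -- a clause over the given variables is determined by its positive literals
  refine Finset.card_le_card_of_injOn
    (fun C => (h.inc (w : ℤ)).filter fun z => (z, true) ∈ C.1)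
    (fun C _ => Finset.mem_powerset.2 (Finset.filter_subset _ _)) fun C hC D hD e => ?_
  have key : ∀ {C : Clause h.Var}, C ∈ {C ∈ h.compression.compressedTseitin χ | v C = w} →
      ∀ z b, (z, b) ∈ C.1 ↔ z ∈ h.inc (w : ℤ) ∧
        (b = true ↔ z ∈ (h.inc (w : ℤ)).filter fun z => (z, true) ∈ C.1) := by
    intro C hC z b
    obtain ⟨hCF, rfl⟩ := Finset.mem_filter.1 hC
    have hin : ∀ b, (z, b) ∈ C.1 → z ∈ h.inc (v C : ℤ) := fun b hb => by
      rw [← hvC C hCF]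
      exact Finset.mem_image_of_mem Prod.fst hb
    have hout : z ∈ h.inc (v C : ℤ) → ∃ b, (z, b) ∈ C.1 := fun hz => by
      rw [← hvC C hCF] at hz
      obtain ⟨⟨z', b⟩, hb, rfl⟩ := Finset.mem_image.1 hz
      exact ⟨b, hb⟩
    have hno := C.2 z
    rw [Finset.mem_filter]
    constructor
    · intro hb
      refine ⟨hin b hb, ?_⟩
      cases b
      · have : (z, true) ∉ C.1 := fun h' => hno ⟨h', hb⟩
        simp [this]
      · simp [hb, hin _ hb]
    · rintro ⟨hz, hiff⟩
      obtain ⟨b', hb'⟩ := hout hz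
      cases b
      · have hnt : (z, true) ∉ C.1 := fun h' => by simp [hz, h'] at hiff
        cases b'
        · exact hb'
        · exact (hnt hb').elim
      · exact (hiff.1 rfl).2
  refine Subtype.ext (Finset.ext fun ⟨z, b⟩ => ?_)
  rw [key hC, key hD]
  simp only at e
  rw [e]

theorem size_compressedTseitin_le (hd : ∀ i, (h.rows : ℤ) ∣ h.per i) :
    CNF.size (h.compression.compressedTseitin χ) ≤ 64 * h.reps.card := by
  have h1 : CNF.size (h.compression.compressedTseitin χ) ≤
      (h.compression.compressedTseitin χ).card • 4 :=
    Finset.sum_le_card_nsmul _ _ _ fun C hC => width_le_of_mem hC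
  have h2 := card_compressedTseitin_le (χ := χ) hd
  rw [smul_eq_mul] at h1
  omega

/-- All classes of edges appear in the formula. -/
theorem vars_compressedTseitin : CNF.vars (h.compression.compressedTseitin χ) = Finset.univ := by
  classical
  refine Finset.eq_univ_of_forall fun z => ?_
  obtain ⟨s, t, hst⟩ := exists_mem_cls z
  obtain ⟨b0, b1⟩ := bounds_of_mem_cls hst
  have := h.step_pos s
  lift t to ℕ using b0
  have hz : z ∈ h.inc (t : ℕ) := mem_inc.2 ⟨s, _, Or.inl rfl, hst⟩
  obtain ⟨α, hα⟩ : ∃ α : h.Var → ZMod 2, ∑ x ∈ h.inc (t : ℕ), α x ≠ χ ⟨t, by omega⟩ := by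
    refine ⟨fun x => if x = z then χ ⟨t, by omega⟩ + 1 else 0, ?_⟩
    rw [Finset.sum_ite_eq', if_pos hz]
    simp
  obtain ⟨C, hC, -, -, h3⟩ := exists_clause (v := ⟨t, by omega⟩) hα
  obtain ⟨b, hb⟩ := h3 z hz
  simp only [CNF.vars, Finset.mem_biUnion, Finset.mem_image]
  exact ⟨C, hC, _, hb, rfl⟩

theorem one_le_depth (π : Refutation (h.compression.compressedTseitin χ)) : 1 ≤ π.depth := by
  obtain ⟨i, -, hi⟩ := π.last_empty
  refine le_depth ?_
  cases hp : π.premises i with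
  | none =>
    obtain ⟨v, α, -, hl⟩ := mem_compressedTseitin.1 (π.axiom_mem i hp)
    obtain ⟨z, hz⟩ := h.inc_nonempty v
    have := (hl (z, decide (α z = 0))).2 ⟨hz, by simp⟩
    simp [hi] at this
  | some jl =>
    refine ⟨![jl.1, i], fun t => ?_⟩
    obtain rfl : t = 0 := Subsingleton.elim _ _
    exact ⟨jl.1, jl.2, hp, Or.inl rfl⟩

end Helix

/-! ### The parameters -/

namespace Helix

/-- The factors that divide the period of the row `i`: the factor `j` is used in the `c + 1`
cyclically consecutive rows beginning with the row `j`. -/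
def factorsOf (k c : ℕ) (i : ℤ) : Finset ℕ :=
  (Finset.range k).filter fun j : ℕ => (i - j) % k ≤ c

theorem card_factorsOf {k c : ℕ} (hck : c < k) (i : ℤ) :
    (factorsOf k c i).card = c + 1 := by
  have hk : (0 : ℤ) < k := by omega
  rw [factorsOf, ← Finset.card_range (c + 1)]
  have aux : ∀ x : ℤ, (i - (i - x) % k) % k = x % k := fun x => by
    rw [Int.sub_emod, Int.emod_emod_of_dvd _ dvd_rfl, ← Int.sub_emod, sub_sub_cancel]
  refine Finset.card_nbij' (fun j => ((i - j) % k).toNat) (fun d => ((i - d) % k).toNat) ?_ ?_ ?_ ?_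
  · intro j hj
    have h0 := Int.emod_nonneg (i - j) hk.ne'
    simp only [Finset.coe_filter, Finset.mem_range, Set.mem_ofPred_eq, Finset.coe_range,
      Set.mem_Iio] at hj ⊢
    omega
  · intro d hd
    have h0 := Int.emod_nonneg (i - d) hk.ne'
    have h1 := Int.emod_lt_of_pos (i - d) hk
    simp only [Finset.coe_filter, Finset.mem_range, Set.mem_ofPred_eq, Finset.coe_range,
      Set.mem_Iio] at hd ⊢
    refine ⟨by omega, ?_⟩
    rw [Int.toNat_of_nonneg h0, aux, Int.emod_eq_of_lt (by omega) (by omega)]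
    omega
  · intro j hj
    simp only [Finset.coe_filter, Finset.mem_range, Set.mem_ofPred_eq] at hj
    have h0 := Int.emod_nonneg (i - j) hk.ne'
    simp only
    rw [Int.toNat_of_nonneg h0, aux, Int.emod_eq_of_lt (by omega) (by omega)]
    omega
  · intro d hd
    simp only [Finset.coe_range, Set.mem_Iio] at hd
    have h0 := Int.emod_nonneg (i - d) hk.ne'
    simp only
    rw [Int.toNat_of_nonneg h0, aux, Int.emod_eq_of_lt (by omega) (by omega)]
    omega

section Condense

variable {k c n H : ℕ} {Q : ℕ → ℕ}

theorem prod_factorsOf_pos (hQ : ∀ j, 0 < Q j) (i : ℤ) : 0 < ∏ j ∈ factorsOf k c i, Q j :=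
  Finset.prod_pos fun j _ => hQ j

/-- The helix with `k` rows and `8 * k * H` columns in which the period of the row `i` is
`8 * k * ∏ j ∈ factorsOf k c i, Q j` columns. The first and the last `16 * k` columns are not
compressed. -/
def condense (k c H : ℕ) (Q : ℕ → ℕ) (hk : 2 ≤ k) (hH : 2 ≤ H) (hQ : ∀ j, 0 < Q j) : Helix where
  len := k * (8 * k * H)
  rows := k
  lo := k * (2 * (8 * k))
  hi := k * (8 * k * (H - 2))
  per i := (k * (8 * k * ∏ j ∈ factorsOf k c i, Q j) : ℕ)
  two_le_rows := hk
  rows_lt_per i := by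
    have h1 : 1 ≤ ∏ j ∈ factorsOf k c i, Q j := prod_factorsOf_pos hQ i
    have h2 : 2 ≤ 8 * k * ∏ j ∈ factorsOf k c i, Q j := by nlinarith
    have h3 := Nat.mul_le_mul_left k h2
    exact_mod_cast (by omega : k < k * (8 * k * ∏ j ∈ factorsOf k c i, Q j))
  rows_le_lo := Nat.le_mul_of_pos_right k (by omega)
  hi_add_rows_le := by
    obtain ⟨H', rfl⟩ := Nat.exists_eq_add_of_le' hH
    rw [Nat.add_sub_cancel]
    nlinarith [Nat.mul_le_mul_left k (show 1 ≤ 8 * k * 2 by omega)]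

variable {hk : 2 ≤ k} {hH : 2 ≤ H} {hQ : ∀ j, 0 < Q j}

theorem rows_dvd_per_condense (i : ℤ) :
    ((condense k c H Q hk hH hQ).rows : ℤ) ∣ (condense k c H Q hk hH hQ).per i := by
  simp only [condense]
  push_cast
  exact dvd_mul_right _ _

theorem condensed_condense (hck : c < k) (h4 : 4 ≤ H)
    (hcop : ∀ i j, i < k → j < k → i ≠ j → Nat.Coprime (Q i) (Q j)) :
    (condense k c H Q hk hH hQ).Condensed (8 * k) H c fun j => Q j.toNat where
  len_eq := by simp [condense]
  lo_eq := by simp [condense]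
  hi_eq := by simp [condense, Nat.cast_sub hH]
  dvd_per i := by
    simp only [condense]
    push_cast
    exact mul_dvd_mul_left _ (dvd_mul_right _ _)
  mul_dvd_per i j j0 j1 hij := by
    lift j to ℕ using j0
    simp only [condense, Int.toNat_natCast] at j1 hij ⊢
    push_cast
    refine mul_dvd_mul_left _ (mul_dvd_mul_left _ (Finset.dvd_prod_of_mem _ ?_))
    rw [factorsOf, Finset.mem_filter, Finset.mem_range, Int.emod_sub_emod]
    exact ⟨by omega, hij⟩
  isCoprime i j i0 i1 j0 j1 hij := by
    lift i to ℕ using i0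
    lift j to ℕ using j0
    simp only [condense] at i1 j1
    exact Nat.isCoprime_iff_coprime.2 (hcop i j (by omega) (by omega) (by omega))
  four_rows_lt := by
    simp only [condense]
    omega
  four_le := by omega
  c_nonneg := by omega
  c_lt := by
    simp only [condense]
    omega

theorem per_condense_le (hck : c < k) (hQn : ∀ j, Q j ≤ 2 * n) (i : ℤ) :
    (condense k c H Q hk hH hQ).per i ≤ (k * (8 * k * (2 * n) ^ (c + 1)) : ℕ) := by
  have : ∏ j ∈ factorsOf k c i, Q j ≤ (2 * n) ^ (c + 1) := by
    rw [← card_factorsOf hck i]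
    exact Finset.prod_le_pow_card _ _ _ fun j _ => hQn j
  simp only [condense]
  exact_mod_cast Nat.mul_le_mul_left k (Nat.mul_le_mul_left (8 * k) this)

theorem le_per_condense (hck : c < k) (hQn : ∀ j, n ≤ Q j) (i : ℤ) :
    (k * (8 * k * n ^ (c + 1)) : ℕ) ≤ (condense k c H Q hk hH hQ).per i := by
  have : n ^ (c + 1) ≤ ∏ j ∈ factorsOf k c i, Q j := by
    rw [← card_factorsOf hck i]
    exact Finset.pow_card_le_prod _ _ _ fun j _ => hQn j
  simp only [condense]
  exact_mod_cast Nat.mul_le_mul_left k (Nat.mul_le_mul_left (8 * k) this)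

theorem card_reps_condense_le (hck : c < k) (hQn : ∀ j, Q j ≤ 2 * n) :
    (condense k c H Q hk hH hQ).reps.card ≤ 32 * k ^ 2 + 8 * k ^ 2 * (2 * n) ^ (c + 1) := by
  have h1 := card_reps_le_of_per_le (h := condense k c H Q hk hH hQ) (per_condense_le hck hQn)
  obtain ⟨H', rfl⟩ := Nat.exists_eq_add_of_le' hH
  simp only [condense, Nat.add_sub_cancel] at h1
  rw [show k * (8 * k * (H' + 2)) - k * (8 * k * H') = 16 * k ^ 2 by
    rw [Nat.sub_eq_iff_eq_add (Nat.mul_le_mul_left _ (Nat.mul_le_mul_left _ (by omega)))]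
    ring] at h1
  refine h1.trans (le_of_eq ?_)
  ring

theorem card_reps_condense_le_add :
    (condense k c H Q hk hH hQ).reps.card ≤
      32 * k ^ 2 + Fintype.card (condense k c H Q hk hH hQ).Var := by
  have h1 := card_reps_le (h := condense k c H Q hk hH hQ)
  obtain ⟨H', rfl⟩ := Nat.exists_eq_add_of_le' hH
  simp only [condense, Nat.add_sub_cancel] at h1
  rw [show k * (8 * k * (H' + 2)) - k * (8 * k * H') = 16 * k ^ 2 by
    rw [Nat.sub_eq_iff_eq_add (Nat.mul_le_mul_left _ (Nat.mul_le_mul_left _ (by omega)))]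
    ring] at h1
  refine h1.trans (le_of_eq ?_)
  simp only [condense, Nat.add_sub_cancel]
  ring

theorem le_card_var_condense (hck : c < k) (hQn : ∀ j, n ≤ Q j) (hx : 16 ≤ n ^ (c + 1))
    (hH' : n ^ (c + 1) ≤ 2 * H + 1) :
    2 * k ^ 2 * n ^ (c + 1) ≤ Fintype.card (condense k c H Q hk hH hQ).Var := by
  have h1 := card_le_card_var (h := condense k c H Q hk hH hQ)
    (A := Finset.range (k * (2 * k * n ^ (c + 1)))) (fun v hv => ?_) fun v hv w hw _ => ?_
  · rw [Finset.card_range] at h1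
    refine le_trans (le_of_eq ?_) h1
    ring
  · rw [Finset.mem_range] at hv
    have h2 : 2 * k * n ^ (c + 1) + 1 ≤ 8 * k * H := by nlinarith
    have h3 := Nat.mul_le_mul_left k h2
    simp only [condense]
    rw [mul_add] at h3
    omega
  · rw [Finset.mem_range] at hv
    have h2 := le_per_condense (hk := hk) (hH := hH) (hQ := hQ) hck hQn
      ((v : ℤ) % (condense k c H Q hk hH hQ).rows)
    have h3 : k * (2 * k * n ^ (c + 1)) ≤ k * (8 * k * n ^ (c + 1)) := by
      gcongr
      norm_num
    omega

end Condense

/-- The charge concentrated in the vertex `0`. -/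
def unitCharge (h : Helix) (v : Fin h.len) : ZMod 2 := if (v : ℕ) = 0 then 1 else 0

theorem sum_unitCharge (h : Helix) : ∑ v, h.unitCharge v = 1 := by
  have h1 := h.rows_le_lo
  have h2 := h.hi_add_rows_le
  have h3 := h.two_le_rows
  rw [Finset.sum_eq_single (⟨0, by omega⟩ : Fin h.len)]
  · simp [unitCharge]
  · intro v _ hv
    exact if_neg fun h0 => hv (Fin.ext h0)
  · simp

theorem unitCharge_congr (h : Helix) (u v : Fin h.len) (huv : h.compression.vertexEq u v) :
    h.unitCharge u = h.unitCharge v := by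
  obtain rfl | ⟨hu, hv, -⟩ := huv
  · rfl
  · have h1 := h.rows_le_lo
    have h3 := h.two_le_rows
    rw [unitCharge, unitCharge, if_neg (by omega), if_neg (by omega)]

/-- The compressed Tseitin formulas of condensed helices: the bounds that do not depend on the
arithmetic of the factors, and the depth bound for coprime factors. -/
theorem exists_compression {n k c : ℕ} (hc : 3 ≤ c) (hck : c < k) (hn : 2 ≤ n) {Q : ℕ → ℕ}
    (hQ : ∀ j, n ≤ Q j ∧ Q j ≤ 2 * n) :
    ∃ h : Helix, ∃ F : CNF h.Var, F = h.compression.compressedTseitin h.unitCharge ∧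
      CNF.IsKCNF 4 F ∧ CNF.size F ≤ 128 * (CNF.vars F).card ∧
      2 * k ^ 2 * n ^ (c + 1) ≤ (CNF.vars F).card ∧
      (CNF.vars F).card ≤ 40 * k ^ 2 * (2 * n) ^ (c + 1) ∧
      (∃ π : Refutation F, π.width ≤ k + 3 ∧ π.size ≤ 32 * (k ^ 2 * (4 * n) ^ k)) ∧
      ∀ π : Refutation F, 1 ≤ π.depth ∧
        ((∀ i j, i < k → j < k → i ≠ j → Nat.Coprime (Q i) (Q j)) → π.width ≤ k + c →
          n ^ k ≤ 16 * π.depth) := by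
  set P := ∏ j ∈ Finset.range k, Q j with hP
  have hP1 : n ^ k ≤ P := by
    have := Finset.pow_card_le_prod (Finset.range k) Q n fun j _ => (hQ j).1
    rwa [Finset.card_range] at this
  have hP2 : P ≤ (2 * n) ^ k := by
    have := Finset.prod_le_pow_card (Finset.range k) Q (2 * n) fun j _ => (hQ j).2
    rwa [Finset.card_range] at this
  have hx : 16 ≤ n ^ (c + 1) := calc
    16 = 2 ^ 4 := by norm_num
    _ ≤ n ^ 4 := Nat.pow_le_pow_left hn 4
    _ ≤ n ^ (c + 1) := Nat.pow_le_pow_right (by omega) (by omega)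
  have hxk : n ^ (c + 1) ≤ n ^ k := Nat.pow_le_pow_right (by omega) (by omega)
  have hk : 2 ≤ k := by omega
  have hH : 2 ≤ P / 2 := by omega
  have hQ0 : ∀ j, 0 < Q j := fun j => by
    have := (hQ j).1
    omega
  -- half the common period `P` of the rows puts the two ends at the largest distance modulo `P`
  set h := condense k c (P / 2) Q hk hH hQ0 with hh
  have hN1 : 2 * k ^ 2 * n ^ (c + 1) ≤ Fintype.card h.Var :=
    le_card_var_condense hck (fun j => (hQ j).1) hx (by omega)
  have hN2 : Fintype.card h.Var ≤ 2 * h.reps.card := card_var_le rows_dvd_per_condense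
  have hR1 : h.reps.card ≤ 32 * k ^ 2 + 8 * k ^ 2 * (2 * n) ^ (c + 1) :=
    card_reps_condense_le hck fun j => (hQ j).2
  have hR2 : h.reps.card ≤ 32 * k ^ 2 + Fintype.card h.Var := card_reps_condense_le_add
  refine ⟨h, _, rfl, isKCNF, ?_, ?_, ?_, ?_, fun π => ⟨one_le_depth π, fun hcop hπ => ?_⟩⟩
  · rw [vars_compressedTseitin, Finset.card_univ]
    have h1 := size_compressedTseitin_le (h := h) (χ := h.unitCharge) rows_dvd_per_condense
    nlinarith [Nat.mul_le_mul_left (2 * k ^ 2) hx]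
  · rwa [vars_compressedTseitin, Finset.card_univ]
  · rw [vars_compressedTseitin, Finset.card_univ]
    have hy : 16 ≤ (2 * n) ^ (c + 1) := hx.trans (Nat.pow_le_pow_left (by omega) _)
    nlinarith [Nat.mul_le_mul_left (k ^ 2) hy]
  · obtain ⟨π, h1, h2⟩ := exists_refutation (h := h) h.sum_unitCharge (show 3 ≤ k by omega)
    refine ⟨π, h1.trans (show k + 2 ≤ k + 3 by omega), h2.trans ?_⟩
    calc k * (8 * k * (P / 2)) * (8 * 2 ^ k) = 32 * (k ^ 2 * ((2 * (P / 2)) * 2 ^ k)) := by ring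
      _ ≤ 32 * (k ^ 2 * ((2 * n) ^ k * 2 ^ k)) := by
        gcongr
        omega
      _ = 32 * (k ^ 2 * (4 * n) ^ k) := by
        rw [← mul_pow]
        ring_nf
  · have hC : h.Condensed _ _ _ _ := condensed_condense hck (by omega) hcop
    have h1 := hC.le_depth (χ := h.unitCharge) (fun _ => rfl) (by
      have e : ∏ j ∈ Finset.range h.rows, ((Q ((j : ℕ) : ℤ).toNat : ℕ) : ℤ) = P := by
        rw [hP]
        push_cast
        exact Finset.prod_congr rfl fun j _ => by rw [Int.toNat_natCast]
      rw [e]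
      omega) π (by
        have : h.rows = k := rfl
        omega) (m := (P / 2 - 3) / 2) (by omega)
    omega

end Helix

/-! ### Primes between `n` and `2 * n` -/

/-- Primes in `(2 * n / 7, n / 3]` do not divide the central binomial coefficient. -/
theorem factorization_centralBinom_eq_zero {n p : ℕ} (hp : p.Prime) (h3 : 3 * p ≤ n)
    (h7 : 2 * n < 7 * p) (hs : 2 * n < p ^ 2) : n.centralBinom.factorization p = 0 := by
  rw [Nat.centralBinom, Nat.factorization_choose hp (by omega) (Nat.log_lt_of_lt_pow (by omega) hs)]
  refine Finset.card_eq_zero.2 (Finset.filter_eq_empty_iff.2 fun i hi => ?_)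
  obtain rfl : i = 1 := by
    rw [Finset.mem_Ico] at hi
    omega
  have e : n % p = n - 3 * p := by
    rw [show n = n - 3 * p + 3 * p by omega, Nat.add_mul_mod_self_right,
      Nat.mod_eq_of_lt (by omega), Nat.add_sub_cancel]
  rw [pow_one, show 2 * n - n = n by omega, e]
  omega

theorem prod_primes_Ico_le (m : ℕ) :
    ∏ p ∈ (Finset.Ico (m + 2) (2 * m + 2)).filter Nat.Prime, p ≤ 4 ^ m := by
  have h1 := primorial_add (m + 1) m
  have h2 := primorial_add_le (m := m + 1) (n := m) (by omega)
  rw [h1] at h2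
  have h3 := Nat.le_of_mul_le_mul_left h2 (primorial_pos _)
  rw [show m + 1 + 1 = m + 2 by ring, show m + 1 + m + 1 = 2 * m + 2 by ring] at h3
  refine h3.trans ?_
  rw [show m + 1 + m = 2 * m + 1 by ring, Nat.choose_symm_half]
  exact Nat.choose_middle_le_pow m

/-- A prime divides the central binomial coefficient to the first power at most, unless it is small,
and it is in one of three intervals if it does. -/
theorem centralBinom_le {n : ℕ} (hn : 2 < n) :
    n.centralBinom ≤
      (2 * n) ^ (Nat.sqrt (2 * n) + 1 + ((Finset.Ioc n (2 * n)).filter Nat.Prime).card) *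
        4 ^ (n / 3) * 4 ^ (2 * n / 7) := by
  classical
  set m := n / 3 with hm
  set B := Finset.Icc 1 (Nat.sqrt (2 * n)) ∪ {m + 1} ∪ (Finset.Ioc n (2 * n)).filter Nat.Prime
    with hB
  set I := (Finset.Ico (m + 2) (2 * m + 2)).filter Nat.Prime with hI
  set J := (Finset.range (2 * n / 7 + 1)).filter Nat.Prime with hJ
  have hBcard : B.card ≤
      Nat.sqrt (2 * n) + 1 + ((Finset.Ioc n (2 * n)).filter Nat.Prime).card := by
    refine (Finset.card_union_le _ _).trans (Nat.add_le_add_right ?_ _)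
    refine (Finset.card_union_le _ _).trans ?_
    simp
  have hterm : ∀ p ∈ Finset.range (2 * n + 1), p ^ n.centralBinom.factorization p ≤
      (if p ∈ B then 2 * n else 1) * (if p ∈ I then p else 1) * (if p ∈ J then p else 1) := by
    intro p hp
    have hI1 : 1 ≤ if p ∈ I then p else 1 := by
      split_ifs with h
      · exact (Finset.mem_filter.1 h).2.one_le
      · exact le_rfl
    have hJ1 : 1 ≤ if p ∈ J then p else 1 := by
      split_ifs with h
      · exact (Finset.mem_filter.1 h).2.one_le
      · exact le_rfl
    have hB1 : 1 ≤ if p ∈ B then 2 * n else 1 := by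
      split_ifs <;> omega
    have hone := Nat.mul_le_mul (Nat.mul_le_mul hB1 hI1) hJ1
    by_cases hpB : p ∈ B
    · rw [if_pos hpB, mul_assoc]
      exact (Nat.pow_factorization_choose_le (by omega)).trans
        (Nat.le_mul_of_pos_right _ (Nat.mul_pos hI1 hJ1))
    by_cases hpr : p.Prime
    swap
    · rwa [Nat.factorization_eq_zero_of_not_prime _ hpr]
    simp only [hB, Finset.mem_union, Finset.mem_Icc, Finset.mem_singleton, Finset.mem_filter,
      Finset.mem_Ioc, not_or, not_and, not_le] at hpB
    obtain ⟨⟨hp1, hp2⟩, hp3⟩ := hpB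
    rw [Finset.mem_range] at hp
    have hs : 2 * n < p ^ 2 := Nat.sqrt_lt'.1 (hp1 hpr.one_le)
    have hpn : p ≤ n := by
      by_contra hc
      exact hp3 ⟨by omega, by omega⟩ hpr
    by_cases h23 : 2 * n < 3 * p
    · rwa [Nat.factorization_centralBinom_of_two_mul_self_lt_three_mul hn hpn h23]
    have hv : p ^ n.centralBinom.factorization p ≤ p := by
      conv_rhs => rw [← pow_one p]
      exact Nat.pow_le_pow_right hpr.pos (Nat.factorization_choose_le_one hs)
    by_cases hpm : m + 2 ≤ p
    · have hpI : p ∈ I := Finset.mem_filter.2 ⟨Finset.mem_Ico.2 ⟨hpm, by omega⟩, hpr⟩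
      rw [if_pos hpI] at hone ⊢
      refine hv.trans ?_
      rw [mul_right_comm]
      exact Nat.le_mul_of_pos_left _ (Nat.mul_pos hB1 hJ1)
    by_cases hpJ : p ∈ J
    · rw [if_pos hpJ] at hone ⊢
      exact hv.trans (Nat.le_mul_of_pos_left _ (Nat.mul_pos hB1 hI1))
    · have h7 : 2 * n < 7 * p := by
        by_contra hc
        exact hpJ (Finset.mem_filter.2 ⟨Finset.mem_range.2 (by omega), hpr⟩)
      rwa [factorization_centralBinom_eq_zero hpr (by omega) h7 hs]
  have hprod : ∀ A : Finset ℕ, (∀ p ∈ A, 0 < p) →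
      ∏ p ∈ Finset.range (2 * n + 1), (if p ∈ A then p else 1) ≤ ∏ p ∈ A, p := by
    intro A hA
    rw [Finset.prod_ite_mem]
    exact Finset.prod_le_prod_of_subset_of_one_le' Finset.inter_subset_right
      fun p hp _ => hA p hp
  calc n.centralBinom = ∏ p ∈ Finset.range (2 * n + 1), p ^ n.centralBinom.factorization p :=
        (Nat.prod_pow_factorization_centralBinom n).symm
    _ ≤ _ := Finset.prod_le_prod' hterm
    _ ≤ _ := by
      rw [Finset.prod_mul_distrib, Finset.prod_mul_distrib]
      refine Nat.mul_le_mul (Nat.mul_le_mul ?_ ?_) ?_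
      · rw [Finset.prod_ite_mem, Finset.prod_const]
        exact Nat.pow_le_pow_right (by omega)
          ((Finset.card_le_card Finset.inter_subset_right).trans hBcard)
      · exact (hprod I fun p hp => (Finset.mem_filter.1 hp).2.pos).trans (prod_primes_Ico_le m)
      · exact (hprod J fun p hp => (Finset.mem_filter.1 hp).2.pos).trans
          (primorial_le_four_pow (2 * n / 7))

theorem eventually_le_card_primes : ∀ᶠ n : ℕ in Filter.atTop, (n : ℝ) / (2 * Real.log n) ≤
    ((Finset.Ioc n (2 * n)).filter Nat.Prime).card := by
  have h1 : ∀ᶠ x : ℝ in Filter.atTop, 50 ≤ Real.log x :=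
    Real.tendsto_log_atTop.eventually_ge_atTop 50
  have h2 : ∀ᶠ x : ℝ in Filter.atTop, ‖Real.log x‖ ≤ 1 / 400 * ‖x ^ (1 / 2 : ℝ)‖ :=
    (isLittleO_log_rpow_atTop (by norm_num)).bound (by norm_num)
  have h3 := (tendsto_natCast_atTop_atTop (R := ℝ)).eventually
    (h1.and (h2.and (Filter.eventually_ge_atTop (100 : ℝ))))
  filter_upwards [h3] with n ⟨hL, hLs, hn⟩
  set K := ((Finset.Ioc n (2 * n)).filter Nat.Prime).card with hK
  set L := Real.log n with hLdef
  have hn' : 100 ≤ n := by exact_mod_cast hn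
  rw [← Real.sqrt_eq_rpow, Real.norm_of_nonneg (by linarith), Real.norm_of_nonneg (by positivity)]
    at hLs
  set s := √(n : ℝ) with hs
  have hss : s * s = n := Real.mul_self_sqrt (by linarith)
  have hs10 : 10 ≤ s := Real.le_sqrt_of_sq_le (by norm_num; linarith)
  have hbin : 4 ^ n ≤ (2 * n) ^ (Nat.sqrt (2 * n) + 2 + K) * 4 ^ (n / 3) * 4 ^ (2 * n / 7) := calc
    4 ^ n ≤ 2 * n * n.centralBinom := Nat.four_pow_le_two_mul_self_mul_centralBinom n (by omega)
    _ ≤ 2 * n * ((2 * n) ^ (Nat.sqrt (2 * n) + 1 + K) * 4 ^ (n / 3) * 4 ^ (2 * n / 7)) :=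
      Nat.mul_le_mul_left _ (centralBinom_le (by omega))
    _ = _ := by ring
  have hlog : n * Real.log 4 ≤ (Nat.sqrt (2 * n) + 2 + K : ℕ) * Real.log (2 * n) +
      (n / 3 : ℕ) * Real.log 4 + (2 * n / 7 : ℕ) * Real.log 4 := by
    have h := Real.log_le_log (by positivity) (Nat.cast_le (α := ℝ).2 hbin)
    have hpos : (0 : ℝ) < 2 * n := by linarith
    push_cast at h
    rw [Real.log_mul (by positivity) (by positivity), Real.log_mul (by positivity) (by positivity),
      Real.log_pow, Real.log_pow, Real.log_pow, Real.log_pow] at h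
    push_cast at h ⊢
    exact h
  have hl2 := Real.log_two_gt_d9
  have hl2' := Real.log_two_lt_d9
  have hl4 : Real.log 4 = 2 * Real.log 2 := by
    rw [show (4 : ℝ) = 2 ^ 2 by norm_num, Real.log_pow]
    norm_num
  rw [Real.log_mul (by norm_num) (by linarith), ← hLdef, hl4] at hlog
  have hd3 : ((n / 3 : ℕ) : ℝ) ≤ n / 3 := Nat.cast_div_le
  have hd7 : ((2 * n / 7 : ℕ) : ℝ) ≤ 2 * n / 7 := by
    have := Nat.cast_div_le (α := ℝ) (m := 2 * n) (n := 7)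
    push_cast at this
    exact this
  have hsq : (Nat.sqrt (2 * n) : ℝ) ≤ 3 / 2 * s := by
    have h : ((Nat.sqrt (2 * n) * Nat.sqrt (2 * n) : ℕ) : ℝ) ≤ (2 * n : ℕ) :=
      Nat.cast_le.2 (Nat.sqrt_le (2 * n))
    push_cast at h
    refine abs_le_of_sq_le_sq' ?_ (by positivity) |>.2
    nlinarith
  push_cast at hlog
  -- the contribution of the small primes is negligible
  have hsmall : (Nat.sqrt (2 * n) + 2 : ℝ) * (Real.log 2 + L) ≤ 1 / 100 * n := calc
    (Nat.sqrt (2 * n) + 2 : ℝ) * (Real.log 2 + L) ≤ (2 * s) * (2 * L) := by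
      gcongr <;> linarith
    _ ≤ (2 * s) * (2 * (1 / 400 * s)) := by gcongr
    _ = 1 / 100 * n := by rw [← hss]; ring
  have hmain : 0.518 * n ≤ K * (Real.log 2 + L) := by
    have h3' := mul_le_mul_of_nonneg_right hd3 (by linarith : 0 ≤ 2 * Real.log 2)
    have h7' := mul_le_mul_of_nonneg_right hd7 (by linarith : 0 ≤ 2 * Real.log 2)
    have h8 := mul_le_mul_of_nonneg_left hl2.le (by linarith : (0 : ℝ) ≤ n)
    nlinarith
  rw [div_le_iff₀ (by linarith)]
  have hK0 : (0 : ℝ) ≤ K := Nat.cast_nonneg _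
  have : K * (Real.log 2 + L) ≤ K * (1.02 * L) := by
    gcongr
    linarith
  nlinarith

theorem exists_coprime_factors : ∃ n₀ : ℕ, ∀ n : ℕ, n₀ ≤ n → ∀ k : ℕ,
    (k : ℝ) - 1 < n / (2 * Real.log n) → ∃ Q : ℕ → ℕ, (∀ j, n ≤ Q j ∧ Q j ≤ 2 * n) ∧
      ∀ i j, i < k → j < k → i ≠ j → Nat.Coprime (Q i) (Q j) := by
  obtain ⟨n₀, h₀⟩ := Filter.eventually_atTop.1 eventually_le_card_primes
  refine ⟨n₀, fun n hn k hk => ?_⟩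
  set A := (Finset.Ioc n (2 * n)).filter Nat.Prime with hA
  have hkA : k ≤ A.card := by
    have h1 : (k : ℝ) < A.card + 1 := by linarith [h₀ n hn]
    exact Nat.lt_succ_iff.1 (by exact_mod_cast h1)
  have hmem : ∀ i : Fin A.card, n < A.equivFin.symm i ∧ (A.equivFin.symm i : ℕ) ≤ 2 * n ∧
      (A.equivFin.symm i : ℕ).Prime := fun i => by
    obtain ⟨h1, h2⟩ := Finset.mem_filter.1 (A.equivFin.symm i).2
    rw [Finset.mem_Ioc] at h1
    exact ⟨h1.1, h1.2, h2⟩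
  refine ⟨fun j => if hj : j < A.card then A.equivFin.symm ⟨j, hj⟩ else n, fun j => ?_,
    fun i j hi hj hij => ?_⟩
  · dsimp only
    split_ifs with hj
    · exact ⟨(hmem _).1.le, (hmem _).2.1⟩
    · omega
  · simp only [dif_pos (show i < A.card by omega), dif_pos (show j < A.card by omega)]
    refine (Nat.coprime_primes (hmem _).2.2 (hmem _).2.2).2 fun e => hij ?_
    have := A.equivFin.symm.injective (Subtype.ext e)
    simpa using this

theorem mainTheorem3 :
    ∃ A B δ : ℝ, 0 < A ∧ 0 < B ∧ 0 < δ ∧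
      ∀ n k c : ℕ, 3 ≤ c → (c : ℝ) ≤ (k : ℝ) - 1 → (k : ℝ) - 1 < n / (2 * Real.log n) →
        ∃ (V : Type) (_ : Fintype V) (Γ : GraphCompression V) (χ : V → ZMod 2)
          (F : CNF Γ.EdgeClass),
          ∑ v, χ v = 1 ∧ (∀ u v, Γ.vertexEq u v → χ u = χ v) ∧ F = Γ.compressedTseitin χ ∧
          CNF.IsKCNF 4 F ∧
          (CNF.size F : ℝ) ≤ A * (CNF.vars F).card ∧
          2 * k ^ 2 * n ^ (c + 1) ≤ (CNF.vars F).card ∧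
          (CNF.vars F).card ≤ 40 * k ^ 2 * (2 * n) ^ (c + 1) ∧
          (∃ π : Refutation F, π.width ≤ k + 3 ∧ (π.size : ℝ) ≤ B * (k ^ 2 * (4 * n) ^ k)) ∧
          ∀ π : Refutation F, π.width ≤ k + c → δ * (n : ℝ) ^ k ≤ π.depth := by
  obtain ⟨n₀, hn₀⟩ := exists_coprime_factors
  have hM : (0 : ℝ) < ((n₀ + 1) ^ (n₀ + 1) : ℕ) := by positivity
  -- the second term of the minimum covers the `n` without enough primes, where the depth bound is
  -- at most `1`
  refine ⟨128, 32, min (1 / 16) (1 / ((n₀ + 1) ^ (n₀ + 1) : ℕ)), by norm_num, by norm_num,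
    by positivity, fun n k c hc hck hkn => ?_⟩
  have hck' : c < k := by
    have : (c : ℝ) + 1 ≤ k := by linarith
    exact_mod_cast this
  have hk3 : (3 : ℝ) ≤ (k : ℝ) - 1 := by
    have : (3 : ℝ) ≤ c := by exact_mod_cast hc
    linarith
  have hn : 2 ≤ n := by
    by_contra hn
    interval_cases n <;> norm_num at hkn <;> linarith
  have hk_le : k ≤ n := by
    have hlog : (1 / 2 : ℝ) ≤ Real.log n := by
      have h1 : Real.log 2 ≤ Real.log n :=
        Real.log_le_log (by norm_num) (by exact_mod_cast hn)
      have := Real.log_two_gt_d9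
      linarith
    have h1 : (n : ℝ) / (2 * Real.log n) ≤ n := div_le_self (by positivity) (by linarith)
    have h2 : (k : ℝ) < n + 1 := by linarith
    exact_mod_cast Nat.lt_succ_iff.1 (by exact_mod_cast h2)
  obtain ⟨Q, hQ, hcop⟩ : ∃ Q : ℕ → ℕ, (∀ j, n ≤ Q j ∧ Q j ≤ 2 * n) ∧
      (n₀ ≤ n → ∀ i j, i < k → j < k → i ≠ j → Nat.Coprime (Q i) (Q j)) := by
    by_cases hle : n₀ ≤ n
    · obtain ⟨Q, h1, h2⟩ := hn₀ n hle k hkn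
      exact ⟨Q, h1, fun _ => h2⟩
    · exact ⟨fun _ => n, fun _ => ⟨le_rfl, Nat.le_mul_of_pos_left n two_pos⟩,
        fun h' => (hle h').elim⟩
  obtain ⟨h, F, hF, h1, h2, h3, h4, ⟨π, h5, h6⟩, h7⟩ := Helix.exists_compression hc hck' hn hQ
  refine ⟨Fin h.len, inferInstance, h.compression, h.unitCharge, F, h.sum_unitCharge,
    h.unitCharge_congr, hF, h1, by exact_mod_cast h2, h3, h4, ⟨π, h5, by exact_mod_cast h6⟩,
    fun π hπ => ?_⟩
  obtain ⟨h8, h9⟩ := h7 π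
  by_cases hle : n₀ ≤ n
  · have h10 : ((n ^ k : ℕ) : ℝ) ≤ (16 * π.depth : ℕ) := by exact_mod_cast h9 (hcop hle) hπ
    push_cast at h10
    calc _ ≤ 1 / 16 * (n : ℝ) ^ k := by
          gcongr
          exact min_le_left _ _
      _ ≤ _ := by linarith
  · have h10 : ((n ^ k : ℕ) : ℝ) ≤ ((n₀ + 1) ^ (n₀ + 1) : ℕ) := by
      exact_mod_cast (Nat.pow_le_pow_left (by omega : n ≤ n₀ + 1) k).trans
        (Nat.pow_le_pow_right (by omega) (by omega))
    have h11 : (1 : ℝ) ≤ π.depth := by exact_mod_cast h8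
    calc _ ≤ 1 / (((n₀ + 1) ^ (n₀ + 1) : ℕ) : ℝ) * (((n₀ + 1) ^ (n₀ + 1) : ℕ) : ℝ) := by
          rw [← Nat.cast_pow n k]
          gcongr
          exact min_le_right _ _
      _ = 1 := by field_simp
      _ ≤ _ := h11
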